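/- **Grids.** Let $(I,\mathbb A,m)$ be a probability space; write $|A|=m(A)$. A *grid* is a sequence $\mathcal P=(\mathcal P^k)_{k\ge 0}$ of finite families of measurable sets of positive measure, not all empty, with $\sup_k\sup_{Q\in\mathcal P^k}\#\{P\in\mathcal P^k: P\cap Q\ne\emptyset\}<\infty$. It is a *$(\lambda_1,\lambda_2)$-good grid*, $0<\lambda_1<\lambda_2<1$, if moreover $\mathcal P^0=\{I\}$; each $\mathcal P^k$ is a family of pairwise disjoint sets covering $I$ up to a null set; every $Q\in\mathcal P^{k+1}$ is contained in some $P\in\mathcal P^{k}$; $\lambda_1\le |Q|/|P|\le\lambda_2$ whenever $Q\subset P$, $Q\in\mathcal P^{k+1}$, $P\in\mathcal P^k$; and $\bigcup_k\mathcal P^k$ generates $\mathbb A$. Put $k_0(\Omega,\mathcal P)=\min\{k:\exists P\in\mathcal P^k,\ P\subset\Omega\}$ when this set of $k$ is nonempty. Fix a good grid $\mathcal P$ and $p\in[1,\infty)$, $q\in[1,\infty]$, $\epsilon>0$, $\gamma\in(0,1]$, $s,\beta,\delta>0$ with $s+\epsilon\le 1/p$, $s<\beta<1/p$, $\delta<\max\{s,\epsilon\}$.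 Let $t_0=p/(1-sp+\delta p)$. **Spaces.** For families of coefficients $c=(c_Q)$ put $\|c\|=\big(\sum_k(\sum_{Q\in\mathcal P^k}|c_Q|^p)^{q/p}\big)^{1/q}$ (a supremum over $k$ if $q=\infty$). For a grid, $a_Q=|Q|^{s-1/p}1_Q$. A *$\mathcal B^s_{p,q}$-representation* of $f\in L^p$ is a series $f=\sum_k\sum_{Q\in\mathcal P^k}c_Qa_Q$, with the series in $k$ absolutely convergent in $L^p$ and $\|c\|<\infty$; $\mathcal B^s_{p,q}$ is the space of complex functions having one, and $|f|_{\mathcal B^s_{p,q}}=\inf\|c\|$ over all representations. $\mathcal B^\beta_{p,q}(W)$, for $W\in\mathcal P$, is defined likewise (with $\beta$ for $s$), using only representations with $c_Q=0$ unless $Q\subset W$. A *Besov atom* on $Q$ is $b_Q\in\mathcal B^\beta_{p,q}(Q)$ with $|b_Q|_{\mathcal B^\beta_{p,q}(Q)}\le|Q|^{s-\beta}$. *Property GBS of $C_{GBS}>0$:* whenever $g=\sum_k\sum_{Q\in\mathcal P^k}d_Qb_Q$ with Besov atoms $b_Q$ on $Q$, $\|d\|<\infty$, and absolute convergence in $L^p$,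 there is a $\mathcal B^s_{p,q}$-representation $g=\sum z_Qa_Q$ with $\|z\|\le C_{GBS}\|d\|$. *Property GC of $C_{GC}\ge1$:* there are bounded linear functionals $f\mapsto k_Q^f$ on $L^1(m)$, $Q\in\mathcal P$, such that for each $f\in\mathcal B^s_{p,q}$ the series $\sum k_Q^fa_Q$ is a $\mathcal B^s_{p,q}$-representation of $f$ and $\|(k^f_Q)\|\le C_{GC}|f|_{\mathcal B^s_{p,q}}$. **Branches and potentials.** $\Omega\subset I$ is an *$(\alpha,C,\lambda)$-regular domain* if it contains an element of $\mathcal P$ and is the disjoint union of the sets of families $\mathcal F^k\subset\mathcal P^k$, $k\ge k_0(\Omega,\mathcal P)$, with $\sum_{Q\in\mathcal F^k}|Q|^\alpha\le C\lambda^{k-k_0(\Omega,\mathcal P)}|\Omega|^\alpha$. Let $\Lambda\subset\mathbb N$. For $r\in\Lambda$ let $I_r,J_r\subset I$ be measurable, $h_r:J_r\to I_r$ a bimeasurable bijection, $g_r:J_r\to\mathbb C$ measurable, $\mathcal G_r=(\mathcal G_r^k)_k$ a grid of subsets of $I_r$ with each $\mathcal G_r^k$ pairwise disjoint and $k_0(Q,\mathcal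 G_r)=k$ for $Q\in\mathcal G_r^k$, $a_r\in\mathbb R$, $\epsilon_r=\pm\epsilon$, and let $C_{DGD1}^r,\lambda_{DGD2}^r,C_{DC1}^r,\lambda_{DC2}^r,C_{DRP}^r>0$. Assume, for all $r$: 1. $m(Q)=0\iff m(h_r^{-1}(Q))=0$ for measurable $Q\subset I_r$; 2. for all $Q\in\mathcal G_r$: $h_r^{-1}(Q)$ is a $(1-sp,C_{DGD1}^r,\lambda_{DGD2}^r)$-regular domain; with $\kappa=|k_0(Q,\mathcal G_r)-k_0(h_r^{-1}(Q),\mathcal P)|$ one has $\kappa\ge a_r$ and $(|Q|/|h_r^{-1}(Q)|)^{\epsilon_r/|\epsilon_r|}\le C_{DC1}^r(\lambda_{DC2}^r)^{\kappa}$; 3. up to null sets, $I_r$ and $h_r^{-1}(Q)$, $Q\in\mathcal G_r$, are countable unions of elements of $\mathcal P$; 4. $|g_r1_W|_{\mathcal B^\beta_{p,q}(W)}\le C_{DRP}^r\big(|Q|/|h_r^{-1}(Q)|\big)^{1/p-s+\epsilon_r}|W|^{1/p-\beta}$ for all $W\in\mathcal P$, $Q\in\mathcal G_r$ with $W\subset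 J_r$, $h_r(W)\subset Q$; 5. $\lambda^r=\max\{(\lambda_{DC2}^r)^\epsilon,(\lambda_{DGD2}^r)^{1/p}\}<1$, and $\lambda=\sup_r\lambda^r<1$ (with $\lambda=0$ if $\Lambda=\emptyset$); 6. the sets $Q\in\bigcup_r\mathcal G_r$, together with the $Q\in\mathcal P$ disjoint from all $I_r$, generate $\mathbb A$. Let $\Theta_r=(C_{DC1}^r)^\epsilon C_{DRP}^r(C_{DGD1}^r)^{1/p}(\lambda^r)^{a_r(1-\gamma)}$, $D=2/(1-\lambda^\gamma)$, $N=\sup_{W\in\mathcal P}\#\{r:W\subset J_r\}$, $\Phi_r(f)=g_r\cdot(f\circ h_r)$ on $J_r$ and $0$ elsewhere, and $\Phi(f)=\sum_r\Phi_r(f)$. Assume also that there is $C'\ge0$ with $|\Phi f|_1\le\sum_r|\Phi_rf|_1\le C'|f|_{t_0}$ for all $f\in L^{t_0}(m)$. **Slicing.** A series $\sum_{Q\in\mathcal P}d_Qa_Q$ has a *$C$-regular slicing*, $C\ge0$, if it is a $\mathcal B^s_{p,q}$-representation of some $f$ and for each $r$ there is a $\mathcal B^s_{p,q}$-representation $f1_{I_r}=\sum_{Q\in\mathcal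 G_r}c_Q^ra_Q$ along $\mathcal G_r$, where $c^r_Q\ge0$ can be chosen if all $d_Q\ge0$, such that either $$\Big(\sum_j\big(\sum_r\Theta_r(\sum_{Q\in\mathcal G_r^j}|c_Q^r|^p)^{1/p}\big)^q\Big)^{1/q}\le C\|d\|\quad\text{or}\quad N^{1-1/p}\Big(\sum_j\big(\sum_r\Theta_r^p\sum_{Q\in\mathcal G_r^j}|c_Q^r|^p\big)^{q/p}\Big)^{1/q}\le C\|d\|$$ (suprema over $j$ if $q=\infty$; $N^0=1$ even if $N=\infty$). Assume $(C_{FR},C_{ES})$-*essential slicing*: there is a finite $\mathcal P'\subset\mathcal P$ such that for every $\mathcal B^s_{p,q}$-representation $\sum_{Q\in\mathcal P}d_Qa_Q$, the series $\sum_{Q\in\mathcal P\setminus\mathcal P'}d_Qa_Q$ has a $C_{ES}$-regular slicing and $\sum_{Q\in\mathcal P'}d_Qa_Q$ has a $C_{FR}$-regular slicing. **Theorem (Lasota–Yorke inequality).** Constants $C_{GBS}$ and $C_{GC}$ with properties GBS and GC exist for $(I,m,\mathcal P)$, $s,\beta,p,q$. For any such constants and any data as above, if $C_{GBS}\,D\,C_{ES}\,C_{GC}<1$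 and $|\Phi(f)|_1\le|f|_1$ for every $f\in\mathcal B^s_{p,q}$, then there is $C\ge0$ such that for every $n\ge0$ and every $f\in\mathcal B^s_{p,q}$ one has $\Phi^n(f)\in\mathcal B^s_{p,q}$ and $$|\Phi^n(f)|_{\mathcal B^s_{p,q}}\le C|f|_1+(C_{GBS}\,D\,C_{ES}\,C_{GC})^n|f|_{\mathcal B^s_{p,q}}.$$ -/

import Mathlib

open MeasureTheory Filter Topology
open scoped ENNReal

noncomputable section

namespace GoodGridBesov

variable {X Y : Type*} [MeasurableSpace X] [MeasurableSpace Y]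

/-! ## Grids -/

/-- A grid: finite families `P k` of measurable sets of positive measure, not all of them empty,
with uniformly bounded overlaps inside each family. -/
structure IsGrid (m : Measure X) (P : ℕ → Finset (Set X)) : Prop where
  measurableSet : ∀ k, ∀ Q ∈ P k, MeasurableSet Q
  pos : ∀ k, ∀ Q ∈ P k, 0 < m Q
  nonempty : ∃ k, (P k).Nonempty
  mult : ∃ C : ℕ, ∀ k, ∀ Q ∈ P k, {R : Set X | R ∈ P k ∧ (R ∩ Q).Nonempty}.ncard ≤ C

/-- A `(l₁, l₂)`-good grid. -/
structure IsGoodGrid (m : Measure X) (P : ℕ → Finset (Set X)) (l₁ l₂ : ℝ) : Prop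
    extends IsGrid m P where
  l₁_pos : 0 < l₁
  l₁_lt_l₂ : l₁ < l₂
  l₂_lt_one : l₂ < 1
  zero : P 0 = {Set.univ}
  cover : ∀ k, (⋃ Q ∈ P k, Q) =ᵐ[m] (Set.univ : Set X)
  disjoint : ∀ k, ∀ Q ∈ P k, ∀ R ∈ P k, Q ≠ R → Disjoint Q R
  nested : ∀ k, ∀ Q ∈ P (k + 1), ∃ R ∈ P k, Q ⊆ R
  ratio : ∀ k, ∀ Q ∈ P (k + 1), ∀ R ∈ P k, Q ⊆ R →
    l₁ ≤ m.real Q / m.real R ∧ m.real Q / m.real R ≤ l₂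
  generates : MeasurableSpace.generateFrom {Q : Set X | ∃ k, Q ∈ P k} = ‹MeasurableSpace X›

/-- `k₀(Ω, P)`: the least level at which some element of `P` is contained in `Ω`
(only used when there is one). -/
def k0 {Z : Type*} (P : ℕ → Finset (Set Z)) (Ω : Set Z) : ℕ :=
  sInf {k | ∃ Q ∈ P k, Q ⊆ Ω}

/-! ## Spaces defined by atoms -/

/-- The `ℓ^q` norm of a sequence of elements of `[0, ∞]`, `q ∈ [1, ∞]`. -/
def lqNorm (q : ℝ≥0∞) (u : ℕ → ℝ≥0∞) : ℝ≥0∞ :=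
  if q = ∞ then ⨆ k, u k else (∑' k, u k ^ q.toReal) ^ (1 / q.toReal)

/-- `(∑_k (∑_{Q ∈ P^k} |c_Q|^p)^{q/p})^{1/q}`. -/
def coefNorm (P : ℕ → Finset (Set X)) (p : ℝ) (q : ℝ≥0∞) (c : ℕ → Set X → ℂ) : ℝ≥0∞ :=
  lqNorm q fun k => (∑ Q ∈ P k, ‖c k Q‖ₑ ^ p) ^ (1 / p)

/-- `f = ∑_k ∑_{Q ∈ P^k} c_Q a_Q`, the series in `k` converging absolutely in `L^p`, and the
coefficients having finite norm. -/
structure IsAtomicRep (m : Measure X) (P : ℕ → Finset (Set X)) (p : ℝ) (q : ℝ≥0∞)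
    (a : ℕ → Set X → X → ℂ) (c : ℕ → Set X → ℂ) (f : X → ℂ) : Prop where
  memLp : MemLp f (ENNReal.ofReal p) m
  coefNorm_ne_top : coefNorm P p q c ≠ ∞
  abs_conv : ∑' k, eLpNorm (fun x => ∑ Q ∈ P k, c k Q * a k Q x) (ENNReal.ofReal p) m ≠ ∞
  tendsto : Tendsto
    (fun n => eLpNorm (fun x => f x - ∑ k ∈ Finset.range n, ∑ Q ∈ P k, c k Q * a k Q x)
      (ENNReal.ofReal p) m) atTop (𝓝 0)

/-- Souza's canonical atom `a_Q = |Q|^{s - 1/p} 1_Q`. -/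
def souzaAtom (m : Measure X) (s p : ℝ) (Q : Set X) : X → ℂ :=
  Q.indicator fun _ => ((m.real Q ^ (s - 1 / p) : ℝ) : ℂ)

/-- `∑_Q c_Q a_Q` is a `B^s_{p,q}`-representation of `f`. -/
def IsRep (m : Measure X) (P : ℕ → Finset (Set X)) (s p : ℝ) (q : ℝ≥0∞)
    (c : ℕ → Set X → ℂ) (f : X → ℂ) : Prop :=
  IsAtomicRep m P p q (fun _ Q => souzaAtom m s p Q) c f

/-- `f ∈ B^s_{p,q}`. -/
def MemBesov (m : Measure X) (P : ℕ → Finset (Set X)) (s p : ℝ) (q : ℝ≥0∞) (f : X → ℂ) : Prop :=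
  ∃ c, IsRep m P s p q c f

/-- The norm of `B^s_{p,q}` (equal to `∞` outside the space). -/
def besovNorm (m : Measure X) (P : ℕ → Finset (Set X)) (s p : ℝ) (q : ℝ≥0∞)
    (f : X → ℂ) : ℝ≥0∞ :=
  ⨅ (c : ℕ → Set X → ℂ) (_ : IsRep m P s p q c f), coefNorm P p q c

/-- The norm of `B^s_{p,q}(W)`, where only elements of the grid that are contained in `W` may have
a nonzero coefficient (equal to `∞` outside the space). -/
def besovNormOn (m : Measure X) (P : ℕ → Finset (Set X)) (s p : ℝ) (q : ℝ≥0∞) (W : Set X)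
    (f : X → ℂ) : ℝ≥0∞ :=
  ⨅ (c : ℕ → Set X → ℂ)
    (_ : IsRep m P s p q c f ∧ ∀ k, ∀ Q ∈ P k, c k Q ≠ 0 → Q ⊆ W), coefNorm P p q c

/-- `(s, β, p, q)`-Besov atoms supported on `Q`, normalized so that `a_Q` is one of them. -/
def IsBesovAtom (m : Measure X) (P : ℕ → Finset (Set X)) (s β p : ℝ) (q : ℝ≥0∞) (Q : Set X)
    (b : X → ℂ) : Prop :=
  besovNormOn m P β p q Q b ≤ ENNReal.ofReal (m.real Q ^ (s - β))

/-- `C` is admissible as `C_GBS`: every representation by Besov atoms can be converted into one by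
Souza's atoms, at the expense of a factor `C`. -/
def IsGBSConstant (m : Measure X) (P : ℕ → Finset (Set X)) (s β p : ℝ) (q : ℝ≥0∞)
    (C : ℝ) : Prop :=
  0 < C ∧ ∀ (g : X → ℂ) (d : ℕ → Set X → ℂ) (b : ℕ → Set X → X → ℂ),
    (∀ k, ∀ Q ∈ P k, IsBesovAtom m P s β p q Q (b k Q)) → IsAtomicRep m P p q b d g →
    ∃ z, IsRep m P s p q z g ∧ coefNorm P p q z ≤ ENNReal.ofReal C * coefNorm P p q d

/-- `C` is admissible as `C_GC`: there are bounded linear functionals `f ↦ k_Q^f` on `L¹`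
such that `∑ k_Q^f a_Q` represents every `f ∈ B^s_{p,q}`, with coefficients of norm at most
`C |f|`. -/
def IsGCConstant (m : Measure X) (P : ℕ → Finset (Set X)) (s p : ℝ) (q : ℝ≥0∞)
    (C : ℝ) : Prop :=
  1 ≤ C ∧ ∃ φ : ℕ → Set X → (Lp ℂ 1 m →L[ℂ] ℂ),
    ∀ f : Lp ℂ 1 m, MemBesov m P s p q f →
      IsRep m P s p q (fun k Q => φ k Q f) f ∧
      coefNorm P p q (fun k Q => φ k Q f) ≤ ENNReal.ofReal C * besovNorm m P s p q f

/-! ## Regular domains, branches and potentials -/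

/-- `(α, C, l)`-regular domains. -/
def IsRegularDomain (μ : Measure Y) (H : ℕ → Finset (Set Y)) (α C l : ℝ) (Ω : Set Y) : Prop :=
  (∃ k, ∃ Q ∈ H k, Q ⊆ Ω) ∧
  ∃ F : ℕ → Finset (Set Y),
    (∀ k, k0 H Ω ≤ k → F k ⊆ H k) ∧
    (Ω = ⋃ k, ⋃ (_ : k0 H Ω ≤ k), ⋃ Q ∈ F k, Q) ∧
    (∀ k, k0 H Ω ≤ k → ∀ k', k0 H Ω ≤ k' → ∀ Q ∈ F k, ∀ R ∈ F k', Q ≠ R → Disjoint Q R) ∧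
    ∀ k, k0 H Ω ≤ k →
      ∑ Q ∈ F k, μ.real Q ^ α ≤ C * l ^ (k - k0 H Ω) * μ.real Ω ^ α

/-- `Ω` is, up to a null set, a countable union of elements of the grid. -/
def IsAECountableUnion (m : Measure X) (P : ℕ → Finset (Set X)) (Ω : Set X) : Prop :=
  ∃ S : Set (Set X), S.Countable ∧ (∀ Q ∈ S, ∃ k, Q ∈ P k) ∧ Ω =ᵐ[m] ⋃₀ S

/-- `h⁻¹(Q)`, as a subset of the ambient space. -/
def preim {I : Set X} {J : Set Y} (h : J ≃ᵐ I) (Q : Set X) : Set Y :=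
  Subtype.val '' {y : J | (h y : X) ∈ Q}

/-- The extension by zero of a function on a subset. -/
def extendZero {J : Set Y} (g : J → ℂ) : Y → ℂ :=
  Function.extend Subtype.val g 0

/-- A `(s, p, a, e, DGD1, DGD2, DC1, DC2, G)`-branch `h : J → I`. -/
structure IsBranch (m : Measure X) (μ : Measure Y) (P : ℕ → Finset (Set X))
    (H : ℕ → Finset (Set Y)) (s p a e DGD1 DGD2 DC1 DC2 : ℝ) (G : ℕ → Finset (Set X))
    {I : Set X} {J : Set Y} (h : J ≃ᵐ I) : Prop where
  measurableSet_I : MeasurableSet I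
  measurableSet_J : MeasurableSet J
  DGD1_pos : 0 < DGD1
  DGD2_pos : 0 < DGD2
  DC1_pos : 0 < DC1
  DC2_pos : 0 < DC2
  /-- `G` is a grid on `I`, ... -/
  grid : IsGrid m G
  grid_subset : ∀ k, ∀ Q ∈ G k, Q ⊆ I
  /-- ... each of whose families is disjoint, and such that `k₀(Q, G) = k` for `Q ∈ G^k`. -/
  grid_disjoint : ∀ k, ∀ Q ∈ G k, ∀ R ∈ G k, Q ≠ R → Disjoint Q R
  grid_level : ∀ k, ∀ Q ∈ G k, k0 G Q = k
  null_iff : ∀ Q : Set X, MeasurableSet Q → Q ⊆ I → (m Q = 0 ↔ μ (preim h Q) = 0)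
  geometric : ∀ k, ∀ Q ∈ G k, IsRegularDomain μ H (1 - s * p) DGD1 DGD2 (preim h Q)
  scaling_le : ∀ k, ∀ Q ∈ G k, a ≤ |(k0 G Q : ℝ) - (k0 H (preim h Q) : ℝ)|
  scaling : ∀ k, ∀ Q ∈ G k, (m.real Q / μ.real (preim h Q)) ^ (e / |e|) ≤
    DC1 * DC2 ^ |(k0 G Q : ℝ) - (k0 H (preim h Q) : ℝ)|
  union_I : IsAECountableUnion m P I
  union_preim : ∀ k, ∀ W ∈ G k, IsAECountableUnion μ H (preim h W)

/-- A `(DRP, β, e)`-regular potential `g : J → ℂ` associated with the branch `h : J → I`. -/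
structure IsRegularPotential (m : Measure X) (μ : Measure Y)
    (H : ℕ → Finset (Set Y)) (s β p : ℝ) (q : ℝ≥0∞) (e DRP : ℝ) (G : ℕ → Finset (Set X))
    {I : Set X} {J : Set Y} (h : J ≃ᵐ I) (g : J → ℂ) : Prop where
  DRP_pos : 0 < DRP
  aestronglyMeasurable : AEStronglyMeasurable (extendZero g) μ
  norm_le : ∀ i, ∀ W ∈ H i, ∀ j, ∀ Q ∈ G j, W ⊆ J → (∀ y : J, (y : Y) ∈ W → (h y : X) ∈ Q) →
    besovNormOn μ H β p q W (W.indicator (extendZero g)) ≤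
      ENNReal.ofReal (DRP * (m.real Q / μ.real (preim h Q)) ^ (1 / p - s + e) *
        μ.real W ^ (1 / p - β))

/-! ## Transfer transformations -/

/-- The data of a transfer transformation: branches `h_r : J_r → I_r`, potentials `g_r`, local
grids `G_r`, and numbers `a_r`, `ε_r`, ... -/
structure TransferData (X Y : Type*) [MeasurableSpace X] [MeasurableSpace Y] (Λ : Type*) where
  I : Λ → Set X
  J : Λ → Set Y
  h : ∀ r, J r ≃ᵐ I r
  g : ∀ r, J r → ℂ
  G : Λ → ℕ → Finset (Set X)
  a : Λ → ℝ
  e : Λ → ℝ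
  DGD1 : Λ → ℝ
  DGD2 : Λ → ℝ
  DC1 : Λ → ℝ
  DC2 : Λ → ℝ
  DRP : Λ → ℝ

namespace TransferData

variable {Λ : Type*} (T : TransferData X Y Λ)

/-- `λ_DRS2^r = max {(λ_DC2^r)^ε, (λ_DGD2^r)^{1/p}}`. -/
def lam (p ε : ℝ) (r : Λ) : ℝ :=
  max (T.DC2 r ^ ε) (T.DGD2 r ^ (1 / p))

/-- `λ_DRS2 = sup_r λ_DRS2^r`. -/
def lamSup (p ε : ℝ) : ℝ :=
  ⨆ r, T.lam p ε r

/-- `Θ_r = (C_DC1^r)^ε C_DRP^r (C_DGD1^r)^{1/p} (λ_DRS2^r)^{a_r (1 - γ)}`. -/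
def Theta (p ε γ : ℝ) (r : Λ) : ℝ :=
  T.DC1 r ^ ε * T.DRP r * T.DGD1 r ^ (1 / p) * T.lam p ε r ^ (T.a r * (1 - γ))

/-- `C_D = 2 / (1 - λ_DRS2^γ)`. -/
def constD (p ε γ : ℝ) : ℝ :=
  2 / (1 - T.lamSup p ε ^ γ)

/-- The standing assumptions on branches and potentials. -/
structure Standing (m : Measure X) (μ : Measure Y) (P : ℕ → Finset (Set X))
    (H : ℕ → Finset (Set Y)) (s β p : ℝ) (q : ℝ≥0∞) (ε : ℝ) : Prop where
  abs_e : ∀ r, |T.e r| = ε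
  branch : ∀ r, IsBranch m μ P H s p (T.a r) (T.e r) (T.DGD1 r) (T.DGD2 r) (T.DC1 r) (T.DC2 r)
    (T.G r) (T.h r)
  generates : MeasurableSpace.generateFrom
    ({Q : Set X | ∃ r k, Q ∈ T.G r k ∧ Q ⊆ T.I r} ∪
      {Q : Set X | (∃ k, Q ∈ P k) ∧ ∀ r, Q ∩ T.I r = ∅}) = ‹MeasurableSpace X›
  potential : ∀ r, IsRegularPotential m μ H s β p q (T.e r) (T.DRP r) (T.G r) (T.h r) (T.g r)
  lam_lt_one : ∀ r, T.lam p ε r < 1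
  lamSup_lt_one : T.lamSup p ε < 1

/-- `Φ_r(f) = g_r · (f ∘ h_r)` on `J_r`, zero elsewhere. -/
def branchOp (r : Λ) (f : X → ℂ) : Y → ℂ :=
  extendZero fun y : T.J r => T.g r y * f (T.h r y)

/-- The transfer transformation `Φ(f) = ∑_r Φ_r(f)`. -/
def transfer (f : X → ℂ) : Y → ℂ :=
  fun y => ∑' r, T.branchOp r f y

/-- `|Φ f|_1 ≤ ∑_r |Φ_r f|_1 ≤ C |f|_t` for every `f ∈ L^t`. -/
def BoundedFrom (m : Measure X) (μ : Measure Y) (t : ℝ) : Prop :=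
  ∃ C : ℝ, 0 ≤ C ∧ ∀ f : X → ℂ, MemLp f (ENNReal.ofReal t) m →
    eLpNorm (T.transfer f) 1 μ ≤ ∑' r, eLpNorm (T.branchOp r f) 1 μ ∧
    ∑' r, eLpNorm (T.branchOp r f) 1 μ ≤ ENNReal.ofReal C * eLpNorm f (ENNReal.ofReal t) m

/-- `N = sup_{W ∈ H} #{r : W ⊆ J_r}`. -/
def overlap (H : ℕ → Finset (Set Y)) : ℕ∞ :=
  ⨆ (k : ℕ) (W : Set Y) (_ : W ∈ H k), {r : Λ | W ⊆ T.J r}.encard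

/-- The pair formed by the weighed family of sets of `T` and the series `∑ d_Q a_Q` has a
`C`-regular slicing. -/
def HasRegularSlicing (m : Measure X) (P : ℕ → Finset (Set X)) (H : ℕ → Finset (Set Y))
    (s p : ℝ) (q : ℝ≥0∞) (ε γ : ℝ) (C : ℝ) (d : ℕ → Set X → ℂ) : Prop :=
  0 ≤ C ∧ ∃ f : X → ℂ, IsRep m P s p q d f ∧
    ∃ c : Λ → ℕ → Set X → ℂ,
      (∀ r, IsRep m (T.G r) s p q (c r) ((T.I r).indicator f)) ∧
      (lqNorm q (fun j => ∑' r, ENNReal.ofReal (T.Theta p ε γ r) *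
            (∑ Q ∈ T.G r j, ‖c r j Q‖ₑ ^ p) ^ (1 / p))
          ≤ ENNReal.ofReal C * coefNorm P p q d ∨
        ((T.overlap H : ℕ∞) : ℝ≥0∞) ^ (1 - 1 / p) *
          lqNorm q (fun j => (∑' r, ENNReal.ofReal (T.Theta p ε γ r) ^ p *
            ∑ Q ∈ T.G r j, ‖c r j Q‖ₑ ^ p) ^ (1 / p))
          ≤ ENNReal.ofReal C * coefNorm P p q d) ∧
      ((∀ k, ∀ Q ∈ P k, ∃ t : ℝ, 0 ≤ t ∧ d k Q = t) →
        ∀ r j, ∀ Q ∈ T.G r j, ∃ t : ℝ, 0 ≤ t ∧ c r j Q = t)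

open scoped Classical in
/-- `(B^s_{p,q}, T)` has a `(CFR, CES)`-essential slicing: for a finite `P' ⊆ P` and all
representations `∑ d_Q a_Q`, the part outside `P'` has a `CES`-regular slicing and the part in `P'`
has a `CFR`-regular slicing. -/
def HasEssentialSlicing (m : Measure X) (P : ℕ → Finset (Set X)) (H : ℕ → Finset (Set Y))
    (s p : ℝ) (q : ℝ≥0∞) (ε γ : ℝ) (CFR CES : ℝ) : Prop :=
  ∃ P' : Finset (Set X), (∀ Q ∈ P', ∃ k, Q ∈ P k) ∧
    ∀ (f : X → ℂ) (d : ℕ → Set X → ℂ), IsRep m P s p q d f →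
      T.HasRegularSlicing m P H s p q ε γ CES (fun k Q => if Q ∈ P' then 0 else d k Q) ∧
      T.HasRegularSlicing m P H s p q ε γ CFR (fun k Q => if Q ∈ P' then d k Q else 0)

end TransferData

end GoodGridBesov

end

namespace GoodGridBesov

/-! ## Inequalities for sums and integrals in `[0, ∞]` -/

/-! Every estimate here compares two families of coefficients level by level. A cell at depth i
inside another has at most l₂^i of its measure, so coefficients passed between levels k and j pick
up a factor geometric in |k - j|. Minkowski's inequality handles the sums inside a level, and
Schur's test in ℓ^q (`lqNorm_kernel_le`) handles the sum over levels, its constant being the sum of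
a geometric series.

Constant for Besov atoms (`exists_isGBSConstant`): expand an atom on Q into cells R ⊆ Q with
exponent β, then renormalize to exponent s. The change of normalization costs |R|^(β - s), which
against the bound |Q|^(s - β) leaves (|R|/|Q|)^(β - s), and this decays with the depth of R in Q.

Linear coefficients (`exists_isGCConstant`): use the martingale differences |Q|^(1/p - s) (avg_Q f -
avg_parent f). Given any representation of f, its terms on the levels above Q are constant on the
parent and cancel in the difference. Only levels from that of Q on contribute, the contribution of
level j to level k being of order l₂^(s (j - k)) (`sum_diffCoef_le`).

Transfer operator (`exists_isRep_transfer`): if f 1_{I_r} = ∑ c_Q a_Q along G_r, then Φ_r f = ∑ c_Q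
|Q|^(s - 1/p) g_r 1_{h_r⁻¹ Q}. Each h_r⁻¹ Q is a disjoint union of cells W, and g_r 1_W is
controlled in B^β(W). The distortion of h_r, the regularity of the domain and the bound on g_r
combine so that the W of level k coming from a Q of level j have total weight at most Θ_r λ^(γ |k -
j|) (`branch_weight_le`). The kernel λ^(γ |k - j|) has Schur constant at most 2 / (1 - λ^γ) = D. The
sum over r is absorbed by either form of the slicing condition, and the GBS property turns the
pieces g_r 1_W into Souza atoms.

Lasota–Yorke: represent f by the GC functionals and split off the finite set P'. Outside P' the
factor is GBS · D · C_ES · GC. On P' there are only finitely many coefficients, each bounded by a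
multiple of |f|_1, and they produce the weak term (`exists_coefNorm_finite_le`). As Φ does not
increase the L¹ norm on the space, iterating adds the weak terms in a convergent geometric series
(`iterate_besovNorm_le`). -/

theorem lintegral_rpow_le_measure_univ {α : Type*} [MeasurableSpace α] (μ : Measure α)
    {u : α → ℝ≥0∞} (hu : AEMeasurable u μ) {q : ℝ} (hq : 1 ≤ q) :
    (∫⁻ x, u x ∂μ) ^ q ≤ μ Set.univ ^ (q - 1) * ∫⁻ x, u x ^ q ∂μ := by
  rcases hq.eq_or_lt with rfl | hq'
  · simp
  have hc : q.HolderConjugate q.conjExponent := .conjExponent hq'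
  have h := ENNReal.lintegral_mul_le_Lp_mul_Lq μ hc hu (aemeasurable_const (b := (1 : ℝ≥0∞)))
  have hq0 : (0 : ℝ) < q := by linarith
  simp only [Pi.mul_apply, mul_one, ENNReal.one_rpow, lintegral_const, one_mul] at h
  calc (∫⁻ x, u x ∂μ) ^ q
      ≤ ((∫⁻ x, u x ^ q ∂μ) ^ (1 / q) * μ Set.univ ^ (1 / q.conjExponent)) ^ q := by gcongr
    _ = μ Set.univ ^ (q - 1) * ∫⁻ x, u x ^ q ∂μ := by
        rw [ENNReal.mul_rpow_of_nonneg _ _ hq0.le, ← ENNReal.rpow_mul, ← ENNReal.rpow_mul, mul_comm]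
        congr 2
        · have := hc.symm.one_sub_inv
          rw [Real.conjExponent]
          have : q - 1 ≠ 0 := by linarith
          field_simp
        · rw [one_div_mul_cancel hq0.ne', ENNReal.rpow_one]

/-- Jensen for the counting measure with density w. The weights are the rows of a kernel in Schur's
test, and an indicator when the overlap of branches is counted. -/
theorem tsum_mul_rpow_le {ι : Type*} (w u : ι → ℝ≥0∞) {q : ℝ} (hq : 1 ≤ q) :
    (∑' i, w i * u i) ^ q ≤ (∑' i, w i) ^ (q - 1) * ∑' i, w i * u i ^ q := by
  let _ : MeasurableSpace ι := ⊤
  have hm : ∀ f : ι → ℝ≥0∞, Measurable f := fun f => measurable_from_top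
  have h := lintegral_rpow_le_measure_univ (Measure.count.withDensity w)
    (hm u).aemeasurable hq
  rw [lintegral_withDensity_eq_lintegral_mul _ (hm w) (hm _),
    lintegral_withDensity_eq_lintegral_mul _ (hm w) (hm _), withDensity_apply _ MeasurableSet.univ,
    Measure.restrict_univ, lintegral_count, lintegral_count, lintegral_count] at h
  simpa using h

/-- Minkowski for countably many functions: finite sums by induction, then monotone convergence
along the directed family of finite partial sums. -/
theorem lintegral_tsum_rpow_le {α ι : Type*} [MeasurableSpace α] [Countable ι] (μ : Measure α)
    {u : ι → α → ℝ≥0∞} (hu : ∀ i, AEMeasurable (u i) μ) {p : ℝ} (hp : 1 ≤ p) :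
    (∫⁻ x, (∑' i, u i x) ^ p ∂μ) ^ (1 / p) ≤ ∑' i, (∫⁻ x, u i x ^ p ∂μ) ^ (1 / p) := by
  have hp0 : 0 < p := by linarith
  have key : ∀ S : Finset ι, (∫⁻ x, (∑ i ∈ S, u i x) ^ p ∂μ) ^ (1 / p) ≤
      ∑ i ∈ S, (∫⁻ x, u i x ^ p ∂μ) ^ (1 / p) := by
    classical
    intro S
    induction S using Finset.induction_on with
    | empty => simp [hp0]
    | insert a S ha ih =>
      simp only [Finset.sum_insert ha]
      refine (ENNReal.lintegral_Lp_add_le (hu a)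
        (Finset.aemeasurable_fun_sum S fun i _ => hu i) hp).trans ?_
      gcongr
  rw [one_div, ENNReal.rpow_inv_le_iff hp0]
  have : ∀ x, (∑' i, u i x) ^ p = ⨆ S : Finset ι, (∑ i ∈ S, u i x) ^ p := fun x => by
    rw [ENNReal.tsum_eq_iSup_sum]
    exact (ENNReal.orderIsoRpow p hp0).map_iSup _
  simp only [this]
  rw [lintegral_iSup_directed]
  · refine iSup_le fun S => ?_
    rw [← ENNReal.rpow_inv_le_iff hp0, ← one_div]
    exact (key S).trans (ENNReal.sum_le_tsum S)
  · exact fun S => (Finset.aemeasurable_fun_sum S fun i _ => hu i).pow_const p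
  · refine Monotone.directed_le fun S T hST x => ?_
    dsimp only
    gcongr

theorem tsum_tsum_rpow_le {κ ι : Type*} [Countable ι] (u : ι → κ → ℝ≥0∞) {p : ℝ} (hp : 1 ≤ p) :
    (∑' k, (∑' i, u i k) ^ p) ^ (1 / p) ≤ ∑' i, (∑' k, u i k ^ p) ^ (1 / p) := by
  let _ : MeasurableSpace κ := ⊤
  have h := lintegral_tsum_rpow_le (Measure.count : Measure κ) (u := u)
    (fun i => measurable_from_top.aemeasurable) hp
  simpa only [lintegral_count] using h

theorem sum_tsum_rpow_le {κ ι : Type*} [Countable ι] (s : Finset κ) (u : ι → κ → ℝ≥0∞) {p : ℝ}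
    (hp : 1 ≤ p) :
    (∑ k ∈ s, (∑' i, u i k) ^ p) ^ (1 / p) ≤ ∑' i, (∑ k ∈ s, u i k ^ p) ^ (1 / p) := by
  have h := tsum_tsum_rpow_le (fun i (k : s) => u i k) hp
  simp only [tsum_fintype] at h
  rw [Finset.sum_coe_sort s fun k => (∑' i, u i k) ^ p] at h
  refine h.trans_eq (tsum_congr fun i => ?_)
  rw [Finset.sum_coe_sort s fun k => u i k ^ p]

theorem sum_add_rpow_le {κ : Type*} (s : Finset κ) (u v : κ → ℝ≥0∞) {p : ℝ} (hp : 1 ≤ p) :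
    (∑ k ∈ s, (u k + v k) ^ p) ^ (1 / p) ≤
      (∑ k ∈ s, u k ^ p) ^ (1 / p) + (∑ k ∈ s, v k ^ p) ^ (1 / p) :=
  ENNReal.Lp_add_le s u v hp

/-! ## The `ℓ^q` norm -/

theorem one_le_toReal_of_ne_top {q : ℝ≥0∞} (hq : 1 ≤ q) (h : q ≠ ∞) : 1 ≤ q.toReal := by
  simpa using ENNReal.toReal_mono h hq

theorem lqNorm_mono {q : ℝ≥0∞} {u v : ℕ → ℝ≥0∞} (h : ∀ k, u k ≤ v k) :
    lqNorm q u ≤ lqNorm q v := by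
  unfold lqNorm
  split_ifs
  · exact iSup_mono h
  · refine ENNReal.rpow_le_rpow (ENNReal.tsum_le_tsum fun k => ?_) (by positivity)
    exact ENNReal.rpow_le_rpow (h k) (by positivity)

theorem le_lqNorm {q : ℝ≥0∞} (hq : 1 ≤ q) (u : ℕ → ℝ≥0∞) (k : ℕ) : u k ≤ lqNorm q u := by
  unfold lqNorm
  split_ifs with h
  · exact le_iSup u k
  · have h1 : 0 < q.toReal := by linarith [one_le_toReal_of_ne_top hq h]
    rw [one_div, ENNReal.le_rpow_inv_iff h1]
    exact ENNReal.le_tsum (f := fun k => u k ^ q.toReal) k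

theorem lqNorm_tsum_le {ι : Type*} [Countable ι] {q : ℝ≥0∞} (hq : 1 ≤ q) (u : ι → ℕ → ℝ≥0∞) :
    lqNorm q (fun k => ∑' i, u i k) ≤ ∑' i, lqNorm q (u i) := by
  unfold lqNorm
  split_ifs with h
  · exact iSup_le fun k => ENNReal.tsum_le_tsum fun i => le_iSup (u i) k
  · exact tsum_tsum_rpow_le u (one_le_toReal_of_ne_top hq h)

theorem lqNorm_const_mul {q : ℝ≥0∞} (hq : 1 ≤ q) (c : ℝ≥0∞) (u : ℕ → ℝ≥0∞) :
    lqNorm q (fun k => c * u k) = c * lqNorm q u := by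
  unfold lqNorm
  split_ifs with h
  · exact (ENNReal.mul_iSup _ _).symm
  · have h1 : 0 < q.toReal := by linarith [one_le_toReal_of_ne_top hq h]
    simp_rw [ENNReal.mul_rpow_of_nonneg _ _ h1.le, ENNReal.tsum_mul_left]
    rw [ENNReal.mul_rpow_of_nonneg _ _ (by positivity), ← ENNReal.rpow_mul,
      mul_one_div_cancel h1.ne', ENNReal.rpow_one]

/-- Schur's test in `ℓ^q`. -/
theorem lqNorm_kernel_le {q : ℝ≥0∞} (hq : 1 ≤ q) (K : ℕ → ℕ → ℝ≥0∞) {S : ℝ≥0∞}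
    (hrow : ∀ k, ∑' j, K k j ≤ S) (hcol : ∀ j, ∑' k, K k j ≤ S) (u : ℕ → ℝ≥0∞) :
    lqNorm q (fun k => ∑' j, K k j * u j) ≤ S * lqNorm q u := by
  by_cases h : q = ∞
  · unfold lqNorm
    simp only [h, if_true]
    refine iSup_le fun k => ?_
    calc ∑' j, K k j * u j ≤ ∑' j, K k j * ⨆ i, u i :=
          ENNReal.tsum_le_tsum fun j => by gcongr; exact le_iSup u j
      _ ≤ S * ⨆ i, u i := by rw [ENNReal.tsum_mul_right]; gcongr; exact hrow k
  · have h1 := one_le_toReal_of_ne_top hq h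
    rw [← lqNorm_const_mul hq]
    unfold lqNorm
    simp only [h, if_false]
    set t := q.toReal
    refine ENNReal.rpow_le_rpow ?_ (by positivity)
    -- Row sums enter through Jensen as S^(t - 1). After exchanging the order of summation the
    -- column sums give one more S.
    calc ∑' k, (∑' j, K k j * u j) ^ t
        ≤ ∑' k, S ^ (t - 1) * ∑' j, K k j * u j ^ t := by
          refine ENNReal.tsum_le_tsum fun k => (tsum_mul_rpow_le _ _ h1).trans ?_
          gcongr
          exact hrow k
      _ = S ^ (t - 1) * ∑' j, (∑' k, K k j) * u j ^ t := by
          rw [ENNReal.tsum_mul_left, ENNReal.tsum_comm]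
          simp_rw [ENNReal.tsum_mul_right]
      _ ≤ S ^ (t - 1) * ∑' j, S * u j ^ t := by
          gcongr with j
          exact hcol j
      _ = ∑' j, (S * u j) ^ t := by
          rw [ENNReal.tsum_mul_left, ← mul_assoc]
          simp_rw [ENNReal.mul_rpow_of_nonneg _ _ (zero_le_one.trans h1)]
          rw [ENNReal.tsum_mul_left]
          congr 1
          conv_lhs => rw [← ENNReal.rpow_one S, ← ENNReal.rpow_mul, one_mul]
          rcases eq_or_ne t 1 with ht | ht
          · simp [ht]
          rw [← ENNReal.rpow_add_of_nonneg _ _ (by linarith) zero_le_one]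
          congr 1; ring

/-! ## Mixed norms -/

/-- The mixed `ℓ^q(ℓ^p)` norm of a nonnegative family indexed by a grid. -/
noncomputable def mixNorm {X : Type*} (P : ℕ → Finset (Set X)) (p : ℝ) (q : ℝ≥0∞)
    (x : ℕ → Set X → ℝ≥0∞) : ℝ≥0∞ :=
  lqNorm q fun k => (∑ Q ∈ P k, x k Q ^ p) ^ (1 / p)

section MixNorm

variable {X : Type*} {P : ℕ → Finset (Set X)} {p : ℝ} {q : ℝ≥0∞}

theorem mixNorm_mono (hp : 1 ≤ p) {x y : ℕ → Set X → ℝ≥0∞}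
    (h : ∀ k, ∀ Q ∈ P k, x k Q ≤ y k Q) : mixNorm P p q x ≤ mixNorm P p q y := by
  refine lqNorm_mono fun k => ENNReal.rpow_le_rpow (Finset.sum_le_sum fun Q hQ => ?_)
    (by positivity)
  exact ENNReal.rpow_le_rpow (h k Q hQ) (by linarith)

theorem sum_rpow_le_mixNorm (hq : 1 ≤ q) (x : ℕ → Set X → ℝ≥0∞) (k : ℕ) :
    (∑ Q ∈ P k, x k Q ^ p) ^ (1 / p) ≤ mixNorm P p q x :=
  le_lqNorm hq (fun k => (∑ Q ∈ P k, x k Q ^ p) ^ (1 / p)) k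

theorem le_mixNorm (hp : 1 ≤ p) (hq : 1 ≤ q) (x : ℕ → Set X → ℝ≥0∞) {k : ℕ} {Q : Set X}
    (hQ : Q ∈ P k) : x k Q ≤ mixNorm P p q x := by
  refine le_trans ?_ (sum_rpow_le_mixNorm hq x k)
  rw [one_div, ENNReal.le_rpow_inv_iff (by linarith)]
  exact Finset.single_le_sum (f := fun Q => x k Q ^ p) (fun _ _ => zero_le) hQ

theorem mixNorm_tsum_le {ι : Type*} [Countable ι] (hp : 1 ≤ p) (hq : 1 ≤ q)
    (x : ι → ℕ → Set X → ℝ≥0∞) :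
    mixNorm P p q (fun k Q => ∑' i, x i k Q) ≤ ∑' i, mixNorm P p q (x i) :=
  (lqNorm_mono fun k => sum_tsum_rpow_le (P k) (fun i => x i k) hp).trans
    (lqNorm_tsum_le hq _)

theorem mixNorm_const_mul (hp : 1 ≤ p) (hq : 1 ≤ q) (c : ℝ≥0∞) (x : ℕ → Set X → ℝ≥0∞) :
    mixNorm P p q (fun k Q => c * x k Q) = c * mixNorm P p q x := by
  have hp0 : 0 < p := by linarith
  unfold mixNorm
  rw [← lqNorm_const_mul hq]
  congr 1
  ext k
  simp_rw [ENNReal.mul_rpow_of_nonneg _ _ hp0.le]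
  rw [← Finset.mul_sum, ENNReal.mul_rpow_of_nonneg _ _ (by positivity), ← ENNReal.rpow_mul,
    mul_one_div_cancel hp0.ne', ENNReal.rpow_one]

end MixNorm

end GoodGridBesov

namespace GoodGridBesov

/-! ## Absolutely convergent series -/

theorem summable_of_tsum_enorm_ne_top {ι : Type*} {u : ι → ℂ} (h : ∑' i, ‖u i‖ₑ ≠ ∞) :
    Summable u := by
  have : Summable fun i => ‖u i‖₊ := ENNReal.tsum_coe_ne_top_iff_summable.1 h
  exact Summable.of_norm (NNReal.summable_coe.2 this)

theorem enorm_tsum_le {ι : Type*} (u : ι → ℂ) : ‖∑' i, u i‖ₑ ≤ ∑' i, ‖u i‖ₑ := by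
  by_cases h : ∑' i, ‖u i‖ₑ = ∞
  · simp [h]
  · have hs : Summable fun i => ‖u i‖₊ := ENNReal.tsum_coe_ne_top_iff_summable.1 h
    simp only [enorm_eq_nnnorm]
    rw [← ENNReal.coe_tsum hs]
    exact_mod_cast nnnorm_tsum_le hs

theorem tsum_comm_of_enorm {ι κ : Type*} {u : ι → κ → ℂ} (h : ∑' i, ∑' k, ‖u i k‖ₑ ≠ ∞) :
    ∑' i, ∑' k, u i k = ∑' k, ∑' i, u i k := by
  rw [← ENNReal.tsum_prod (f := fun i k => ‖u i k‖ₑ)] at h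
  exact (summable_of_tsum_enorm_ne_top (u := fun x : ι × κ => u x.1 x.2) h).tsum_comm.symm

/-- Interchange of an infinite sum with an iterated sum whose inner sums are finite. -/
theorem tsum_tsum_sum_comm_of_enorm {ι κ ξ : Type*} {s : κ → Finset ξ} {u : ι → κ → ξ → ℂ}
    (h : ∑' i, ∑' k, ∑ j ∈ s k, ‖u i k j‖ₑ ≠ ∞) :
    ∑' i, ∑' k, ∑ j ∈ s k, u i k j = ∑' k, ∑ j ∈ s k, ∑' i, u i k j := by
  rw [tsum_comm_of_enorm]
  · refine tsum_congr fun k => Summable.tsum_finsetSum fun j hj => ?_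
    refine summable_of_tsum_enorm_ne_top (ne_top_of_le_ne_top h ?_)
    refine ENNReal.tsum_le_tsum fun i => le_trans ?_ (ENNReal.le_tsum k)
    exact Finset.single_le_sum (f := fun j => ‖u i k j‖ₑ) (fun _ _ => zero_le) hj
  · refine ne_top_of_le_ne_top h (ENNReal.tsum_le_tsum fun i => ENNReal.tsum_le_tsum fun k => ?_)
    exact enorm_sum_le _ _

theorem tsum_tsum_sum_comm {ι κ ξ : Type*} {s : κ → Finset ξ} (u : ι → κ → ξ → ℝ≥0∞) :
    ∑' i, ∑' k, ∑ j ∈ s k, u i k j = ∑' k, ∑ j ∈ s k, ∑' i, u i k j := by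
  rw [ENNReal.tsum_comm]
  exact tsum_congr fun k => Summable.tsum_finsetSum fun j _ => ENNReal.summable

section LpSeries

variable {X : Type*} [MeasurableSpace X] {m : Measure X} {p : ℝ}

theorem eLpNorm_ofReal_eq (hp : 1 ≤ p) (f : X → ℂ) :
    eLpNorm f (ENNReal.ofReal p) m = (∫⁻ x, ‖f x‖ₑ ^ p ∂m) ^ (1 / p) := by
  have hp0 : 0 < p := by linarith
  rw [eLpNorm_eq_lintegral_rpow_enorm_toReal (by simpa using hp0) ENNReal.ofReal_ne_top,
    ENNReal.toReal_ofReal hp0.le]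

theorem one_le_ofReal (hp : 1 ≤ p) : 1 ≤ ENNReal.ofReal p := by simpa using hp

theorem lintegral_rpow_mono (hp : 1 ≤ p) {u v : X → ℝ≥0∞} (h : ∀ᵐ x ∂m, u x ≤ v x) :
    (∫⁻ x, u x ^ p ∂m) ^ (1 / p) ≤ (∫⁻ x, v x ^ p ∂m) ^ (1 / p) := by
  refine ENNReal.rpow_le_rpow (lintegral_mono_ae ?_) (by positivity)
  filter_upwards [h] with x hx
  exact ENNReal.rpow_le_rpow hx (by linarith)

theorem ae_ne_top_of_lintegral_rpow (hp : 1 ≤ p) {u : X → ℝ≥0∞} (hu : AEMeasurable u m)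
    (h : (∫⁻ x, u x ^ p ∂m) ^ (1 / p) ≠ ∞) : ∀ᵐ x ∂m, u x ≠ ∞ := by
  have hp0 : 0 < p := by linarith
  have h' : ∫⁻ x, u x ^ p ∂m ≠ ∞ := fun hc => h (by
    rw [hc, ENNReal.top_rpow_of_pos (by positivity)])
  filter_upwards [ae_lt_top' (hu.pow_const p) h'] with x hx hc
  rw [hc, ENNReal.top_rpow_of_pos hp0] at hx
  exact lt_irrefl _ hx

variable {u : ℕ → X → ℂ}

theorem ae_tsum_enorm_ne_top (hp : 1 ≤ p) (hu : ∀ k, AEStronglyMeasurable (u k) m)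
    (habs : ∑' k, eLpNorm (u k) (ENNReal.ofReal p) m ≠ ∞) :
    ∀ᵐ x ∂m, ∑' k, ‖u k x‖ₑ ≠ ∞ := by
  refine ae_ne_top_of_lintegral_rpow hp
    (AEMeasurable.tsum (f := fun k x => ‖u k x‖ₑ) fun k => (hu k).enorm) ?_
  refine ne_top_of_le_ne_top habs ((lintegral_tsum_rpow_le m (fun k => (hu k).enorm) hp).trans ?_)
  simp only [eLpNorm_ofReal_eq hp, le_refl]

theorem aestronglyMeasurable_of_ae_eq_tsum (hp : 1 ≤ p) (hu : ∀ k, AEStronglyMeasurable (u k) m)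
    (habs : ∑' k, eLpNorm (u k) (ENNReal.ofReal p) m ≠ ∞) {F : X → ℂ}
    (hF : F =ᵐ[m] fun x => ∑' k, u k x) : AEStronglyMeasurable F m := by
  refine AEStronglyMeasurable.congr ?_ hF.symm
  refine aestronglyMeasurable_of_tendsto_ae atTop
    (f := fun n x => ∑ k ∈ Finset.range n, u k x) (fun n => ?_) ?_
  · exact Finset.aestronglyMeasurable_fun_sum _ fun k _ => hu k
  · filter_upwards [ae_tsum_enorm_ne_top hp hu habs] with x hx
    exact (summable_of_tsum_enorm_ne_top hx).hasSum.tendsto_sum_nat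

theorem eLpNorm_sub_sum_range_le (hp : 1 ≤ p) (hu : ∀ k, AEStronglyMeasurable (u k) m)
    (habs : ∑' k, eLpNorm (u k) (ENNReal.ofReal p) m ≠ ∞) {F : X → ℂ}
    (hF : F =ᵐ[m] fun x => ∑' k, u k x) (n : ℕ) :
    eLpNorm (fun x => F x - ∑ k ∈ Finset.range n, u k x) (ENNReal.ofReal p) m ≤
      ∑' k, eLpNorm (u (k + n)) (ENNReal.ofReal p) m := by
  simp only [eLpNorm_ofReal_eq hp]
  refine le_trans (lintegral_rpow_mono hp ?_)
    (lintegral_tsum_rpow_le m (fun k => (hu (k + n)).enorm) hp)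
  filter_upwards [hF, ae_tsum_enorm_ne_top hp hu habs] with x hx hx'
  rw [hx, ← (summable_of_tsum_enorm_ne_top hx').sum_add_tsum_nat_add n, add_sub_cancel_left]
  exact enorm_tsum_le _

theorem tendsto_of_ae_eq_tsum (hp : 1 ≤ p) (hu : ∀ k, AEStronglyMeasurable (u k) m)
    (habs : ∑' k, eLpNorm (u k) (ENNReal.ofReal p) m ≠ ∞) {F : X → ℂ}
    (hF : F =ᵐ[m] fun x => ∑' k, u k x) :
    Tendsto (fun n => eLpNorm (fun x => F x - ∑ k ∈ Finset.range n, u k x)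
      (ENNReal.ofReal p) m) atTop (𝓝 0) :=
  tendsto_of_tendsto_of_tendsto_of_le_of_le tendsto_const_nhds
    (ENNReal.tendsto_sum_nat_add _ habs) (fun _ => zero_le)
    (eLpNorm_sub_sum_range_le hp hu habs hF)

theorem memLp_of_ae_eq_tsum (hp : 1 ≤ p) (hu : ∀ k, AEStronglyMeasurable (u k) m)
    (habs : ∑' k, eLpNorm (u k) (ENNReal.ofReal p) m ≠ ∞) {F : X → ℂ}
    (hF : F =ᵐ[m] fun x => ∑' k, u k x) : MemLp F (ENNReal.ofReal p) m := by
  refine ⟨aestronglyMeasurable_of_ae_eq_tsum hp hu habs hF, ?_⟩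
  have h := eLpNorm_sub_sum_range_le hp hu habs hF 0
  simp only [Finset.range_zero, Finset.sum_empty, sub_zero, add_zero] at h
  exact h.trans_lt habs.lt_top

theorem ae_eq_tsum_of_tendsto (hp : 1 ≤ p) (hu : ∀ k, AEStronglyMeasurable (u k) m)
    (habs : ∑' k, eLpNorm (u k) (ENNReal.ofReal p) m ≠ ∞) {F : X → ℂ}
    (hF : AEStronglyMeasurable F m)
    (ht : Tendsto (fun n => eLpNorm (fun x => F x - ∑ k ∈ Finset.range n, u k x)
      (ENNReal.ofReal p) m) atTop (𝓝 0)) : F =ᵐ[m] fun x => ∑' k, u k x := by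
  set G : X → ℂ := fun x => ∑' k, u k x with hG
  have hGm := aestronglyMeasurable_of_ae_eq_tsum hp hu habs (F := G) (EventuallyEq.refl _ _)
  have hGt := tendsto_of_ae_eq_tsum hp hu habs (F := G) (EventuallyEq.refl _ _)
  have hS : ∀ n, AEStronglyMeasurable (fun x => ∑ k ∈ Finset.range n, u k x) m := fun n =>
    Finset.aestronglyMeasurable_fun_sum _ fun k _ => hu k
  have h0 : eLpNorm (F - G) (ENNReal.ofReal p) m ≤ 0 := by
    have hsum := ht.add hGt
    rw [add_zero] at hsum
    refine ge_of_tendsto hsum (Eventually.of_forall fun n => ?_)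
    have e : F - G = (fun x => F x - ∑ k ∈ Finset.range n, u k x) -
        fun x => G x - ∑ k ∈ Finset.range n, u k x := by
      ext x; simp
    rw [e]
    exact eLpNorm_sub_le (hF.sub (hS n)) (hGm.sub (hS n)) (one_le_ofReal hp)
  have := (eLpNorm_eq_zero_iff (hF.sub hGm) (by simpa using (by linarith : (0:ℝ) < p))).1
    (le_antisymm h0 zero_le)
  filter_upwards [this] with x hx
  exact sub_eq_zero.1 hx

end LpSeries

/-! ## Atomic representations -/

section Rep

variable {X : Type*} [MeasurableSpace X] {m : Measure X} {P : ℕ → Finset (Set X)}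
  {p s : ℝ} {q : ℝ≥0∞}

/-- By Minkowski, absolute convergence in L^p forces absolute convergence at almost every point, and
the two limits agree. Representations can therefore be rearranged pointwise. -/
theorem isAtomicRep_iff (hp : 1 ≤ p) {a : ℕ → Set X → X → ℂ} {c : ℕ → Set X → ℂ} {f : X → ℂ}
    (ha : ∀ k, AEStronglyMeasurable (fun x => ∑ Q ∈ P k, c k Q * a k Q x) m) :
    IsAtomicRep m P p q a c f ↔ coefNorm P p q c ≠ ∞ ∧
      ∑' k, eLpNorm (fun x => ∑ Q ∈ P k, c k Q * a k Q x) (ENNReal.ofReal p) m ≠ ∞ ∧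
      f =ᵐ[m] fun x => ∑' k, ∑ Q ∈ P k, c k Q * a k Q x :=
  ⟨fun h => ⟨h.2, h.3, ae_eq_tsum_of_tendsto hp ha h.3 h.1.1 h.4⟩,
    fun h => ⟨memLp_of_ae_eq_tsum hp ha h.2.1 h.2.2, h.1, h.2.1,
      tendsto_of_ae_eq_tsum hp ha h.2.1 h.2.2⟩⟩

theorem measurable_souzaAtom {Q : Set X} (hQ : MeasurableSet Q) :
    Measurable (souzaAtom m s p Q) := measurable_const.indicator hQ

theorem IsGrid.measurable_block (hP : IsGrid m P) (c : ℕ → Set X → ℂ) (k : ℕ) :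
    Measurable fun x => ∑ Q ∈ P k, c k Q * souzaAtom m s p Q x :=
  Finset.measurable_fun_sum _ fun Q hQ =>
    (measurable_souzaAtom (hP.measurableSet k Q hQ)).const_mul _

theorem IsRep.congr {c : ℕ → Set X → ℂ} {f g : X → ℂ} (h : IsRep m P s p q c f)
    (hfg : f =ᵐ[m] g) : IsRep m P s p q c g := by
  refine ⟨h.1.ae_eq hfg, h.2, h.3, h.4.congr fun n => eLpNorm_congr_ae ?_⟩
  filter_upwards [hfg] with x hx
  rw [hx]

theorem IsGrid.isRep_ae_eq (hP : IsGrid m P) (hp : 1 ≤ p) {c : ℕ → Set X → ℂ} {f : X → ℂ}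
    (h : IsRep m P s p q c f) :
    f =ᵐ[m] fun x => ∑' k, ∑ Q ∈ P k, c k Q * souzaAtom m s p Q x :=
  ((isAtomicRep_iff hp fun k => (hP.measurable_block c k).aestronglyMeasurable).1 h).2.2

theorem besovNorm_congr {f g : X → ℂ} (hfg : f =ᵐ[m] g) :
    besovNorm m P s p q f = besovNorm m P s p q g := by
  have h : ∀ c, IsRep m P s p q c f ↔ IsRep m P s p q c g := fun c =>
    ⟨fun h => h.congr hfg, fun h => h.congr hfg.symm⟩
  simp only [besovNorm, h]

theorem IsRep.besovNorm_le {c : ℕ → Set X → ℂ} {f : X → ℂ} (h : IsRep m P s p q c f) :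
    besovNorm m P s p q f ≤ coefNorm P p q c := iInf₂_le c h

end Rep

/-! ## Good grids -/

section GoodGrid

variable {X : Type*} [MeasurableSpace X] {m : Measure X} {P : ℕ → Finset (Set X)} {l₁ l₂ : ℝ}

theorem IsGrid.nonempty_of_mem (hP : IsGrid m P) {k : ℕ} {Q : Set X} (hQ : Q ∈ P k) :
    Q.Nonempty := by
  by_contra h
  have := hP.pos k Q hQ
  simp [Set.not_nonempty_iff_eq_empty.1 h] at this

namespace IsGoodGrid

theorem ofReal_l₂_lt_one (hP : IsGoodGrid m P l₁ l₂) : ENNReal.ofReal l₂ < 1 := by simpa using hP.l₂_lt_one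

theorem measure_ne_zero (hP : IsGoodGrid m P l₁ l₂) {k : ℕ} {Q : Set X} (hQ : Q ∈ P k) : m Q ≠ 0 := (hP.pos k Q hQ).ne'

theorem eq_of_mem (hP : IsGoodGrid m P l₁ l₂) {k : ℕ} {Q R : Set X} (hQ : Q ∈ P k) (hR : R ∈ P k) {x : X} (hxQ : x ∈ Q)
    (hxR : x ∈ R) : Q = R := by
  by_contra h
  exact Set.disjoint_left.1 (hP.disjoint k Q hQ R hR h) hxQ hxR

variable [IsFiniteMeasure m]

theorem measure_le_mul (hP : IsGoodGrid m P l₁ l₂) {k : ℕ} {Q R : Set X} (hQ : Q ∈ P (k + 1)) (hR : R ∈ P k) (h : Q ⊆ R) :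
    m Q ≤ ENNReal.ofReal l₂ * m R := by
  have h1 := (hP.ratio k Q hQ R hR h).2
  have h2 : 0 < m.real R := ENNReal.toReal_pos (hP.measure_ne_zero hR) (measure_ne_top m R)
  rw [div_le_iff₀ h2] at h1
  rw [← ofReal_measureReal (s := R), ← ofReal_measureReal (s := Q),
    ← ENNReal.ofReal_mul (hP.l₁_pos.trans hP.l₁_lt_l₂).le]
  exact ENNReal.ofReal_le_ofReal h1

theorem mul_le_measure (hP : IsGoodGrid m P l₁ l₂) {k : ℕ} {Q R : Set X} (hQ : Q ∈ P (k + 1)) (hR : R ∈ P k) (h : Q ⊆ R) :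
    ENNReal.ofReal l₁ * m R ≤ m Q := by
  have h1 := (hP.ratio k Q hQ R hR h).1
  have h2 : 0 < m.real R := ENNReal.toReal_pos (hP.measure_ne_zero hR) (measure_ne_top m R)
  rw [le_div_iff₀ h2] at h1
  rw [← ofReal_measureReal (s := R), ← ofReal_measureReal (s := Q),
    ← ENNReal.ofReal_mul hP.l₁_pos.le]
  exact ENNReal.ofReal_le_ofReal h1

/-- Climb from R through its successive parents. Each step costs a factor l₂, and disjointness
within level k identifies the last ancestor with Q. -/
theorem subset_and_measure_le (hP : IsGoodGrid m P l₁ l₂) {k i : ℕ} {Q R : Set X} (hQ : Q ∈ P k) (hR : R ∈ P (k + i))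
    (h : (R ∩ Q).Nonempty) : R ⊆ Q ∧ m R ≤ ENNReal.ofReal l₂ ^ i * m Q := by
  induction i generalizing R with
  | zero =>
    obtain ⟨x, hxR, hxQ⟩ := h
    obtain rfl := hP.eq_of_mem hR hQ hxR hxQ
    simp
  | succ i ih =>
    obtain ⟨S, hS, hRS⟩ := hP.nested (k + i) R hR
    obtain ⟨h1, h2⟩ := ih hS (h.mono (Set.inter_subset_inter_left _ hRS))
    refine ⟨hRS.trans h1, (hP.measure_le_mul hR hS hRS).trans ?_⟩
    rw [pow_succ', mul_assoc]
    gcongr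

theorem measure_le_pow_mul (hP : IsGoodGrid m P l₁ l₂) {j k : ℕ} {Q R : Set X} (hQ : Q ∈ P j) (hR : R ∈ P k) (hjk : j ≤ k)
    (h : R ⊆ Q) : m R ≤ ENNReal.ofReal l₂ ^ (k - j) * m Q := by
  obtain ⟨i, rfl⟩ := Nat.exists_eq_add_of_le hjk
  rw [Nat.add_sub_cancel_left]
  refine (hP.subset_and_measure_le hQ hR ?_).2
  rw [Set.inter_eq_left.2 h]
  exact hP.nonempty_of_mem hR

/-- Were R on a strictly coarser level, Q would lie in R, hence equal it, and its positive measure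
would be smaller than itself. As a consequence a cell determines its level. -/
theorem level_le (hP : IsGoodGrid m P l₁ l₂) {j k : ℕ} {Q R : Set X} (hQ : Q ∈ P j) (hR : R ∈ P k) (h : R ⊆ Q) : j ≤ k := by
  by_contra! hlt
  obtain ⟨i, rfl⟩ := Nat.exists_eq_add_of_lt hlt
  have hne : (Q ∩ R).Nonempty := by
    rw [Set.inter_eq_right.2 h]
    exact hP.nonempty_of_mem hR
  obtain ⟨h1, h2⟩ := hP.subset_and_measure_le hR (i := i + 1) hQ hne
  obtain rfl := h1.antisymm h
  have h3 : ENNReal.ofReal l₂ ^ (i + 1) < 1 := pow_lt_one₀ zero_le hP.ofReal_l₂_lt_one (by simp)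
  have h4 := ENNReal.mul_lt_mul_left (hP.measure_ne_zero hR) (measure_ne_top m Q) h3
  rw [one_mul] at h4
  exact absurd h2 (not_le.2 h4)

theorem level_unique (hP : IsGoodGrid m P l₁ l₂) {j k : ℕ} {Q : Set X} (hj : Q ∈ P j) (hk : Q ∈ P k) : j = k :=
  le_antisymm (hP.level_le hj hk subset_rfl) (hP.level_le hk hj subset_rfl)

theorem measure_le_pow (hP : IsGoodGrid m P l₁ l₂) {k : ℕ} {Q : Set X} (hQ : Q ∈ P k) :
    m Q ≤ ENNReal.ofReal l₂ ^ k * m Set.univ :=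
  hP.measure_le_pow_mul (j := 0) (by simp [hP.zero]) hQ (Nat.zero_le k) (Set.subset_univ Q)

end IsGoodGrid

end GoodGrid

end GoodGridBesov

/-! ### Series of Souza's atoms along a good grid -/

namespace GoodGridBesov

theorem sum_mul_rpow_le {κ : Type*} {p : ℝ} (hp : 1 ≤ p) (t : Finset κ)
    (y w : κ → ℝ≥0∞) {c : ℝ≥0∞}
    (h : ∀ Q ∈ t, y Q ≠ 0 → w Q ≤ c) :
    (∑ Q ∈ t, (y Q * w Q) ^ p) ^ (1 / p) ≤ c * (∑ Q ∈ t, y Q ^ p) ^ (1 / p) := by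
  have hp0 : 0 < p := by linarith
  calc (∑ Q ∈ t, (y Q * w Q) ^ p) ^ (1 / p)
      ≤ (∑ Q ∈ t, c ^ p * y Q ^ p) ^ (1 / p) := by
        refine ENNReal.rpow_le_rpow (Finset.sum_le_sum fun Q hQ => ?_) (by positivity)
        rw [← ENNReal.mul_rpow_of_nonneg _ _ hp0.le]
        refine ENNReal.rpow_le_rpow ?_ hp0.le
        by_cases hy : y Q = 0
        · simp [hy]
        · rw [mul_comm]; gcongr; exact h Q hQ hy
    _ = c * (∑ Q ∈ t, y Q ^ p) ^ (1 / p) := by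
        rw [← Finset.mul_sum, ENNReal.mul_rpow_of_nonneg _ _ (by positivity), ← ENNReal.rpow_mul,
          mul_one_div_cancel hp0.ne', ENNReal.rpow_one]

section Blocks

variable {X : Type*} [MeasurableSpace X] {m : Measure X} {P : ℕ → Finset (Set X)} {l₁ l₂ : ℝ}
  {p s : ℝ} {q : ℝ≥0∞}

theorem ofReal_measureReal_rpow [IsFiniteMeasure m] {Q : Set X} (hQ : m Q ≠ 0) (t : ℝ) :
    ENNReal.ofReal (m.real Q ^ t) = m Q ^ t := by
  have h : 0 < m.real Q := ENNReal.toReal_pos hQ (measure_ne_top m Q)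
  rw [← ENNReal.ofReal_rpow_of_pos h, ofReal_measureReal]

theorem enorm_souzaAtom [IsFiniteMeasure m] {Q : Set X} (hQ : m Q ≠ 0) (x : X) :
    ‖souzaAtom m s p Q x‖ₑ = Q.indicator (fun _ => m Q ^ (s - 1 / p)) x := by
  by_cases hx : x ∈ Q
  · rw [souzaAtom, Set.indicator_of_mem hx, Set.indicator_of_mem hx, ← ofReal_norm,
      Complex.norm_real, Real.norm_of_nonneg (by positivity), ofReal_measureReal_rpow hQ]
  · rw [souzaAtom, Set.indicator_of_notMem hx, Set.indicator_of_notMem hx, enorm_zero]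

theorem souzaAtom_change [IsFiniteMeasure m] {Q : Set X} (hQ : m Q ≠ 0) (t : ℝ) (x : X) :
    souzaAtom m t p Q x = ((m.real Q ^ (t - s) : ℝ) : ℂ) * souzaAtom m s p Q x := by
  have h2 : 0 < m.real Q := ENNReal.toReal_pos hQ (measure_ne_top m Q)
  by_cases hx : x ∈ Q
  · simp only [souzaAtom, Set.indicator_of_mem hx]
    rw [← Complex.ofReal_mul, ← Real.rpow_add h2]
    congr 2; ring
  · simp [souzaAtom, hx]

/-- The cells of one level are disjoint, so at most one term is nonzero. -/
theorem IsGoodGrid.sum_rpow (hP : IsGoodGrid m P l₁ l₂) (hp : 1 ≤ p) (k : ℕ) {x : X}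
    {u : Set X → ℝ≥0∞} (hu : ∀ Q ∈ P k, x ∉ Q → u Q = 0) :
    (∑ Q ∈ P k, u Q) ^ p = ∑ Q ∈ P k, u Q ^ p := by
  have hp0 : 0 < p := by linarith
  by_cases h : ∃ Q ∈ P k, x ∈ Q
  · obtain ⟨Q, hQ, hx⟩ := h
    have h0 : ∀ R ∈ P k, R ≠ Q → u R = 0 := fun R hR hne =>
      hu R hR fun hxR => hne (hP.eq_of_mem hR hQ hxR hx)
    rw [Finset.sum_eq_single_of_mem Q hQ h0, Finset.sum_eq_single_of_mem Q hQ]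
    intro R hR hne
    rw [h0 R hR hne, ENNReal.zero_rpow_of_pos hp0]
  · push Not at h
    rw [Finset.sum_eq_zero fun Q hQ => hu Q hQ (h Q hQ), ENNReal.zero_rpow_of_pos hp0]
    refine (Finset.sum_eq_zero fun Q hQ => ?_).symm
    rw [hu Q hQ (h Q hQ), ENNReal.zero_rpow_of_pos hp0]

theorem IsGoodGrid.lintegral_sum_rpow (hP : IsGoodGrid m P l₁ l₂) (hp : 1 ≤ p) (k : ℕ)
    {u : Set X → X → ℝ≥0∞} (hum : ∀ Q ∈ P k, AEMeasurable (u Q) m)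
    (hu : ∀ Q ∈ P k, ∀ x ∉ Q, u Q x = 0) :
    ∫⁻ x, (∑ Q ∈ P k, u Q x) ^ p ∂m = ∑ Q ∈ P k, ∫⁻ x, u Q x ^ p ∂m := by
  rw [← lintegral_finsetSum' _ fun Q hQ => (hum Q hQ).pow_const p]
  exact lintegral_congr fun x => hP.sum_rpow hp k fun Q hQ hx => hu Q hQ x hx

theorem lintegral_souzaAtom_rpow [IsFiniteMeasure m] (hp : 1 ≤ p) {Q : Set X} (hQ : m Q ≠ 0)
    (hQm : MeasurableSet Q) (y : ℝ≥0∞) :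
    ∫⁻ x, (y * ‖souzaAtom m s p Q x‖ₑ) ^ p ∂m = (y * m Q ^ s) ^ p := by
  have hp0 : 0 < p := by linarith
  have e : ∀ x, (y * ‖souzaAtom m s p Q x‖ₑ) ^ p =
      Q.indicator (fun _ => (y * m Q ^ (s - 1 / p)) ^ p) x := by
    intro x
    rw [enorm_souzaAtom hQ]
    by_cases hx : x ∈ Q
    · simp [hx]
    · simp [hx, hp0]
  simp_rw [e]
  rw [lintegral_indicator_const hQm, ENNReal.mul_rpow_of_nonneg _ _ hp0.le,
    ENNReal.mul_rpow_of_nonneg _ _ hp0.le, mul_assoc, ← ENNReal.rpow_mul, ← ENNReal.rpow_mul]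
  congr 1
  nth_rewrite 2 [← ENNReal.rpow_one (m Q)]
  rw [← ENNReal.rpow_add _ _ hQ (measure_ne_top m Q)]
  congr 1
  field_simp
  ring

theorem IsGoodGrid.lintegral_block (hP : IsGoodGrid m P l₁ l₂) [IsFiniteMeasure m] (hp : 1 ≤ p)
    (k : ℕ) (y : Set X → ℝ≥0∞) :
    (∫⁻ x, (∑ Q ∈ P k, y Q * ‖souzaAtom m s p Q x‖ₑ) ^ p ∂m) ^ (1 / p) =
      (∑ Q ∈ P k, (y Q * m Q ^ s) ^ p) ^ (1 / p) := by
  rw [hP.lintegral_sum_rpow hp]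
  · congr 1
    exact Finset.sum_congr rfl fun Q hQ =>
      lintegral_souzaAtom_rpow hp (hP.measure_ne_zero hQ) (hP.measurableSet k Q hQ) _
  · exact fun Q hQ =>
      ((measurable_souzaAtom (hP.measurableSet k Q hQ)).enorm.const_mul _).aemeasurable
  · intro Q hQ x hx
    simp [souzaAtom, hx]

theorem IsGoodGrid.measure_rpow_le [IsProbabilityMeasure m] (hP : IsGoodGrid m P l₁ l₂)
    (hs : 0 ≤ s) {k : ℕ} {Q : Set X} (hQ : Q ∈ P k) :
    m Q ^ s ≤ (ENNReal.ofReal l₂ ^ s) ^ k := by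
  have h := hP.measure_le_pow hQ
  rw [measure_univ, mul_one] at h
  rw [← ENNReal.rpow_natCast, ← ENNReal.rpow_mul, mul_comm s, ENNReal.rpow_mul,
    ENNReal.rpow_natCast]
  exact ENNReal.rpow_le_rpow h hs

theorem IsGoodGrid.ofReal_l₂_rpow_lt_one (hP : IsGoodGrid m P l₁ l₂) (hs : 0 < s) :
    ENNReal.ofReal l₂ ^ s < 1 := ENNReal.rpow_lt_one hP.ofReal_l₂_lt_one hs

theorem geometric_ne_top {r : ℝ≥0∞} (hr : r < 1) : ∑' k : ℕ, r ^ k ≠ ∞ := by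
  rw [ENNReal.tsum_geometric]
  exact ENNReal.inv_ne_top.2 (tsub_pos_of_lt hr).ne'

variable [IsProbabilityMeasure m]

/-- Souza's atom on Q has L^p norm |Q|^s, at most l₂^(s k) on level k. Bounded level norms of the
coefficients thus give summable L^p norms. -/
theorem IsGoodGrid.tsum_lintegral_block_le (hP : IsGoodGrid m P l₁ l₂) (hp : 1 ≤ p) (hq : 1 ≤ q)
    (hs : 0 < s) (y : ℕ → Set X → ℝ≥0∞) :
    ∑' k, (∫⁻ x, (∑ Q ∈ P k, y k Q * ‖souzaAtom m s p Q x‖ₑ) ^ p ∂m) ^ (1 / p) ≤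
      (∑' k, (ENNReal.ofReal l₂ ^ s) ^ k) * mixNorm P p q y := by
  rw [← ENNReal.tsum_mul_right]
  refine ENNReal.tsum_le_tsum fun k => ?_
  rw [hP.lintegral_block hp]
  refine (sum_mul_rpow_le hp (P k) (y k) _ fun Q hQ _ => hP.measure_rpow_le hs.le hQ).trans ?_
  gcongr
  exact sum_rpow_le_mixNorm hq y k

theorem IsGoodGrid.ae_tsum_block_ne_top (hP : IsGoodGrid m P l₁ l₂) (hp : 1 ≤ p) (hq : 1 ≤ q)
    (hs : 0 < s) {y : ℕ → Set X → ℝ≥0∞} (hy : mixNorm P p q y ≠ ∞) :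
    ∀ᵐ x ∂m, ∑' k, ∑ Q ∈ P k, y k Q * ‖souzaAtom m s p Q x‖ₑ ≠ ∞ := by
  have hm : ∀ k, AEMeasurable (fun x => ∑ Q ∈ P k, y k Q * ‖souzaAtom m s p Q x‖ₑ) m := fun k =>
    Finset.aemeasurable_fun_sum _ fun Q hQ =>
      ((measurable_souzaAtom (hP.measurableSet k Q hQ)).enorm.const_mul _).aemeasurable
  refine ae_ne_top_of_lintegral_rpow hp (AEMeasurable.tsum hm) ?_
  refine ne_top_of_le_ne_top ?_
    ((lintegral_tsum_rpow_le m hm hp).trans (hP.tsum_lintegral_block_le hp hq hs y))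
  exact ENNReal.mul_ne_top (geometric_ne_top (hP.ofReal_l₂_rpow_lt_one hs)) hy

theorem IsGoodGrid.abs_conv (hP : IsGoodGrid m P l₁ l₂) (hp : 1 ≤ p) (hq : 1 ≤ q)
    (hs : 0 < s) {c : ℕ → Set X → ℂ} (hc : coefNorm P p q c ≠ ∞) :
    ∑' k, eLpNorm (fun x => ∑ Q ∈ P k, c k Q * souzaAtom m s p Q x) (ENNReal.ofReal p) m ≠ ∞ := by
  have h := hP.tsum_lintegral_block_le hp hq hs (m := m) (s := s) fun k Q => ‖c k Q‖ₑ
  refine ne_top_of_le_ne_top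
    (ENNReal.mul_ne_top (geometric_ne_top (hP.ofReal_l₂_rpow_lt_one hs)) hc) (le_trans ?_ h)
  refine ENNReal.tsum_le_tsum fun k => ?_
  rw [eLpNorm_ofReal_eq hp]
  refine lintegral_rpow_mono hp (Eventually.of_forall fun x => ?_)
  refine (enorm_sum_le _ _).trans_eq (Finset.sum_congr rfl fun Q _ => ?_)
  rw [enorm_mul]

/-- For s > 0 a finite coefficient norm already implies absolute convergence in L^p, so only the
pointwise identity remains to be checked. -/
theorem IsGoodGrid.isRep_iff (hP : IsGoodGrid m P l₁ l₂) (hp : 1 ≤ p) (hq : 1 ≤ q)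
    (hs : 0 < s) {c : ℕ → Set X → ℂ} {f : X → ℂ} :
    IsRep m P s p q c f ↔ coefNorm P p q c ≠ ∞ ∧
      f =ᵐ[m] fun x => ∑' k, ∑ Q ∈ P k, c k Q * souzaAtom m s p Q x := by
  rw [IsRep, isAtomicRep_iff hp fun k => (hP.measurable_block c k).aestronglyMeasurable]
  exact ⟨fun h => ⟨h.1, h.2.2⟩, fun h => ⟨h.1, hP.abs_conv hp hq hs h.1, h.2⟩⟩

/-- Superposition of countably many representations. -/
theorem IsGoodGrid.isRep_tsum {ι : Type*} [Countable ι] (hP : IsGoodGrid m P l₁ l₂) (hp : 1 ≤ p)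
    (hq : 1 ≤ q) (hs : 0 < s) {y : ι → ℕ → Set X → ℂ} {f : ι → X → ℂ} {F : X → ℂ}
    (hf : ∀ i, f i =ᵐ[m] fun x => ∑' k, ∑ Q ∈ P k, y i k Q * souzaAtom m s p Q x)
    (hy : mixNorm P p q (fun k Q => ∑' i, ‖y i k Q‖ₑ) ≠ ∞)
    (hF : F =ᵐ[m] fun x => ∑' i, f i x) :
    IsRep m P s p q (fun k Q => ∑' i, y i k Q) F ∧
      coefNorm P p q (fun k Q => ∑' i, y i k Q) ≤ mixNorm P p q (fun k Q => ∑' i, ‖y i k Q‖ₑ) := by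
  have hle : coefNorm P p q (fun k Q => ∑' i, y i k Q) ≤
      mixNorm P p q (fun k Q => ∑' i, ‖y i k Q‖ₑ) :=
    mixNorm_mono hp fun k Q _ => enorm_tsum_le _
  refine ⟨(hP.isRep_iff hp hq hs).2 ⟨ne_top_of_le_ne_top hy hle, ?_⟩, hle⟩
  filter_upwards [hF, ae_all_iff.2 hf, hP.ae_tsum_block_ne_top hp hq hs hy] with x hx hfx hsum
  rw [hx]
  simp_rw [hfx]
  rw [tsum_tsum_sum_comm_of_enorm]
  · simp_rw [tsum_mul_right]
  · simp_rw [enorm_mul]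
    rw [tsum_tsum_sum_comm]
    simpa only [ENNReal.tsum_mul_right] using hsum

theorem IsGoodGrid.isRep_add (hP : IsGoodGrid m P l₁ l₂) (hp : 1 ≤ p)
    (hq : 1 ≤ q) (hs : 0 < s) {c d : ℕ → Set X → ℂ} {f g : X → ℂ}
    (hc : IsRep m P s p q c f) (hd : IsRep m P s p q d g) :
    IsRep m P s p q (fun k Q => c k Q + d k Q) (fun x => f x + g x) ∧
      coefNorm P p q (fun k Q => c k Q + d k Q) ≤ coefNorm P p q c + coefNorm P p q d := by
  have hle : mixNorm P p q (fun k Q => ∑' i : Bool, ‖(cond i c d) k Q‖ₑ) ≤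
      coefNorm P p q c + coefNorm P p q d := by
    refine (mixNorm_tsum_le hp hq fun (i : Bool) k Q => ‖(cond i c d) k Q‖ₑ).trans_eq ?_
    rw [tsum_fintype, Fintype.sum_bool]
    rfl
  have h := hP.isRep_tsum (ι := Bool) hp hq hs (y := fun i => cond i c d)
    (f := fun i => cond i f g) (F := fun x => f x + g x) ?_
    (ne_top_of_le_ne_top (ENNReal.add_ne_top.2 ⟨hc.2, hd.2⟩) hle)
    (Eventually.of_forall fun x => by simp [tsum_fintype])
  · simp only [tsum_fintype, Fintype.sum_bool, cond_true, cond_false] at h hle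
    exact ⟨h.1, h.2.trans hle⟩
  · rintro (_ | _)
    · exact hP.isRep_ae_eq hp hd
    · exact hP.isRep_ae_eq hp hc

end Blocks

end GoodGridBesov

/-! ### Geometric kernels and the local spaces on a cell -/

namespace GoodGridBesov

theorem tsum_indicator_comp_le {s : Set ℕ} {φ : ℕ → ℕ} (hφ : Set.InjOn φ s) (f : ℕ → ℝ≥0∞) :
    ∑' k, s.indicator (fun k => f (φ k)) k ≤ ∑' k, f k := by
  rw [← tsum_subtype s fun k => f (φ k)]
  exact ENNReal.tsum_comp_le_tsum_of_injective (f := fun k : s => φ k) hφ.injective f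

/-- The convolution kernel `c r^{k - j}`, `j ≤ k`. -/
noncomputable def lowerKernel (c r : ℝ≥0∞) (k j : ℕ) : ℝ≥0∞ := if j ≤ k then c * r ^ (k - j) else 0

theorem tsum_lowerKernel_right_le (c r : ℝ≥0∞) (k : ℕ) :
    ∑' j, lowerKernel c r k j ≤ c * ∑' i, r ^ i := by
  have h := tsum_indicator_comp_le (s := {j | j ≤ k}) (φ := fun j => k - j)
    (fun a ha b hb hab => by simp only [Set.mem_ofPred_eq] at ha hb hab; omega) fun i => c * r ^ i
  rw [ENNReal.tsum_mul_left] at h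
  refine le_trans (le_of_eq (tsum_congr fun j => ?_)) h
  simp [lowerKernel, Set.indicator]

theorem tsum_lowerKernel_left_le (c r : ℝ≥0∞) (j : ℕ) :
    ∑' k, lowerKernel c r k j ≤ c * ∑' i, r ^ i := by
  have h := tsum_indicator_comp_le (s := {k | j ≤ k}) (φ := fun k => k - j)
    (fun a ha b hb hab => by simp only [Set.mem_ofPred_eq] at ha hb hab; omega) fun i => c * r ^ i
  rw [ENNReal.tsum_mul_left] at h
  refine le_trans (le_of_eq (tsum_congr fun j => ?_)) h
  simp [lowerKernel, Set.indicator]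

section BesovOn

variable {X : Type*} [MeasurableSpace X] {m : Measure X} {P : ℕ → Finset (Set X)} {l₁ l₂ : ℝ}
  {p s β : ℝ} {q : ℝ≥0∞} {W : Set X}

theorem exists_isRep_of_besovNormOn_lt {f : X → ℂ} {t : ℝ≥0∞}
    (h : besovNormOn m P s p q W f < t) :
    ∃ c, IsRep m P s p q c f ∧ (∀ k, ∀ Q ∈ P k, c k Q ≠ 0 → Q ⊆ W) ∧ coefNorm P p q c < t := by
  obtain ⟨c, hc⟩ := iInf_lt_iff.1 h
  obtain ⟨hc, h⟩ := iInf_lt_iff.1 hc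
  exact ⟨c, hc.1, hc.2, h⟩

theorem IsGoodGrid.measure_rpow_le_mul [IsFiniteMeasure m] (hP : IsGoodGrid m P l₁ l₂)
    (hs : 0 ≤ s) {j k : ℕ} {Q R : Set X} (hQ : Q ∈ P j) (hR : R ∈ P k) (hjk : j ≤ k)
    (h : R ⊆ Q) : m R ^ s ≤ (ENNReal.ofReal l₂ ^ s) ^ (k - j) * m Q ^ s := by
  rw [← ENNReal.rpow_natCast (ENNReal.ofReal l₂ ^ s), ← ENNReal.rpow_mul, mul_comm s,
    ENNReal.rpow_mul, ENNReal.rpow_natCast, ← ENNReal.mul_rpow_of_nonneg _ _ hs]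
  exact ENNReal.rpow_le_rpow (hP.measure_le_pow_mul hQ hR hjk h) hs

theorem coefNorm_zero {X : Type*} {P : ℕ → Finset (Set X)} (hp : 1 ≤ p) (hq : 1 ≤ q) :
    coefNorm P p q (fun _ _ => 0) = 0 := by
  have h := mixNorm_const_mul (P := P) hp hq 0 fun _ _ => 0
  simpa [mixNorm, coefNorm] using h

theorem besovNormOn_zero (hp : 1 ≤ p) (hq : 1 ≤ q) :
    besovNormOn m P s p q W (fun _ => 0) = 0 := by
  have hz : coefNorm P p q (fun _ _ => 0) = 0 := coefNorm_zero hp hq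
  refine le_antisymm ?_ zero_le
  refine (iInf₂_le (fun _ _ => 0) ⟨⟨MemLp.zero', ?_, ?_, ?_⟩, ?_⟩).trans hz.le
  · simp [hz]
  · simp
  · simp
  · simp

variable [IsProbabilityMeasure m]

theorem IsGoodGrid.besovNormOn_tsum_le {ι : Type*} [Countable ι] (hP : IsGoodGrid m P l₁ l₂)
    (hp : 1 ≤ p) (hq : 1 ≤ q) (hs : 0 < s) {f : ι → X → ℂ} {F : X → ℂ}
    (hF : F =ᵐ[m] fun x => ∑' i, f i x) :
    besovNormOn m P s p q W F ≤ ∑' i, besovNormOn m P s p q W (f i) := by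
  by_cases htop : ∑' i, besovNormOn m P s p q W (f i) = ∞
  · simp [htop]
  refine ENNReal.le_of_forall_pos_le_add fun η hη _ => ?_
  -- The infima need not be attained. Representations are chosen with errors of total less than η
  -- and superposed.
  obtain ⟨η', hη', hsum⟩ := ENNReal.exists_pos_sum_of_countable
    (ENNReal.coe_ne_zero.2 hη.ne') ι
  have hlt : ∀ i, besovNormOn m P s p q W (f i) < besovNormOn m P s p q W (f i) + η' i := fun i =>
    ENNReal.lt_add_right (ENNReal.ne_top_of_tsum_ne_top htop i)
      (ENNReal.coe_ne_zero.2 (hη' i).ne')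
  choose c hc hcW hcn using fun i => exists_isRep_of_besovNormOn_lt (hlt i)
  have hle : mixNorm P p q (fun k Q => ∑' i, ‖c i k Q‖ₑ) ≤
      ∑' i, besovNormOn m P s p q W (f i) + η := by
    refine (mixNorm_tsum_le hp hq fun i k Q => ‖c i k Q‖ₑ).trans ?_
    refine (ENNReal.tsum_le_tsum fun i => (hcn i).le).trans ?_
    rw [ENNReal.tsum_add]
    gcongr
  have hfin : ∑' i, besovNormOn m P s p q W (f i) + η ≠ ∞ := by simp [htop]
  obtain ⟨h1, h2⟩ := hP.isRep_tsum hp hq hs (fun i => hP.isRep_ae_eq hp (hc i))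
    (ne_top_of_le_ne_top hfin hle) hF
  refine (iInf₂_le _ ⟨h1, fun k Q hQ hne => ?_⟩).trans (h2.trans hle)
  by_contra hsub
  refine hne ?_
  have : ∀ i, c i k Q = 0 := fun i => by
    by_contra h
    exact hsub (hcW i k Q hQ h)
  simp [this]

theorem IsGoodGrid.besovNormOn_const_mul_le (hP : IsGoodGrid m P l₁ l₂)
    (hp : 1 ≤ p) (hq : 1 ≤ q) (hs : 0 < s) (a : ℂ) (f : X → ℂ) :
    besovNormOn m P s p q W (fun x => a * f x) ≤ ‖a‖ₑ * besovNormOn m P s p q W f := by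
  -- For a = 0 the right side is 0 even where the norm is ∞, so the zero function must be treated
  -- apart.
  by_cases ha : a = 0
  · simp [ha, besovNormOn_zero hp hq]
  have ha0 : ‖a‖ₑ ≠ 0 := by simpa using ha
  rw [← ENNReal.div_le_iff' ha0 enorm_ne_top]
  refine le_iInf₂ fun c hc => ?_
  rw [ENNReal.div_le_iff' ha0 enorm_ne_top]
  have hn : coefNorm P p q (fun k Q => a * c k Q) = ‖a‖ₑ * coefNorm P p q c := by
    have h := mixNorm_const_mul (P := P) hp hq ‖a‖ₑ fun k Q => ‖c k Q‖ₑ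
    simp only [← enorm_mul] at h
    exact h
  rw [← hn]
  refine iInf₂_le _ ⟨(hP.isRep_iff hp hq hs).2 ⟨?_, ?_⟩, fun k Q hQ hne => ?_⟩
  · rw [hn]
    exact ENNReal.mul_ne_top enorm_ne_top hc.1.2
  · filter_upwards [hP.isRep_ae_eq hp hc.1] with x hx
    rw [hx, ← tsum_mul_left]
    simp only [Finset.mul_sum, mul_assoc]
  · exact hc.2 k Q hQ fun h => hne (by simp [h])

/-- Cells inside W have level at least k, and their atoms have L^p norm at most l₂^(s (i - k))
|W|^s. The geometric series therefore starts at |W|^s rather than at 1. -/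
theorem IsGoodGrid.eLpNorm_le_coefNorm (hP : IsGoodGrid m P l₁ l₂)
    (hp : 1 ≤ p) (hq : 1 ≤ q) (hs : 0 < s) {k : ℕ} (hW : W ∈ P k) {c : ℕ → Set X → ℂ} {f : X → ℂ}
    (hc : IsRep m P s p q c f) (hcW : ∀ i, ∀ Q ∈ P i, c i Q ≠ 0 → Q ⊆ W) :
    (∫⁻ x, ‖f x‖ₑ ^ p ∂m) ^ (1 / p) ≤
      ((∑' i, (ENNReal.ofReal l₂ ^ s) ^ i) * m W ^ s) * coefNorm P p q c := by
  have hm : ∀ k, AEMeasurable (fun x => ∑ Q ∈ P k, ‖c k Q‖ₑ * ‖souzaAtom m s p Q x‖ₑ) m := fun k =>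
    Finset.aemeasurable_fun_sum _ fun Q hQ =>
      ((measurable_souzaAtom (hP.measurableSet k Q hQ)).enorm.const_mul _).aemeasurable
  have h1 : (∫⁻ x, ‖f x‖ₑ ^ p ∂m) ^ (1 / p) ≤
      ∑' i, (∫⁻ x, (∑ Q ∈ P i, ‖c i Q‖ₑ * ‖souzaAtom m s p Q x‖ₑ) ^ p ∂m) ^ (1 / p) := by
    refine le_trans (lintegral_rpow_mono hp ?_) (lintegral_tsum_rpow_le m hm hp)
    filter_upwards [hP.isRep_ae_eq hp hc] with x hx
    rw [hx]
    refine (enorm_tsum_le _).trans (ENNReal.tsum_le_tsum fun i => ?_)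
    refine (enorm_sum_le _ _).trans_eq (Finset.sum_congr rfl fun Q _ => ?_)
    rw [enorm_mul]
  refine h1.trans ?_
  calc _ ≤ ∑' i, lowerKernel 1 (ENNReal.ofReal l₂ ^ s) i k * (m W ^ s * coefNorm P p q c) := by
        refine ENNReal.tsum_le_tsum fun i => ?_
        rw [hP.lintegral_block hp, ← mul_assoc]
        refine (sum_mul_rpow_le hp (P i) (fun Q => ‖c i Q‖ₑ) _
          (c := lowerKernel 1 (ENNReal.ofReal l₂ ^ s) i k * m W ^ s) fun Q hQ hne => ?_).trans ?_
        · have hQW := hcW i Q hQ (by simpa using hne)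
          have hki := hP.level_le hW hQ hQW
          rw [lowerKernel, if_pos hki, one_mul]
          exact hP.measure_rpow_le_mul hs.le hW hQ hki hQW
        · gcongr
          exact sum_rpow_le_mixNorm hq (fun k Q => ‖c k Q‖ₑ) i
    _ ≤ _ := by
        rw [ENNReal.tsum_mul_right, mul_assoc]
        exact mul_le_mul' ((tsum_lowerKernel_left_le 1 _ k).trans_eq (one_mul _)) le_rfl

theorem IsGoodGrid.eLpNorm_le_besovNormOn (hP : IsGoodGrid m P l₁ l₂)
    (hp : 1 ≤ p) (hq : 1 ≤ q) (hs : 0 < s) {k : ℕ} (hW : W ∈ P k) (f : X → ℂ) :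
    (∫⁻ x, ‖f x‖ₑ ^ p ∂m) ^ (1 / p) ≤
      ((∑' i, (ENNReal.ofReal l₂ ^ s) ^ i) * m W ^ s) * besovNormOn m P s p q W f := by
  have h0 : (∑' i, (ENNReal.ofReal l₂ ^ s) ^ i) * m W ^ s ≠ 0 := by
    refine mul_ne_zero ?_ ?_
    · refine ne_of_gt (lt_of_lt_of_le zero_lt_one ?_)
      exact (pow_zero _).symm.trans_le
        (ENNReal.le_tsum (f := fun i => (ENNReal.ofReal l₂ ^ s) ^ i) 0)
    · exact (ENNReal.rpow_pos (hP.pos k W hW) (measure_ne_top m W)).ne'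
  have h1 : (∑' i, (ENNReal.ofReal l₂ ^ s) ^ i) * m W ^ s ≠ ∞ :=
    ENNReal.mul_ne_top (geometric_ne_top (hP.ofReal_l₂_rpow_lt_one hs))
      (ENNReal.rpow_ne_top_of_nonneg hs.le (measure_ne_top m W))
  rw [← ENNReal.div_le_iff' h0 h1]
  refine le_iInf₂ fun c hc => ?_
  rw [ENNReal.div_le_iff' h0 h1]
  exact hP.eLpNorm_le_coefNorm hp hq hs hW hc.1 hc.2

end BesovOn

end GoodGridBesov

/-! ### From Besov atoms to Souza's atoms -/

namespace GoodGridBesov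

section GBS

variable {X : Type*} [MeasurableSpace X] {m : Measure X} [IsProbabilityMeasure m]
  {P : ℕ → Finset (Set X)} {l₁ l₂ : ℝ} {p s β : ℝ} {q : ℝ≥0∞}

theorem measure_rpow_ne_zero {Q : Set X} (hQ : m Q ≠ 0) (t : ℝ) : m Q ^ t ≠ 0 :=
  (ENNReal.rpow_pos (pos_iff_ne_zero.2 hQ) (measure_ne_top m Q)).ne'

theorem measure_rpow_ne_top {Q : Set X} (hQ : m Q ≠ 0) (t : ℝ) : m Q ^ t ≠ ∞ := by
  rw [← ofReal_measureReal_rpow hQ]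
  exact ENNReal.ofReal_ne_top

theorem measure_rpow_mul {Q : Set X} (hQ : m Q ≠ 0) (t u : ℝ) : m Q ^ t * m Q ^ u = m Q ^ (t + u) :=
  (ENNReal.rpow_add _ _ hQ (measure_ne_top m Q)).symm

theorem IsGoodGrid.exists_isRep_of_isBesovAtom (hP : IsGoodGrid m P l₁ l₂) {k : ℕ} {Q : Set X}
    (hQ : Q ∈ P k) {b : X → ℂ} (hb : IsBesovAtom m P s β p q Q b) :
    ∃ c, IsRep m P β p q c b ∧ (∀ k, ∀ R ∈ P k, c k R ≠ 0 → R ⊆ Q) ∧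
      coefNorm P p q c ≤ 2 * m Q ^ (s - β) := by
  have h0 := hP.measure_ne_zero hQ
  rw [IsBesovAtom, ofReal_measureReal_rpow h0] at hb
  -- The factor 2 leaves room for a representation that is not optimal; |Q|^(s - β) is finite and
  -- nonzero.
  have hlt : besovNormOn m P β p q Q b < 2 * m Q ^ (s - β) := by
    refine hb.trans_lt ?_
    rw [two_mul]
    exact ENNReal.lt_add_right (measure_rpow_ne_top h0 _) (measure_rpow_ne_zero h0 _)
  obtain ⟨c, h1, h2, h3⟩ := exists_isRep_of_besovNormOn_lt hlt
  exact ⟨c, h1, h2, h3.le⟩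

/-- The factor |R|^(β - s) renormalizes atoms from exponent β to exponent s. For R ⊆ Q it is at most
l₂^((β - s)(k - j)) |Q|^(β - s), and the power of |Q| cancels the bound on the atom's coefficients.
-/
theorem IsGoodGrid.sum_sum_atom_coef_le (hP : IsGoodGrid m P l₁ l₂) (hp : 1 ≤ p)
    (hq : 1 ≤ q) (hsβ : s < β) (j k : ℕ) (d : Set X → ℂ) (c : Set X → ℕ → Set X → ℂ)
    (hcQ : ∀ Q ∈ P j, ∀ k, ∀ R ∈ P k, c Q k R ≠ 0 → R ⊆ Q)
    (hcn : ∀ Q ∈ P j, coefNorm P p q (c Q) ≤ 2 * m Q ^ (s - β)) :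
    (∑ R ∈ P k, (∑ Q ∈ P j, ‖d Q‖ₑ * (‖c Q k R‖ₑ * m R ^ (β - s))) ^ p) ^ (1 / p) ≤
      lowerKernel 2 (ENNReal.ofReal l₂ ^ (β - s)) k j * (∑ Q ∈ P j, ‖d Q‖ₑ ^ p) ^ (1 / p) := by
  have hp0 : 0 < p := by linarith
  set K := lowerKernel 2 (ENNReal.ofReal l₂ ^ (β - s)) k j with hK
  have h1 : ∀ Q ∈ P j, (∑ R ∈ P k, (‖c Q k R‖ₑ * m R ^ (β - s)) ^ p) ≤ K ^ p := by
    intro Q hQ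
    rw [← ENNReal.rpow_inv_le_iff hp0, ← one_div]
    set r := ENNReal.ofReal l₂ ^ (β - s)
    refine (sum_mul_rpow_le hp (P k) (fun R => ‖c Q k R‖ₑ) _
      (c := lowerKernel 1 r k j * m Q ^ (β - s)) fun R hR hne => ?_).trans ?_
    · have hRQ := hcQ Q hQ k R hR (by simpa using hne)
      have hjk := hP.level_le hQ hR hRQ
      rw [lowerKernel, if_pos hjk, one_mul]
      exact hP.measure_rpow_le_mul (by linarith) hQ hR hjk hRQ
    · calc _ ≤ lowerKernel 1 r k j * m Q ^ (β - s) * (2 * m Q ^ (s - β)) := by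
            gcongr
            exact (sum_rpow_le_mixNorm hq (fun k R => ‖c Q k R‖ₑ) k).trans (hcn Q hQ)
        _ = lowerKernel 1 r k j * 2 * (m Q ^ (β - s) * m Q ^ (s - β)) := by ring
        _ = K := by
            rw [measure_rpow_mul (hP.measure_ne_zero hQ)]
            simp only [sub_add_sub_cancel, sub_self, ENNReal.rpow_zero, mul_one, hK, lowerKernel]
            split_ifs <;> ring
  -- A cell R lies in at most one Q of level j, so the p-th power passes inside the sum over Q.
  calc _ = (∑ R ∈ P k, ∑ Q ∈ P j, ‖d Q‖ₑ ^ p * (‖c Q k R‖ₑ * m R ^ (β - s)) ^ p) ^ (1 / p) := by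
        congr 1
        refine Finset.sum_congr rfl fun R hR => ?_
        obtain ⟨x, hx⟩ := hP.nonempty_of_mem hR
        rw [hP.sum_rpow hp j (x := x)]
        · simp_rw [ENNReal.mul_rpow_of_nonneg _ _ hp0.le]
        · intro Q hQ hxQ
          have : c Q k R = 0 := by
            by_contra hne
            exact hxQ (hcQ Q hQ k R hR hne hx)
          simp [this]
    _ ≤ (∑ Q ∈ P j, ‖d Q‖ₑ ^ p * K ^ p) ^ (1 / p) := by
        rw [Finset.sum_comm]
        refine ENNReal.rpow_le_rpow (Finset.sum_le_sum fun Q hQ => ?_) (by positivity)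
        rw [← Finset.mul_sum]
        gcongr
        exact h1 Q hQ
    _ = K * (∑ Q ∈ P j, ‖d Q‖ₑ ^ p) ^ (1 / p) := by
        rw [← Finset.sum_mul, ENNReal.mul_rpow_of_nonneg _ _ (by positivity), ← ENNReal.rpow_mul,
          mul_one_div_cancel hp0.ne', ENNReal.rpow_one, mul_comm]

/-- Representations by Besov atoms can be converted into representations by Souza's atoms. -/
theorem IsGoodGrid.exists_isGBSConstant (hP : IsGoodGrid m P l₁ l₂) (hp : 1 ≤ p)
    (hq : 1 ≤ q) (hs : 0 < s) (hsβ : s < β) :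
    ∃ C : ℝ, IsGBSConstant m P s β p q C := by
  -- The Schur constant of the kernel; the 2 comes from the nearly optimal representations of the
  -- atoms.
  set S : ℝ≥0∞ := 2 * ∑' i, (ENNReal.ofReal l₂ ^ (β - s)) ^ i with hS
  have hSt : S ≠ ∞ := ENNReal.mul_ne_top (by simp)
    (geometric_ne_top (hP.ofReal_l₂_rpow_lt_one (by linarith)))
  have hS0 : S ≠ 0 := by
    refine mul_ne_zero (by simp) (ne_of_gt (lt_of_lt_of_le zero_lt_one ?_))
    exact (pow_zero _).symm.trans_le (ENNReal.le_tsum (f := fun i => (_ : ℝ≥0∞) ^ i) 0)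
  refine ⟨S.toReal, ENNReal.toReal_pos hS0 hSt, fun g d b hb hg => ?_⟩
  rw [ENNReal.ofReal_toReal hSt]
  have hex : ∀ j Q, ∃ c : ℕ → Set X → ℂ, Q ∈ P j →
      IsRep m P β p q c (b j Q) ∧ (∀ k, ∀ R ∈ P k, c k R ≠ 0 → R ⊆ Q) ∧
      coefNorm P p q c ≤ 2 * m Q ^ (s - β) := fun j Q => by
    by_cases hQ : Q ∈ P j
    · obtain ⟨c, hc⟩ := hP.exists_isRep_of_isBesovAtom hQ (hb j Q hQ)
      exact ⟨c, fun _ => hc⟩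
    · exact ⟨0, fun h => absurd h hQ⟩
  choose c hc using hex
  have hbm : ∀ j, AEStronglyMeasurable (fun x => ∑ Q ∈ P j, d j Q * b j Q x) m := fun j =>
    Finset.aestronglyMeasurable_fun_sum _ fun Q hQ => ((hc j Q hQ).1.1.1).const_mul _
  obtain ⟨hd, -, hgF⟩ := (isAtomicRep_iff hp hbm).1 hg
  -- The coefficient on R of level k contributed by all atoms of level j. Superposing over j
  -- represents g.
  set y : ℕ → ℕ → Set X → ℂ := fun j k R =>
    ∑ Q ∈ P j, d j Q * (c j Q k R * ((m.real R ^ (β - s) : ℝ) : ℂ)) with hy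
  have hyn : mixNorm P p q (fun k R => ∑' j, ‖y j k R‖ₑ) ≤ S * coefNorm P p q d := by
    refine le_trans (lqNorm_mono fun k => ?_)
      (lqNorm_kernel_le hq (lowerKernel 2 (ENNReal.ofReal l₂ ^ (β - s)))
        (tsum_lowerKernel_right_le _ _) (tsum_lowerKernel_left_le _ _) _)
    refine (sum_tsum_rpow_le (P k) (fun j R => ‖y j k R‖ₑ) hp).trans
      (ENNReal.tsum_le_tsum fun j => ?_)
    refine le_trans ?_ (hP.sum_sum_atom_coef_le hp hq hsβ j k (d j) (c j)
      (fun Q hQ => (hc j Q hQ).2.1) (fun Q hQ => (hc j Q hQ).2.2))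
    refine ENNReal.rpow_le_rpow (Finset.sum_le_sum fun R hR => ?_) (by positivity)
    refine ENNReal.rpow_le_rpow ?_ (by linarith)
    refine (enorm_sum_le _ _).trans_eq (Finset.sum_congr rfl fun Q _ => ?_)
    rw [enorm_mul, enorm_mul, ← ofReal_measureReal_rpow (hP.measure_ne_zero hR), ← ofReal_norm,
      ← ofReal_norm, ← ofReal_norm, Complex.norm_real, Real.norm_of_nonneg (by positivity)]
  have hyfin : mixNorm P p q (fun k R => ∑' j, ‖y j k R‖ₑ) ≠ ∞ :=
    ne_top_of_le_ne_top (ENNReal.mul_ne_top hSt hd) hyn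
  have h := hP.isRep_tsum hp hq hs (f := fun j x => ∑ Q ∈ P j, d j Q * b j Q x) (y := y)
    (fun j => ?_) hyfin hgF
  · exact ⟨_, h.1, h.2.trans hyn⟩
  have hall : ∀ᵐ x ∂m, ∀ Q ∈ P j,
      b j Q x = ∑' k, ∑ R ∈ P k, c j Q k R * souzaAtom m β p R x ∧
      ∑' k, ∑ R ∈ P k, ‖c j Q k R‖ₑ * ‖souzaAtom m β p R x‖ₑ ≠ ∞ := by
    rw [Finset.eventually_all]
    intro Q hQ
    filter_upwards [hP.isRep_ae_eq hp (hc j Q hQ).1,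
      hP.ae_tsum_block_ne_top hp hq (hs.trans hsβ) (m := m) (hc j Q hQ).1.2] with x h1 h2
    exact ⟨h1, h2⟩
  filter_upwards [hall] with x hx
  have e1 : ∀ Q ∈ P j, d j Q * b j Q x =
      ∑' k, d j Q * ∑ R ∈ P k, c j Q k R * souzaAtom m β p R x := fun Q hQ => by
    rw [(hx Q hQ).1, tsum_mul_left]
  rw [Finset.sum_congr rfl e1, ← Summable.tsum_finsetSum]
  · refine tsum_congr fun k => ?_
    simp only [hy, Finset.sum_mul, Finset.mul_sum]
    rw [Finset.sum_comm]
    refine Finset.sum_congr rfl fun R hR => Finset.sum_congr rfl fun Q _ => ?_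
    rw [souzaAtom_change (s := s) (hP.measure_ne_zero hR)]
    ring
  · intro Q hQ
    refine (summable_of_tsum_enorm_ne_top (ne_top_of_le_ne_top (hx Q hQ).2 ?_)).mul_left _
    refine ENNReal.tsum_le_tsum fun k => (enorm_sum_le _ _).trans_eq ?_
    simp only [enorm_mul]

/-- Superposition of countably many families of functions in the spaces `B^β_{p,q}(W)`. -/
theorem IsGoodGrid.exists_isRep_of_besovNormOn_le {ι : Type*} [Countable ι]
    (hP : IsGoodGrid m P l₁ l₂) (hp : 1 ≤ p) (hq : 1 ≤ q) (hs : 0 < s) (hsβ : s < β) {C : ℝ}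
    (hC : IsGBSConstant m P s β p q C) {v : ι → ℕ → Set X → X → ℂ} {y : ι → ℕ → Set X → ℝ≥0∞}
    (hvm : ∀ i k, ∀ W ∈ P k, AEStronglyMeasurable (v i k W) m)
    (hsupp : ∀ i k, ∀ W ∈ P k, ∀ x ∉ W, v i k W x = 0)
    (hnorm : ∀ i k, ∀ W ∈ P k, besovNormOn m P β p q W (v i k W) ≤ y i k W * m W ^ (s - β))
    (hy : mixNorm P p q (fun k W => ∑' i, y i k W) ≠ ∞) :
    (∀ᵐ x ∂m, ∑' i, ∑' k, ∑ W ∈ P k, ‖v i k W x‖ₑ ≠ ∞) ∧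
    ∀ F : X → ℂ, (F =ᵐ[m] fun x => ∑' i, ∑' k, ∑ W ∈ P k, v i k W x) →
      ∃ z, IsRep m P s p q z F ∧
        coefNorm P p q z ≤ ENNReal.ofReal C * mixNorm P p q (fun k W => ∑' i, y i k W) := by
  have hβ : 0 < β := hs.trans hsβ
  set G : ℝ≥0∞ := ∑' i, (ENNReal.ofReal l₂ ^ β) ^ i with hG
  have hGt : G ≠ ∞ := geometric_ne_top (hP.ofReal_l₂_rpow_lt_one hβ)
  set D : ℕ → Set X → ℝ≥0∞ := fun k W => ∑' i, y i k W with hD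
  have hDt : ∀ k, ∀ W ∈ P k, D k W ≠ ∞ := fun k W hW =>
    ne_top_of_le_ne_top hy (le_mixNorm hp hq D hW)
  -- The absolute sum of everything living on level k. Since its L^p norms are summable in k, the
  -- triple series converges absolutely almost everywhere and the sum over i may be moved inside.
  set V : ℕ → X → ℝ≥0∞ := fun k x => ∑ W ∈ P k, ∑' i, ‖v i k W x‖ₑ with hV
  have hVm : ∀ k, AEMeasurable (V k) m := fun k =>
    Finset.aemeasurable_fun_sum _ fun W hW => AEMeasurable.tsum fun i => (hvm i k W hW).enorm
  have hVle : ∀ k, (∫⁻ x, V k x ^ p ∂m) ^ (1 / p) ≤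
      G * (ENNReal.ofReal l₂ ^ s) ^ k * mixNorm P p q D := by
    intro k
    rw [hP.lintegral_sum_rpow hp k (u := fun W x => ∑' i, ‖v i k W x‖ₑ)
      (fun W hW => AEMeasurable.tsum fun i => (hvm i k W hW).enorm)
      (fun W hW x hx => by simp [hsupp _ k W hW x hx])]
    have h1 : ∀ W ∈ P k, ∫⁻ x, (∑' i, ‖v i k W x‖ₑ) ^ p ∂m ≤ (D k W * (G * m W ^ s)) ^ p := by
      intro W hW
      rw [← ENNReal.rpow_inv_le_iff (by linarith), ← one_div]
      refine (lintegral_tsum_rpow_le m (fun i => (hvm i k W hW).enorm) hp).trans ?_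
      calc _ ≤ ∑' i, (G * m W ^ β) * (y i k W * m W ^ (s - β)) :=
            ENNReal.tsum_le_tsum fun i =>
              (hP.eLpNorm_le_besovNormOn hp hq hβ hW _).trans (by gcongr; exact hnorm i k W hW)
        _ = D k W * (G * (m W ^ β * m W ^ (s - β))) := by
            rw [ENNReal.tsum_mul_left, ENNReal.tsum_mul_right]; ring
        _ = _ := by
            rw [measure_rpow_mul (hP.measure_ne_zero hW), add_sub_cancel]
    refine (ENNReal.rpow_le_rpow (Finset.sum_le_sum h1) (by positivity)).trans ?_
    refine (sum_mul_rpow_le hp (P k) (D k) _ (c := G * (ENNReal.ofReal l₂ ^ s) ^ k)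
      fun W hW _ => ?_).trans ?_
    · gcongr
      exact hP.measure_rpow_le hs.le hW
    · gcongr
      exact sum_rpow_le_mixNorm hq D k
  have hVsum : ∑' k, (∫⁻ x, V k x ^ p ∂m) ^ (1 / p) ≠ ∞ := by
    refine ne_top_of_le_ne_top ?_ (ENNReal.tsum_le_tsum hVle)
    rw [ENNReal.tsum_mul_right, ENNReal.tsum_mul_left]
    exact ENNReal.mul_ne_top
      (ENNReal.mul_ne_top hGt (geometric_ne_top (hP.ofReal_l₂_rpow_lt_one hs))) hy
  have hae : ∀ᵐ x ∂m, ∑' i, ∑' k, ∑ W ∈ P k, ‖v i k W x‖ₑ ≠ ∞ := by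
    filter_upwards [ae_ne_top_of_lintegral_rpow hp (AEMeasurable.tsum hVm)
      (ne_top_of_le_ne_top hVsum (lintegral_tsum_rpow_le m hVm hp))] with x hx
    rwa [tsum_tsum_sum_comm]
  refine ⟨hae, fun F hF => ?_⟩
  -- D bounds the normalized norm of the total function on W. Dividing that function by D gives a
  -- Besov atom, with D as its coefficient.
  set d : ℕ → Set X → ℂ := fun k W => (((D k W).toReal : ℝ) : ℂ) with hd
  set b : ℕ → Set X → X → ℂ := fun k W x => (d k W)⁻¹ * ∑' i, v i k W x with hb
  have hdn : ∀ k, ∀ W ∈ P k, ‖d k W‖ₑ = D k W := fun k W hW => by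
    rw [hd, ← ofReal_norm, Complex.norm_real, Real.norm_of_nonneg ENNReal.toReal_nonneg,
      ENNReal.ofReal_toReal (hDt k W hW)]
  have hdD : coefNorm P p q d = mixNorm P p q D := by
    refine le_antisymm (mixNorm_mono hp fun k W hW => (hdn k W hW).le)
      (mixNorm_mono hp fun k W hW => (hdn k W hW).ge)
  have hvsum : ∀ k, ∀ W ∈ P k,
      besovNormOn m P β p q W (fun x => ∑' i, v i k W x) ≤ D k W * m W ^ (s - β) := by
    intro k W hW
    refine (hP.besovNormOn_tsum_le hp hq hβ (EventuallyEq.refl _ _)).trans ?_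
    rw [hD, ← ENNReal.tsum_mul_right]
    exact ENNReal.tsum_le_tsum fun i => hnorm i k W hW
  have hbatom : ∀ k, ∀ W ∈ P k, IsBesovAtom m P s β p q W (b k W) := by
    intro k W hW
    rw [IsBesovAtom, ofReal_measureReal_rpow (hP.measure_ne_zero hW)]
    by_cases h0 : d k W = 0
    · have : b k W = fun _ => 0 := by ext x; simp [hb, h0]
      rw [this, besovNormOn_zero hp hq]
      exact zero_le
    refine (hP.besovNormOn_const_mul_le hp hq hβ _ _).trans ?_
    have hD0 : D k W ≠ 0 := by
      rw [← hdn k W hW]; simpa using h0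
    calc _ ≤ ‖(d k W)⁻¹‖ₑ * (D k W * m W ^ (s - β)) := by gcongr; exact hvsum k W hW
      _ = m W ^ (s - β) := by
        rw [enorm_inv h0, hdn k W hW, ← mul_assoc, ENNReal.inv_mul_cancel hD0 (hDt k W hW),
          one_mul]
  have hsm : ∀ k, ∀ W ∈ P k, AEStronglyMeasurable (fun x => ∑' i, v i k W x) m := by
    intro k W hW
    obtain ⟨c, hc, -⟩ := exists_isRep_of_besovNormOn_lt (lt_of_le_of_lt (hvsum k W hW)
      (ENNReal.mul_lt_top (hDt k W hW).lt_top
        (measure_rpow_ne_top (hP.measure_ne_zero hW) _).lt_top))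
    exact hc.1.1
  -- If d = 0 then b = 0 through the inverse of 0, and nothing is lost: the total function has local
  -- norm 0, hence vanishes almost everywhere.
  have hzero : ∀ᵐ x ∂m, ∀ k, ∀ W ∈ P k, d k W * b k W x = ∑' i, v i k W x := by
    rw [ae_all_iff]
    intro k
    rw [Finset.eventually_all]
    intro W hW
    by_cases h0 : d k W = 0
    · have hD0 : D k W = 0 := by rw [← hdn k W hW, h0, enorm_zero]
      have hz : besovNormOn m P β p q W (fun x => ∑' i, v i k W x) = 0 :=
        le_antisymm ((hvsum k W hW).trans (by simp [hD0])) zero_le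
      have hn := hP.eLpNorm_le_besovNormOn hp hq hβ hW fun x => ∑' i, v i k W x
      rw [hz, mul_zero, ← eLpNorm_ofReal_eq hp, nonpos_iff_eq_zero,
        eLpNorm_eq_zero_iff (hsm k W hW) (by simpa using (by linarith : (0:ℝ) < p))] at hn
      filter_upwards [hn] with x hx
      rw [h0, zero_mul]
      exact hx.symm
    · exact Eventually.of_forall fun x => by rw [hb]; exact mul_inv_cancel_left₀ h0 _
  have hbm : ∀ k, AEStronglyMeasurable (fun x => ∑ W ∈ P k, d k W * b k W x) m := fun k =>
    Finset.aestronglyMeasurable_fun_sum _ fun W hW => ((hsm k W hW).const_mul _).const_mul _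
  have hrep : IsAtomicRep m P p q b d F := by
    refine (isAtomicRep_iff hp hbm).2 ⟨hdD ▸ hy, ?_, ?_⟩
    · refine ne_top_of_le_ne_top hVsum (ENNReal.tsum_le_tsum fun k => ?_)
      rw [eLpNorm_ofReal_eq hp]
      refine lintegral_rpow_mono hp ?_
      filter_upwards [hzero] with x hx
      rw [Finset.sum_congr rfl (hx k)]
      exact (enorm_sum_le _ _).trans (Finset.sum_le_sum fun W _ => enorm_tsum_le _)
    · filter_upwards [hF, hae, hzero] with x hx hx1 hx2
      rw [hx, tsum_tsum_sum_comm_of_enorm hx1]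
      exact tsum_congr fun k => Finset.sum_congr rfl fun W hW => (hx2 k W hW).symm
  obtain ⟨z, hz, hzn⟩ := hC.2 F d b hbatom hrep
  exact ⟨z, hz, hdD ▸ hzn⟩

end GBS

end GoodGridBesov

/-! ### Averages on cells and conditional expectations -/

namespace GoodGridBesov

section Averages

variable {X : Type*} [MeasurableSpace X] {m : Measure X} {Q : Set X}

/-- The average of `f` on `Q`. -/
noncomputable def cellAvg (m : Measure X) (Q : Set X) (f : X → ℂ) : ℂ :=
  (((m.real Q)⁻¹ : ℝ) : ℂ) * ∫ x in Q, f x ∂m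

theorem cellAvg_eq_add {f g : X → ℂ} (hf : Integrable f m) (hg : Integrable g m) :
    cellAvg m Q f = cellAvg m Q (fun x => f x - g x) + cellAvg m Q g := by
  rw [cellAvg, cellAvg, cellAvg, integral_sub hf.restrict hg.restrict]
  ring

/-- The average on `Q` as a functional on `L¹`. -/
noncomputable def cellAvgCLM (m : Measure X) (Q : Set X) : Lp ℂ 1 m →L[ℂ] ℂ :=
  (((m.real Q)⁻¹ : ℝ) : ℂ) • (L1.integralCLM' ℂ).comp (LpToLpRestrictCLM X ℂ ℂ m 1 Q)

theorem cellAvgCLM_apply (f : Lp ℂ 1 m) : cellAvgCLM m Q f = cellAvg m Q f := by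
  rw [cellAvg, cellAvgCLM]
  simp only [_root_.smul_apply, ContinuousLinearMap.comp_apply, smul_eq_mul]
  congr 1
  rw [← L1.integral_eq' ℂ, L1.integral_eq_integral]
  exact integral_congr_ae (LpToLpRestrictCLM_coeFn ℂ Q f)

variable [IsProbabilityMeasure m]

theorem cellAvg_of_const {f : X → ℂ} {a : ℂ} (hQ : m Q ≠ 0) (hQm : MeasurableSet Q)
    (h : ∀ x ∈ Q, f x = a) : cellAvg m Q f = a := by
  have h2 : m.real Q ≠ 0 := (ENNReal.toReal_pos hQ (measure_ne_top m Q)).ne'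
  rw [cellAvg, setIntegral_congr_fun hQm (g := fun _ => a) h, setIntegral_const, Complex.real_smul,
    ← mul_assoc, ← Complex.ofReal_mul, inv_mul_cancel₀ h2, Complex.ofReal_one, one_mul]

theorem enorm_cellAvg_le (hQ : m Q ≠ 0) (f : X → ℂ) :
    ‖cellAvg m Q f‖ₑ ≤ (m Q)⁻¹ * ∫⁻ x in Q, ‖f x‖ₑ ∂m := by
  have h2 : 0 < m.real Q := ENNReal.toReal_pos hQ (measure_ne_top m Q)
  rw [cellAvg, enorm_mul]
  refine mul_le_mul' (le_of_eq ?_) (enorm_integral_le_lintegral_enorm _)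
  rw [← ofReal_norm, Complex.norm_real, Real.norm_of_nonneg (by positivity),
    ENNReal.ofReal_inv_of_pos h2, ofReal_measureReal]

theorem laverage_rpow_le {p : ℝ} (hp : 1 ≤ p) (hQ : m Q ≠ 0) {u : X → ℝ≥0∞} (hu : AEMeasurable u m) :
    ((m Q)⁻¹ * ∫⁻ x in Q, u x ∂m) ^ p ≤ (m Q)⁻¹ * ∫⁻ x in Q, u x ^ p ∂m := by
  have h := lintegral_rpow_le_measure_univ (m.restrict Q) hu.restrict hp
  rw [Measure.restrict_apply_univ] at h
  rw [ENNReal.mul_rpow_of_nonneg _ _ (by linarith)]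
  refine (mul_le_mul' le_rfl h).trans_eq ?_
  rw [← mul_assoc]
  congr 1
  rw [← ENNReal.rpow_neg_one, ← ENNReal.rpow_mul, measure_rpow_mul hQ]
  congr 1; ring

end Averages

section Projections

variable {X : Type*} [MeasurableSpace X] {m : Measure X} {P : ℕ → Finset (Set X)}
  {l₁ l₂ : ℝ} {p s : ℝ} {q : ℝ≥0∞}

open scoped Classical in
/-- The parent of a cell of level `k + 1`. -/
noncomputable def parent (P : ℕ → Finset (Set X)) (k : ℕ) (Q : Set X) : Set X :=
  if h : ∃ R ∈ P k, Q ⊆ R then h.choose else ∅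

theorem IsGoodGrid.parent_mem (hP : IsGoodGrid m P l₁ l₂) {k : ℕ} {Q : Set X} (hQ : Q ∈ P (k + 1)) :
    parent P k Q ∈ P k := by
  have h := hP.nested k Q hQ
  rw [parent, dif_pos h]
  exact h.choose_spec.1

theorem IsGoodGrid.subset_parent (hP : IsGoodGrid m P l₁ l₂) {k : ℕ} {Q : Set X}
    (hQ : Q ∈ P (k + 1)) : Q ⊆ parent P k Q := by
  have h := hP.nested k Q hQ
  rw [parent, dif_pos h]
  exact h.choose_spec.2

/-- The coefficient functionals of the martingale-difference representation. -/
noncomputable def diffCoef (m : Measure X) (P : ℕ → Finset (Set X)) (s p : ℝ) :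
    ℕ → Set X → (Lp ℂ 1 m →L[ℂ] ℂ)
  | 0, Q => ((m.real Q ^ (1 / p - s) : ℝ) : ℂ) • cellAvgCLM m Q
  | k + 1, Q => ((m.real Q ^ (1 / p - s) : ℝ) : ℂ) • (cellAvgCLM m Q - cellAvgCLM m (parent P k Q))

/-- The conditional expectation with respect to the `k`-th family of a grid. -/
noncomputable def cellProj (m : Measure X) (P : ℕ → Finset (Set X)) (k : ℕ) (f : X → ℂ) (x : X) :
    ℂ :=
  ∑ Q ∈ P k, Q.indicator (fun _ => cellAvg m Q f) x

theorem IsGoodGrid.ae_mem_cells (hP : IsGoodGrid m P l₁ l₂) :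
    ∀ᵐ x ∂m, ∀ k, ∃ Q ∈ P k, x ∈ Q := by
  rw [ae_all_iff]
  intro k
  filter_upwards [hP.cover k] with x hx
  have h : x ∈ ⋃ Q ∈ P k, Q := hx.mpr (Set.mem_univ x)
  simpa using h

theorem IsGoodGrid.sum_indicator (hP : IsGoodGrid m P l₁ l₂) {k : ℕ} {Q : Set X} (hQ : Q ∈ P k)
    {x : X} (hx : x ∈ Q) (a : Set X → ℂ) :
    ∑ R ∈ P k, R.indicator (fun _ => a R) x = a Q := by
  rw [Finset.sum_eq_single_of_mem Q hQ, Set.indicator_of_mem hx]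
  intro R hR hne
  exact Set.indicator_of_notMem (fun hxR => hne (hP.eq_of_mem hR hQ hxR hx)) _

variable [IsProbabilityMeasure m]

theorem coef_mul_souzaAtom {Q : Set X} (hQ : m Q ≠ 0) (a : ℂ) (x : X) :
    ((m.real Q ^ (1 / p - s) : ℝ) : ℂ) * a * souzaAtom m s p Q x = Q.indicator (fun _ => a) x := by
  have h2 : 0 < m.real Q := ENNReal.toReal_pos hQ (measure_ne_top m Q)
  by_cases hx : x ∈ Q
  · simp only [souzaAtom, Set.indicator_of_mem hx]
    rw [mul_right_comm, ← Complex.ofReal_mul, ← Real.rpow_add h2]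
    simp
  · simp [souzaAtom, hx]

/-- At a point the block of level k + 1 is the average on its cell minus that on the parent, which
is the cell of level k containing the same point. The sum telescopes. -/
theorem IsGoodGrid.sum_range_diffCoef (hP : IsGoodGrid m P l₁ l₂) (f : Lp ℂ 1 m) {x : X}
    (hx : ∀ k, ∃ Q ∈ P k, x ∈ Q) (n : ℕ) :
    ∑ k ∈ Finset.range (n + 1), ∑ Q ∈ P k, diffCoef m P s p k Q f * souzaAtom m s p Q x =
      cellProj m P n f x := by
  induction n with
  | zero =>
    rw [zero_add, Finset.sum_range_one, cellProj]
    refine Finset.sum_congr rfl fun Q hQ => ?_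
    rw [← coef_mul_souzaAtom (s := s) (p := p) (hP.measure_ne_zero hQ)]
    simp [diffCoef, cellAvgCLM_apply]
  | succ n ih =>
    rw [Finset.sum_range_succ, ih]
    obtain ⟨Q, hQ, hxQ⟩ := hx (n + 1)
    have e : ∀ R ∈ P (n + 1), diffCoef m P s p (n + 1) R f * souzaAtom m s p R x =
        R.indicator (fun _ => cellAvg m R f - cellAvg m (parent P n R) f) x := fun R hR => by
      rw [← coef_mul_souzaAtom (s := s) (p := p) (hP.measure_ne_zero hR)]
      simp [diffCoef, cellAvgCLM_apply]
    rw [Finset.sum_congr rfl e, cellProj, cellProj,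
      hP.sum_indicator hQ hxQ fun R => cellAvg m R f - cellAvg m (parent P n R) f,
      hP.sum_indicator hQ hxQ fun R => cellAvg m R f,
      hP.sum_indicator (hP.parent_mem hQ) (hP.subset_parent hQ hxQ) fun R => cellAvg m R f]
    ring

/-- Jensen on each cell, then disjointness of the cells. -/
theorem IsGoodGrid.eLpNorm_cellProj_le (hP : IsGoodGrid m P l₁ l₂) (hp : 1 ≤ p) (k : ℕ) {f : X → ℂ}
    (hf : AEStronglyMeasurable f m) :
    eLpNorm (cellProj m P k f) (ENNReal.ofReal p) m ≤ eLpNorm f (ENNReal.ofReal p) m := by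
  have hp0 : 0 < p := by linarith
  rw [eLpNorm_ofReal_eq hp, eLpNorm_ofReal_eq hp]
  refine ENNReal.rpow_le_rpow ?_ (by positivity)
  calc ∫⁻ x, ‖cellProj m P k f x‖ₑ ^ p ∂m
      ≤ ∫⁻ x, (∑ Q ∈ P k, Q.indicator (fun _ => ‖cellAvg m Q f‖ₑ) x) ^ p ∂m := by
        refine lintegral_mono fun x => ENNReal.rpow_le_rpow ?_ hp0.le
        refine (enorm_sum_le _ _).trans_eq (Finset.sum_congr rfl fun Q _ => ?_)
        rw [enorm_indicator_eq_indicator_enorm]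
    _ = ∑ Q ∈ P k, ∫⁻ x, Q.indicator (fun _ => ‖cellAvg m Q f‖ₑ) x ^ p ∂m :=
        hP.lintegral_sum_rpow hp k (fun Q hQ =>
          (measurable_const.indicator (hP.measurableSet k Q hQ)).aemeasurable)
          fun Q _ x hx => Set.indicator_of_notMem hx _
    _ ≤ ∑ Q ∈ P k, ∫⁻ x in Q, ‖f x‖ₑ ^ p ∂m := by
        refine Finset.sum_le_sum fun Q hQ => ?_
        have h0 := hP.measure_ne_zero hQ
        have e : ∀ x, Q.indicator (fun _ => ‖cellAvg m Q f‖ₑ) x ^ p =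
            Q.indicator (fun _ => ‖cellAvg m Q f‖ₑ ^ p) x := fun x => by
          by_cases hx : x ∈ Q <;> simp [hx, hp0]
        simp_rw [e]
        rw [lintegral_indicator_const (hP.measurableSet k Q hQ)]
        calc _ ≤ ((m Q)⁻¹ * ∫⁻ x in Q, ‖f x‖ₑ ^ p ∂m) * m Q := by
              gcongr
              exact (ENNReal.rpow_le_rpow (enorm_cellAvg_le h0 f) hp0.le).trans
                (laverage_rpow_le hp h0 hf.enorm)
          _ = _ := by
            rw [mul_right_comm, ENNReal.inv_mul_cancel h0 (measure_ne_top m Q), one_mul]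
    _ = ∫⁻ x in ⋃ Q ∈ P k, Q, ‖f x‖ₑ ^ p ∂m := by
        rw [lintegral_biUnion_finset]
        · intro Q hQ R hR hne
          exact hP.disjoint k Q hQ R hR hne
        · exact fun Q hQ => hP.measurableSet k Q hQ
    _ ≤ ∫⁻ x, ‖f x‖ₑ ^ p ∂m := setLIntegral_le_lintegral _ _

/-- A cell of level at most k contains Q or misses it. The bound n ≤ k + 1 allows exactly the levels
0, ..., k. -/
theorem IsGoodGrid.sum_range_block_const (hP : IsGoodGrid m P l₁ l₂) (c : ℕ → Set X → ℂ) {k n : ℕ}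
    (hn : n ≤ k + 1) {Q : Set X} (hQ : Q ∈ P k) {x y : X} (hx : x ∈ Q) (hy : y ∈ Q) :
    ∑ j ∈ Finset.range n, ∑ R ∈ P j, c j R * souzaAtom m s p R x =
      ∑ j ∈ Finset.range n, ∑ R ∈ P j, c j R * souzaAtom m s p R y := by
  refine Finset.sum_congr rfl fun j hj => Finset.sum_congr rfl fun R hR => ?_
  congr 1
  have hjk : j ≤ k := by have := Finset.mem_range.1 hj; omega
  obtain ⟨i, rfl⟩ := Nat.exists_eq_add_of_le hjk
  have h : ∀ z ∈ Q, z ∈ R → Q ⊆ R := fun z hz hzR =>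
    (hP.subset_and_measure_le hR hQ ⟨z, hz, hzR⟩).1
  by_cases hxR : x ∈ R
  · simp [souzaAtom, hxR, h x hx hxR hy]
  · have hyR : y ∉ R := fun hyR => hxR (h y hy hyR hx)
    simp [souzaAtom, hxR, hyR]

end Projections

end GoodGridBesov

/-! ### Representation by martingale differences -/

namespace GoodGridBesov

section GC

variable {X : Type*} [MeasurableSpace X] {m : Measure X} {P : ℕ → Finset (Set X)}
  {l₁ l₂ : ℝ} {p s : ℝ} {q : ℝ≥0∞}

/-- The sum of the absolute values of the terms of level `j` of a series of Souza's atoms. -/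
noncomputable def absBlock (m : Measure X) (P : ℕ → Finset (Set X)) (s p : ℝ) (c : ℕ → Set X → ℂ)
    (j : ℕ) (x : X) : ℝ≥0∞ :=
  ∑ R ∈ P j, ‖c j R‖ₑ * ‖souzaAtom m s p R x‖ₑ

theorem IsGrid.measurable_absBlock (hP : IsGrid m P) (c : ℕ → Set X → ℂ) (j : ℕ) :
    Measurable (absBlock m P s p c j) :=
  Finset.measurable_fun_sum _ fun Q hQ =>
    (measurable_souzaAtom (hP.measurableSet j Q hQ)).enorm.const_mul _

variable [IsProbabilityMeasure m]

open scoped Classical in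
-- Jensen bounds the average on Q by the L^p norm there, where level j is seen only through the
-- cells R ⊆ Q. The powers of the measures combine into (|R|/|Q|)^s ≤ l₂^(s (j - k)).
theorem IsGoodGrid.laverage_absBlock_le (hP : IsGoodGrid m P l₁ l₂) (hp : 1 ≤ p) (hs : 0 < s)
    (c : ℕ → Set X → ℂ) {k j : ℕ} (hkj : k ≤ j) {Q : Set X} (hQ : Q ∈ P k) :
    (m Q ^ (1 / p - s) * ((m Q)⁻¹ * ∫⁻ x in Q, absBlock m P s p c j x ∂m)) ^ p ≤
      ((ENNReal.ofReal l₂ ^ s) ^ (j - k)) ^ p *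
        ∑ R ∈ P j, if R ⊆ Q then ‖c j R‖ₑ ^ p else 0 := by
  have hp0 : 0 < p := by linarith
  have h0 := hP.measure_ne_zero hQ
  set y : Set X → ℝ≥0∞ := fun R => if R ⊆ Q then ‖c j R‖ₑ else 0 with hy
  have h1 : ∫⁻ x in Q, absBlock m P s p c j x ^ p ∂m ≤ ∑ R ∈ P j, (y R * m R ^ s) ^ p := by
    have h2 := hP.lintegral_block hp j y (s := s)
    have h3 : ∫⁻ x, (∑ R ∈ P j, y R * ‖souzaAtom m s p R x‖ₑ) ^ p ∂m =
        ∑ R ∈ P j, (y R * m R ^ s) ^ p :=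
      ENNReal.rpow_left_injective (x := 1 / p) (by positivity) h2
    rw [← h3]
    refine le_trans (setLIntegral_mono' (hP.measurableSet k Q hQ) fun x hx => ?_)
      (setLIntegral_le_lintegral Q _)
    refine ENNReal.rpow_le_rpow (Finset.sum_le_sum fun R hR => ?_) hp0.le
    by_cases hxR : x ∈ R
    · obtain ⟨i, rfl⟩ := Nat.exists_eq_add_of_le hkj
      have hsub := (hP.subset_and_measure_le hQ hR ⟨x, hxR, hx⟩).1
      simp [hy, hsub]
    · simp [souzaAtom, hxR]
  calc _ = (m Q ^ (1 / p - s)) ^ p * ((m Q)⁻¹ * ∫⁻ x in Q, absBlock m P s p c j x ∂m) ^ p :=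
        ENNReal.mul_rpow_of_nonneg _ _ hp0.le
    _ ≤ (m Q ^ (1 / p - s)) ^ p * ((m Q)⁻¹ * ∑ R ∈ P j, (y R * m R ^ s) ^ p) := by
        gcongr
        refine (laverage_rpow_le hp h0 (hP.measurable_absBlock c j).aemeasurable).trans ?_
        gcongr
    _ = ∑ R ∈ P j, (y R * (m Q ^ (-s) * m R ^ s)) ^ p := by
        rw [← mul_assoc, Finset.mul_sum]
        refine Finset.sum_congr rfl fun R _ => ?_
        rw [← ENNReal.rpow_neg_one, ← ENNReal.rpow_mul, measure_rpow_mul h0, mul_left_comm,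
          ENNReal.mul_rpow_of_nonneg (m Q ^ (-s)) _ hp0.le, ← ENNReal.rpow_mul]
        congr 2
        field_simp
        ring
    _ ≤ ∑ R ∈ P j, ((ENNReal.ofReal l₂ ^ s) ^ (j - k)) ^ p * (y R) ^ p := by
        refine Finset.sum_le_sum fun R hR => ?_
        rw [← ENNReal.mul_rpow_of_nonneg _ _ hp0.le, mul_comm (y R)]
        refine ENNReal.rpow_le_rpow ?_ hp0.le
        by_cases hRQ : R ⊆ Q
        · gcongr
          calc m Q ^ (-s) * m R ^ s
              ≤ m Q ^ (-s) * ((ENNReal.ofReal l₂ ^ s) ^ (j - k) * m Q ^ s) := by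
                gcongr
                exact hP.measure_rpow_le_mul hs.le hQ hR hkj hRQ
            _ = (ENNReal.ofReal l₂ ^ s) ^ (j - k) := by
                rw [mul_left_comm, measure_rpow_mul h0]; simp
        · simp [hy, hRQ]
    _ = _ := by
        rw [Finset.mul_sum]
        refine Finset.sum_congr rfl fun R _ => ?_
        congr 1
        simp only [hy]
        split_ifs
        · rfl
        · exact ENNReal.zero_rpow_of_pos hp0

open scoped Classical in
-- Applied with π the identity (M = 1) and with π the parent map (M the bound on the number of
-- children). A cell R is counted once for each Q with R ⊆ π Q, hence at most M times.
theorem IsGoodGrid.sum_laverage_absBlock_le (hP : IsGoodGrid m P l₁ l₂) (hp : 1 ≤ p) (hs : 0 < s)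
    (c : ℕ → Set X → ℂ) {k k' j : ℕ} (hkj : k' ≤ j) (π : Set X → Set X)
    (hπ : ∀ Q ∈ P k, π Q ∈ P k') {M : ℝ≥0∞}
    (hM : ∀ Q' ∈ P k', ∑ Q ∈ P k, (if π Q = Q' then (1 : ℝ≥0∞) else 0) ≤ M) :
    (∑ Q ∈ P k, (m (π Q) ^ (1 / p - s) *
        ((m (π Q))⁻¹ * ∫⁻ x in π Q, absBlock m P s p c j x ∂m)) ^ p) ^ (1 / p) ≤
      M ^ (1 / p) * (ENNReal.ofReal l₂ ^ s) ^ (j - k') * (∑ R ∈ P j, ‖c j R‖ₑ ^ p) ^ (1 / p) := by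
  have hp0 : 0 < p := by linarith
  have hcount : ∀ R ∈ P j, ∑ Q ∈ P k, (if R ⊆ π Q then (1 : ℝ≥0∞) else 0) ≤ M := by
    intro R hR
    by_cases h : ∃ Q ∈ P k, R ⊆ π Q
    · obtain ⟨Q₀, hQ₀, hRQ₀⟩ := h
      refine le_trans (Finset.sum_le_sum fun Q hQ => ?_) (hM (π Q₀) (hπ Q₀ hQ₀))
      by_cases hRQ : R ⊆ π Q
      · obtain ⟨x, hx⟩ := hP.nonempty_of_mem hR
        rw [if_pos hRQ, if_pos (hP.eq_of_mem (hπ Q hQ) (hπ Q₀ hQ₀) (hRQ hx) (hRQ₀ hx))]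
      · simp [hRQ]
    · push Not at h
      rw [Finset.sum_eq_zero fun Q hQ => if_neg (h Q hQ)]
      exact zero_le
  set r := (ENNReal.ofReal l₂ ^ s) ^ (j - k')
  have h1 : ∑ Q ∈ P k, (m (π Q) ^ (1 / p - s) *
      ((m (π Q))⁻¹ * ∫⁻ x in π Q, absBlock m P s p c j x ∂m)) ^ p ≤
      M * r ^ p * ∑ R ∈ P j, ‖c j R‖ₑ ^ p := by
    calc _ ≤ ∑ Q ∈ P k, r ^ p * ∑ R ∈ P j, (if R ⊆ π Q then ‖c j R‖ₑ ^ p else 0) :=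
          Finset.sum_le_sum fun Q hQ => hP.laverage_absBlock_le hp hs c hkj (hπ Q hQ)
      _ = r ^ p * ∑ R ∈ P j, (∑ Q ∈ P k, if R ⊆ π Q then (1 : ℝ≥0∞) else 0) * ‖c j R‖ₑ ^ p := by
          rw [← Finset.mul_sum, Finset.sum_comm]
          simp only [Finset.sum_mul, ite_mul, one_mul, zero_mul]
      _ ≤ r ^ p * ∑ R ∈ P j, M * ‖c j R‖ₑ ^ p := by
          refine mul_le_mul' le_rfl (Finset.sum_le_sum fun R hR => ?_)
          exact mul_le_mul' (hcount R hR) le_rfl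
      _ = _ := by rw [← Finset.mul_sum]; ring
  refine (ENNReal.rpow_le_rpow h1 (by positivity)).trans_eq ?_
  rw [ENNReal.mul_rpow_of_nonneg _ _ (by positivity), ENNReal.mul_rpow_of_nonneg _ _ (by positivity),
    ← ENNReal.rpow_mul, mul_one_div_cancel hp0.ne', ENNReal.rpow_one]

open scoped Classical in
-- Children are disjoint and each fills at least the fraction l₁ of Q'.
theorem IsGoodGrid.card_children_le (hP : IsGoodGrid m P l₁ l₂) {k : ℕ} {Q' : Set X}
    (hQ' : Q' ∈ P k) :
    ∑ Q ∈ P (k + 1), (if parent P k Q = Q' then (1 : ℝ≥0∞) else 0) ≤ (ENNReal.ofReal l₁)⁻¹ := by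
  have h0 := hP.measure_ne_zero hQ'
  rw [ENNReal.le_inv_iff_mul_le,
    ← ENNReal.mul_le_mul_iff_left h0 (measure_ne_top m Q'), one_mul, mul_assoc, Finset.sum_mul]
  calc _ ≤ ∑ Q ∈ P (k + 1), if parent P k Q = Q' then m Q else 0 := by
        refine Finset.sum_le_sum fun Q hQ => ?_
        split_ifs with h
        · rw [one_mul]
          exact hP.mul_le_measure hQ hQ' (h ▸ hP.subset_parent hQ)
        · simp
    _ = ∑ Q ∈ P (k + 1) with parent P k Q = Q', m Q := by rw [Finset.sum_filter]
    _ = m (⋃ Q ∈ (P (k + 1)).filter fun Q => parent P k Q = Q', Q) := by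
        rw [measure_biUnion_finset]
        · intro Q hQ R hR hne
          exact hP.disjoint (k + 1) Q (Finset.mem_filter.1 hQ).1 R (Finset.mem_filter.1 hR).1 hne
        · exact fun Q hQ => hP.measurableSet (k + 1) Q (Finset.mem_filter.1 hQ).1
    _ ≤ m Q' := by
        refine measure_mono (Set.iUnion₂_subset fun Q hQ => ?_)
        obtain ⟨h1, h2⟩ := Finset.mem_filter.1 hQ
        exact h2 ▸ hP.subset_parent h1

theorem IsGoodGrid.enorm_sub_sum_range_le (hP : IsGoodGrid m P l₁ l₂) (hp : 1 ≤ p) (hq : 1 ≤ q)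
    (hs : 0 < s) {c : ℕ → Set X → ℂ} {f : X → ℂ} (hc : IsRep m P s p q c f) (n : ℕ) :
    ∀ᵐ x ∂m, ‖f x - ∑ j ∈ Finset.range n, ∑ R ∈ P j, c j R * souzaAtom m s p R x‖ₑ ≤
      ∑' i, absBlock m P s p c (i + n) x := by
  filter_upwards [hP.isRep_ae_eq hp hc, hP.ae_tsum_block_ne_top hp hq hs (m := m) hc.2] with x h1 h2
  have hle : ∀ j, ‖∑ R ∈ P j, c j R * souzaAtom m s p R x‖ₑ ≤ absBlock m P s p c j x := fun j =>
    (enorm_sum_le _ _).trans_eq (Finset.sum_congr rfl fun R _ => enorm_mul _ _)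
  have hsum := summable_of_tsum_enorm_ne_top (ne_top_of_le_ne_top h2 (ENNReal.tsum_le_tsum hle))
  rw [h1, ← hsum.sum_add_tsum_nat_add n, add_sub_cancel_left]
  exact (enorm_tsum_le _).trans (ENNReal.tsum_le_tsum fun i => hle _)

theorem IsGoodGrid.enorm_cellAvg_sub_le (hP : IsGoodGrid m P l₁ l₂) (hp : 1 ≤ p) (hq : 1 ≤ q)
    (hs : 0 < s) {c : ℕ → Set X → ℂ} {f : X → ℂ} (hc : IsRep m P s p q c f) (n : ℕ) {k : ℕ}
    {Q : Set X} (hQ : Q ∈ P k) :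
    ‖cellAvg m Q fun x => f x - ∑ j ∈ Finset.range n, ∑ R ∈ P j, c j R * souzaAtom m s p R x‖ₑ ≤
      ∑' i, (m Q)⁻¹ * ∫⁻ x in Q, absBlock m P s p c (i + n) x ∂m := by
  refine (enorm_cellAvg_le (hP.measure_ne_zero hQ) _).trans ?_
  rw [ENNReal.tsum_mul_left,
    ← lintegral_tsum fun i => (hP.measurable_absBlock c (i + n)).aemeasurable]
  exact mul_le_mul' le_rfl
    (lintegral_mono_ae (ae_restrict_of_ae (hP.enorm_sub_sum_range_le hp hq hs hc n)))

theorem IsGoodGrid.integrable_block (hP : IsGoodGrid m P l₁ l₂) (c : ℕ → Set X → ℂ) (n : ℕ) :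
    Integrable (fun x => ∑ j ∈ Finset.range n, ∑ R ∈ P j, c j R * souzaAtom m s p R x) m := by
  refine integrable_finsetSum _ fun j _ => integrable_finsetSum _ fun R hR => ?_
  exact ((integrable_const _).indicator (hP.measurableSet j R hR)).const_mul _

theorem ofReal_enorm_rpow {Q : Set X} (hQ : m Q ≠ 0) (t : ℝ) :
    ‖((m.real Q ^ t : ℝ) : ℂ)‖ₑ = m Q ^ t := by
  rw [← ofReal_norm, Complex.norm_real, Real.norm_of_nonneg (by positivity),
    ofReal_measureReal_rpow hQ]

/-- Before averaging on Q of level k, subtract from f the levels below k of the given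
representation. That part is constant on the parent and drops out of the difference, so only levels
j ≥ k remain. The cell itself accounts for the 1 in the constant, the parent for l₁^(-1/p). -/
theorem IsGoodGrid.sum_diffCoef_le (hP : IsGoodGrid m P l₁ l₂) (hp : 1 ≤ p) (hq : 1 ≤ q)
    (hs : 0 < s) (hsp : s ≤ 1 / p) {c : ℕ → Set X → ℂ} {f : Lp ℂ 1 m} (hc : IsRep m P s p q c f)
    (k : ℕ) :
    (∑ Q ∈ P k, ‖diffCoef m P s p k Q f‖ₑ ^ p) ^ (1 / p) ≤
      ∑' j, lowerKernel (1 + (ENNReal.ofReal l₁)⁻¹ ^ (1 / p)) (ENNReal.ofReal l₂ ^ s) j k *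
        (∑ R ∈ P j, ‖c j R‖ₑ ^ p) ^ (1 / p) := by
  classical
  have hp0 : 0 < p := by linarith
  set r := ENNReal.ofReal l₂ ^ s with hr
  set M := (ENNReal.ofReal l₁)⁻¹ with hM
  set A : Set X → ℕ → ℝ≥0∞ := fun Q j =>
    m Q ^ (1 / p - s) * ((m Q)⁻¹ * ∫⁻ x in Q, absBlock m P s p c j x ∂m) with hA
  set N : ℕ → ℝ≥0∞ := fun j => (∑ R ∈ P j, ‖c j R‖ₑ ^ p) ^ (1 / p) with hN
  have hr1 : r ≤ 1 := (hP.ofReal_l₂_rpow_lt_one hs).le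
  have hself : ∀ k j, k ≤ j → (∑ Q ∈ P k, A Q j ^ p) ^ (1 / p) ≤ r ^ (j - k) * N j := by
    intro k j hkj
    have h := hP.sum_laverage_absBlock_le hp hs c hkj (k := k) (π := id) (M := 1)
      (fun Q hQ => hQ) fun Q' hQ' => by
        simp only [id]
        rw [Finset.sum_ite_eq_of_mem' _ _ _ hQ']
    simp only [id, ENNReal.one_rpow, one_mul] at h
    exact h
  have hshift : ∀ k, ∑' i, (1 + M ^ (1 / p)) * r ^ i * N (i + k) ≤
      ∑' j, lowerKernel (1 + M ^ (1 / p)) r j k * N j := by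
    intro k
    refine le_trans (le_of_eq (tsum_congr fun i => ?_))
      (ENNReal.tsum_comp_le_tsum_of_injective (add_left_injective k)
        fun j => lowerKernel (1 + M ^ (1 / p)) r j k * N j)
    simp [lowerKernel]
  cases k with
  | zero =>
    refine le_trans ?_ (hshift 0)
    have h1 : ∀ Q ∈ P 0, ‖diffCoef m P s p 0 Q f‖ₑ ≤ ∑' i, A Q i := by
      intro Q hQ
      have h := hP.enorm_cellAvg_sub_le hp hq hs hc 0 hQ
      simp only [Finset.range_zero, Finset.sum_empty, sub_zero, add_zero] at h
      have e : diffCoef m P s p 0 Q f = ((m.real Q ^ (1 / p - s) : ℝ) : ℂ) * cellAvg m Q f := by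
        simp [diffCoef, cellAvgCLM_apply]
      rw [e, enorm_mul, ofReal_enorm_rpow (hP.measure_ne_zero hQ), hA, ENNReal.tsum_mul_left]
      gcongr
    calc _ ≤ (∑ Q ∈ P 0, (∑' i, A Q i) ^ p) ^ (1 / p) := by
          refine ENNReal.rpow_le_rpow (Finset.sum_le_sum fun Q hQ => ?_) (by positivity)
          exact ENNReal.rpow_le_rpow (h1 Q hQ) hp0.le
      _ ≤ ∑' i, (∑ Q ∈ P 0, A Q i ^ p) ^ (1 / p) := sum_tsum_rpow_le (P 0) (fun i Q => A Q i) hp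
      _ ≤ _ := by
          refine ENNReal.tsum_le_tsum fun i => (hself 0 i (Nat.zero_le i)).trans ?_
          rw [Nat.sub_zero, add_zero]
          gcongr
          exact le_mul_of_one_le_left zero_le le_self_add
  | succ k =>
    refine le_trans ?_ (hshift (k + 1))
    have h1 : ∀ Q ∈ P (k + 1), ‖diffCoef m P s p (k + 1) Q f‖ₑ ≤
        ∑' i, (A Q (i + (k + 1)) + A (parent P k Q) (i + (k + 1))) := by
      intro Q hQ
      have hpar := hP.parent_mem hQ
      have hsub := hP.subset_parent hQ
      set S : X → ℂ := fun x =>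
        ∑ j ∈ Finset.range (k + 1), ∑ R ∈ P j, c j R * souzaAtom m s p R x with hS
      have hSi : Integrable S m := hP.integrable_block c (k + 1)
      have hfi : Integrable f m := L1.integrable_coeFn f
      have hdec : ∀ R, cellAvg m R f = cellAvg m R (fun x => f x - S x) + cellAvg m R S := fun R =>
        cellAvg_eq_add hfi hSi
      obtain ⟨x₀, hx₀⟩ := hP.nonempty_of_mem hQ
      -- Both averages of S equal its value at one point of Q, so they cancel in the difference.
      have hc1 : cellAvg m Q S = S x₀ :=
        cellAvg_of_const (hP.measure_ne_zero hQ) (hP.measurableSet _ Q hQ) fun x hx =>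
          hP.sum_range_block_const c le_rfl hpar (hsub hx) (hsub hx₀)
      have hc2 : cellAvg m (parent P k Q) S = S x₀ :=
        cellAvg_of_const (hP.measure_ne_zero hpar) (hP.measurableSet _ _ hpar) fun x hx =>
          hP.sum_range_block_const c le_rfl hpar hx (hsub hx₀)
      have e : diffCoef m P s p (k + 1) Q f = ((m.real Q ^ (1 / p - s) : ℝ) : ℂ) *
          (cellAvg m Q (fun x => f x - S x) - cellAvg m (parent P k Q) fun x => f x - S x) := by
        have : diffCoef m P s p (k + 1) Q f = ((m.real Q ^ (1 / p - s) : ℝ) : ℂ) *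
            (cellAvg m Q f - cellAvg m (parent P k Q) f) := by
          simp [diffCoef, cellAvgCLM_apply]
        rw [this, hdec Q, hdec (parent P k Q), hc1, hc2, add_sub_add_right_eq_sub]
      rw [e, enorm_mul, ofReal_enorm_rpow (hP.measure_ne_zero hQ), ENNReal.tsum_add]
      refine (mul_le_mul' le_rfl enorm_sub_le).trans ?_
      rw [mul_add]
      simp only [hA, ENNReal.tsum_mul_left (a := m _ ^ (1 / p - s))]
      refine add_le_add (mul_le_mul' le_rfl (hP.enorm_cellAvg_sub_le hp hq hs hc (k + 1) hQ))
        (mul_le_mul' ?_ (hP.enorm_cellAvg_sub_le hp hq hs hc (k + 1) hpar))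
      -- The exponent 1/p - s is nonnegative, so the weight of Q may be replaced by that of its
      -- parent.
      exact ENNReal.rpow_le_rpow (measure_mono hsub) (by linarith)
    have hparent : ∀ j, k + 1 ≤ j →
        (∑ Q ∈ P (k + 1), A (parent P k Q) j ^ p) ^ (1 / p) ≤
          M ^ (1 / p) * r ^ (j - (k + 1)) * N j := by
      intro j hkj
      refine (hP.sum_laverage_absBlock_le hp hs c (k := k + 1) (k' := k) (by omega)
        (parent P k) (fun Q hQ => hP.parent_mem hQ)
        fun Q' hQ' => hP.card_children_le hQ').trans ?_
      gcongr _ * ?_ * _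
      -- Measured from the parent's level the decay has one more factor r ≤ 1, which is discarded.
      exact pow_le_pow_of_le_one zero_le hr1 (by omega)
    calc _ ≤ (∑ Q ∈ P (k + 1),
            (∑' i, (A Q (i + (k + 1)) + A (parent P k Q) (i + (k + 1)))) ^ p) ^ (1 / p) := by
          refine ENNReal.rpow_le_rpow (Finset.sum_le_sum fun Q hQ => ?_) (by positivity)
          exact ENNReal.rpow_le_rpow (h1 Q hQ) hp0.le
      _ ≤ ∑' i, (∑ Q ∈ P (k + 1),
            (A Q (i + (k + 1)) + A (parent P k Q) (i + (k + 1))) ^ p) ^ (1 / p) :=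
          sum_tsum_rpow_le (P (k + 1))
            (fun i Q => A Q (i + (k + 1)) + A (parent P k Q) (i + (k + 1))) hp
      _ ≤ _ := by
          refine ENNReal.tsum_le_tsum fun i => (sum_add_rpow_le _ _ _ hp).trans ?_
          refine (add_le_add (hself (k + 1) (i + (k + 1)) (by omega))
            (hparent (i + (k + 1)) (by omega))).trans_eq ?_
          rw [Nat.add_sub_cancel]
          ring

/-- Existence of bounded linear functionals that provide almost optimal representations. -/
theorem IsGoodGrid.exists_isGCConstant (hP : IsGoodGrid m P l₁ l₂) (hp : 1 ≤ p) (hq : 1 ≤ q)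
    (hs : 0 < s) (hsp : s ≤ 1 / p) : ∃ C : ℝ, IsGCConstant m P s p q C := by
  have hp0 : 0 < p := by linarith
  set c₀ : ℝ≥0∞ := 1 + (ENNReal.ofReal l₁)⁻¹ ^ (1 / p) with hc₀
  have hc₀t : c₀ ≠ ∞ := by
    refine ENNReal.add_ne_top.2 ⟨by simp, ENNReal.rpow_ne_top_of_nonneg (by positivity) ?_⟩
    simpa using hP.l₁_pos
  set S : ℝ≥0∞ := c₀ * ∑' i, (ENNReal.ofReal l₂ ^ s) ^ i with hS
  have hSt : S ≠ ∞ := ENNReal.mul_ne_top hc₀t (geometric_ne_top (hP.ofReal_l₂_rpow_lt_one hs))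
  have key : ∀ (f : Lp ℂ 1 m) (c : ℕ → Set X → ℂ), IsRep m P s p q c f →
      coefNorm P p q (fun k Q => diffCoef m P s p k Q f) ≤ S * coefNorm P p q c := fun f c hc =>
    (lqNorm_mono fun k => hP.sum_diffCoef_le hp hq hs hsp hc k).trans
      (lqNorm_kernel_le hq (fun k j => lowerKernel c₀ (ENNReal.ofReal l₂ ^ s) j k)
        (fun k => tsum_lowerKernel_left_le _ _ k) (fun j => tsum_lowerKernel_right_le _ _ j) _)
  -- The maximum is there because a GC constant is required to be at least 1.
  refine ⟨max 1 S.toReal, le_max_left _ _, diffCoef m P s p, fun f hf => ?_⟩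
  obtain ⟨c, hc⟩ := hf
  refine ⟨⟨hc.1, ?_, ?_, ?_⟩, ?_⟩
  · exact ne_top_of_le_ne_top (ENNReal.mul_ne_top hSt hc.2) (key f c hc)
  · exact hP.abs_conv hp hq hs
      (ne_top_of_le_ne_top (ENNReal.mul_ne_top hSt hc.2) (key f c hc))
  · rw [← tendsto_add_atTop_iff_nat 1]
    have h2 := ENNReal.Tendsto.const_mul (a := 2) ((tendsto_add_atTop_iff_nat 1).2 hc.4)
      (Or.inr (by simp))
    rw [mul_zero] at h2
    refine tendsto_of_tendsto_of_tendsto_of_le_of_le tendsto_const_nhds h2 (fun _ => zero_le)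
      fun n => ?_
    set T : X → ℂ := fun x =>
      ∑ j ∈ Finset.range (n + 1), ∑ R ∈ P j, c j R * souzaAtom m s p R x with hT
    have hTi : Integrable T m := hP.integrable_block c (n + 1)
    have hfi : Integrable f m := L1.integrable_coeFn f
    -- The projection fixes the partial sum T of the given representation, so the error is (f - T)
    -- minus its projection, with norm at most 2 ‖f - T‖.
    have hae : (fun x => f x - ∑ k ∈ Finset.range (n + 1), ∑ Q ∈ P k,
        diffCoef m P s p k Q f * souzaAtom m s p Q x) =ᵐ[m]
        (fun x => f x - T x) - cellProj m P n (fun x => f x - T x) := by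
      filter_upwards [hP.ae_mem_cells] with x hx
      rw [hP.sum_range_diffCoef f hx n, Pi.sub_apply]
      obtain ⟨Q, hQ, hxQ⟩ := hx n
      have e1 : ∀ g : X → ℂ, cellProj m P n g x = cellAvg m Q g := fun g =>
        hP.sum_indicator hQ hxQ fun R => cellAvg m R g
      have e2 : cellAvg m Q T = T x :=
        cellAvg_of_const (hP.measure_ne_zero hQ) (hP.measurableSet n Q hQ) fun y hy =>
          hP.sum_range_block_const c le_rfl hQ hy hxQ
      have e3 : cellAvg m Q f = cellAvg m Q (fun x => f x - T x) + cellAvg m Q T := cellAvg_eq_add hfi hTi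
      rw [e1, e1, e3, e2]
      ring
    rw [eLpNorm_congr_ae hae, two_mul]
    have hm : AEStronglyMeasurable (fun x => f x - T x) m := (hfi.sub hTi).1
    have hm' : AEStronglyMeasurable (cellProj m P n fun x => f x - T x) m :=
      (Finset.measurable_fun_sum _ fun Q hQ =>
        measurable_const.indicator (hP.measurableSet n Q hQ)).aestronglyMeasurable
    exact (eLpNorm_sub_le hm hm' (one_le_ofReal hp)).trans
      (add_le_add le_rfl (hP.eLpNorm_cellProj_le hp n hm))
  · have hS' : S ≤ ENNReal.ofReal (max 1 S.toReal) := by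
      rw [← ENNReal.ofReal_toReal hSt]
      refine ENNReal.ofReal_le_ofReal ?_
      rw [ENNReal.ofReal_toReal hSt]
      exact le_max_right _ _
    have hC0 : ENNReal.ofReal (max 1 S.toReal) ≠ 0 := by simp
    rw [← ENNReal.div_le_iff' hC0 ENNReal.ofReal_ne_top]
    refine le_iInf₂ fun d hd => ?_
    rw [ENNReal.div_le_iff' hC0 ENNReal.ofReal_ne_top]
    exact (key f d hd).trans (mul_le_mul' hS' le_rfl)

end GC

end GoodGridBesov

namespace GoodGridBesov

/-! ## The transfer operator on regularly sliced series -/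

/-- The symmetric kernel `r^{|k - j|}`. -/
noncomputable def symmKernel (r : ℝ≥0∞) (k j : ℕ) : ℝ≥0∞ := r ^ ((k - j) + (j - k))

theorem symmKernel_comm (r : ℝ≥0∞) (k j : ℕ) : symmKernel r k j = symmKernel r j k := by
  rw [symmKernel, symmKernel, add_comm]

/-- One geometric series on each side of the diagonal, which is counted twice. This is the 2 in
`constD`. -/
theorem tsum_symmKernel_le (r : ℝ≥0∞) (k : ℕ) : ∑' j, symmKernel r k j ≤ 2 * ∑' i, r ^ i := by
  have h : ∀ j, symmKernel r k j ≤ lowerKernel 1 r k j + lowerKernel 1 r j k := by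
    intro j
    rcases le_total j k with h | h
    · refine le_trans (le_of_eq ?_) le_self_add
      simp [symmKernel, lowerKernel, h, Nat.sub_eq_zero_of_le h]
    · refine le_trans (le_of_eq ?_) le_add_self
      simp [symmKernel, lowerKernel, h, Nat.sub_eq_zero_of_le h]
  refine (ENNReal.tsum_le_tsum h).trans ?_
  rw [ENNReal.tsum_add, two_mul]
  exact add_le_add ((tsum_lowerKernel_right_le 1 r k).trans_eq (one_mul _))
    ((tsum_lowerKernel_left_le 1 r k).trans_eq (one_mul _))

theorem sum_rpow_of_subsingleton_support {κ : Type*} [Fintype κ] {p : ℝ} (hp : 0 < p)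
    {u : κ → ℝ≥0∞} (hu : ∀ a b, u a ≠ 0 → u b ≠ 0 → a = b) :
    (∑ a, u a) ^ p = ∑ a, u a ^ p := by
  by_cases h : ∃ a, u a ≠ 0
  · obtain ⟨a, ha⟩ := h
    have h0 : ∀ b, b ≠ a → u b = 0 := fun b hb => by
      by_contra hne
      exact hb (hu b a hne ha)
    rw [Fintype.sum_eq_single a h0, Fintype.sum_eq_single a]
    intro b hb
    rw [h0 b hb, ENNReal.zero_rpow_of_pos hp]
  · push Not at h
    simp [h, hp]

/-- Here a = |Q|, o = |h⁻¹ Q|, S is the sum of |W|^(1 - s p) over the pieces of level k, n = k -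
k₀(h⁻¹ Q), κ = |j - k₀(h⁻¹ Q)| and δ = |k - j|. All powers of a and o cancel except (a / o)^e, which
is at most DC1^ε L^κ, while S^(1/p) supplies L^n. Since κ + n exceeds both A and δ, it exceeds (1 -
γ) A + γ δ: the share 1 - γ goes into Θ, the share γ into decay between levels. -/
theorem branch_weight_le {p s e ε γ a o S A DGD1 DGD2 DC1 DC2 DRP L κ δ : ℝ} {n : ℕ} (hp : 0 < p)
    (hε : 0 < ε) (he : |e| = ε) (hγ0 : 0 ≤ γ) (hγ1 : γ ≤ 1) (ha : 0 < a) (ho : 0 < o) (hS0 : 0 ≤ S)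
    (hG1 : 0 < DGD1) (hG2 : 0 < DGD2) (hC1 : 0 < DC1) (hC2 : 0 < DC2) (hR : 0 < DRP)
    (hL1 : L < 1) (hLC : DC2 ^ ε ≤ L) (hLG : DGD2 ^ (1 / p) ≤ L)
    (hκ0 : 0 ≤ κ) (hA : A ≤ κ) (hδ : δ ≤ κ + n)
    (hsc : (a / o) ^ (e / |e|) ≤ DC1 * DC2 ^ κ) (hS : S ≤ DGD1 * DGD2 ^ n * o ^ (1 - s * p)) :
    a ^ (s - 1 / p) * (DRP * (a / o) ^ (1 / p - s + e)) * S ^ (1 / p) ≤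
      DC1 ^ ε * DRP * DGD1 ^ (1 / p) * L ^ (A * (1 - γ)) * L ^ (γ * δ) := by
  have hL0 : 0 < L := (Real.rpow_pos_of_pos hC2 ε).trans_le hLC
  have hao : 0 < a / o := div_pos ha ho
  have h1 : (a / o) ^ e ≤ DC1 ^ ε * L ^ κ := by
    calc (a / o) ^ e = ((a / o) ^ (e / |e|)) ^ ε := by
          rw [← Real.rpow_mul hao.le, ← he, div_mul_cancel₀ _ (by rw [he]; exact hε.ne')]
      _ ≤ (DC1 * DC2 ^ κ) ^ ε := Real.rpow_le_rpow (by positivity) hsc hε.le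
      _ = DC1 ^ ε * (DC2 ^ ε) ^ κ := by
          rw [Real.mul_rpow hC1.le (by positivity), ← Real.rpow_mul hC2.le, ← Real.rpow_mul hC2.le,
            mul_comm κ]
      _ ≤ DC1 ^ ε * L ^ κ := by gcongr
  have h2 : S ^ (1 / p) ≤ DGD1 ^ (1 / p) * L ^ (n : ℝ) * o ^ (1 / p - s) := by
    calc S ^ (1 / p) ≤ (DGD1 * DGD2 ^ n * o ^ (1 - s * p)) ^ (1 / p) := by gcongr
      _ = DGD1 ^ (1 / p) * (DGD2 ^ (1 / p)) ^ (n : ℝ) * o ^ (1 / p - s) := by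
          rw [Real.mul_rpow (by positivity) (by positivity), Real.mul_rpow hG1.le (by positivity),
            ← Real.rpow_mul ho.le, ← Real.rpow_natCast, ← Real.rpow_mul hG2.le,
            ← Real.rpow_mul hG2.le, mul_comm (n : ℝ)]
          congr 2
          field_simp
      _ ≤ _ := by gcongr
  have h3 : L ^ κ * L ^ (n : ℝ) ≤ L ^ (A * (1 - γ)) * L ^ (γ * δ) := by
    rw [← Real.rpow_add hL0, ← Real.rpow_add hL0]
    refine Real.rpow_le_rpow_of_exponent_ge hL0 hL1.le ?_
    have hn : (0 : ℝ) ≤ n := Nat.cast_nonneg n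
    nlinarith [mul_le_mul_of_nonneg_right (hA.trans (le_add_of_nonneg_right hn))
      (sub_nonneg.2 hγ1), mul_le_mul_of_nonneg_left hδ hγ0]
  calc a ^ (s - 1 / p) * (DRP * (a / o) ^ (1 / p - s + e)) * S ^ (1 / p)
      ≤ a ^ (s - 1 / p) * (DRP * ((a / o) ^ (1 / p - s) * (DC1 ^ ε * L ^ κ))) *
          (DGD1 ^ (1 / p) * L ^ (n : ℝ) * o ^ (1 / p - s)) := by
        rw [Real.rpow_add hao]
        gcongr
    _ = (a ^ (s - 1 / p) * a ^ (1 / p - s)) * (DC1 ^ ε * DRP * DGD1 ^ (1 / p)) *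
          (L ^ κ * L ^ (n : ℝ)) := by
        rw [Real.div_rpow ha.le ho.le]
        have : o ^ (1 / p - s) ≠ 0 := (Real.rpow_pos_of_pos ho _).ne'
        field_simp
    _ = (DC1 ^ ε * DRP * DGD1 ^ (1 / p)) * (L ^ κ * L ^ (n : ℝ)) := by
        rw [← Real.rpow_add ha]; simp
    _ ≤ (DC1 ^ ε * DRP * DGD1 ^ (1 / p)) * (L ^ (A * (1 - γ)) * L ^ (γ * δ)) := by gcongr
    _ = _ := by ring

/-- The families are replaced by ∅ below level k₀, where the definition says nothing. Disjointness
gives a unique cell around each point, and a cell determines its level, so the pair (k, W) is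
unique. -/
theorem IsRegularDomain.exists_family {X : Type*} [MeasurableSpace X] {m : Measure X}
    {P : ℕ → Finset (Set X)} {l₁ l₂ : ℝ} [IsFiniteMeasure m] (hP : IsGoodGrid m P l₁ l₂)
    {α C l : ℝ} {Ω : Set X} (h : IsRegularDomain m P α C l Ω) :
    0 < m.real Ω ∧ ∃ F : ℕ → Finset (Set X), (∀ k, F k ⊆ P k) ∧
      (∀ k, (F k).Nonempty → k0 P Ω ≤ k ∧
        ∑ Q ∈ F k, m.real Q ^ α ≤ C * l ^ (k - k0 P Ω) * m.real Ω ^ α) ∧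
      (∀ k, ∀ W ∈ F k, W ⊆ Ω) ∧
      ∀ x ∈ Ω, ∃ k, ∃ W ∈ F k, x ∈ W ∧ ∀ k', ∀ W' ∈ F k', x ∈ W' → k' = k ∧ W' = W := by
  classical
  obtain ⟨⟨k, Q, hQ, hQΩ⟩, F, hF, hΩ, hdisj, hsum⟩ := h
  have hmem : ∀ k, ∀ W, W ∈ (if k0 P Ω ≤ k then F k else ∅) ↔ k0 P Ω ≤ k ∧ W ∈ F k := fun k W => by
    split_ifs with h <;> simp [h]
  refine ⟨?_, fun k => if k0 P Ω ≤ k then F k else ∅, fun k W hW => ?_, fun k hk => ?_,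
    fun k W hW => ?_, fun x hx => ?_⟩
  · exact ENNReal.toReal_pos ((hP.pos k Q hQ).trans_le (measure_mono hQΩ)).ne' (measure_ne_top m Ω)
  · obtain ⟨h1, h2⟩ := (hmem k W).1 hW
    exact hF k h1 h2
  · have h1 : k0 P Ω ≤ k := by
      obtain ⟨W, hW⟩ := hk
      exact ((hmem k W).1 hW).1
    refine ⟨h1, ?_⟩
    simp only [if_pos h1]
    exact hsum k h1
  · obtain ⟨h1, h2⟩ := (hmem k W).1 hW
    intro x hx
    rw [hΩ]
    simp only [Set.mem_iUnion]
    exact ⟨k, h1, W, h2, hx⟩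
  · rw [hΩ] at hx
    simp only [Set.mem_iUnion] at hx
    obtain ⟨k, h1, W, h2, hxW⟩ := hx
    refine ⟨k, W, (hmem k W).2 ⟨h1, h2⟩, hxW, fun k' W' hW' hxW' => ?_⟩
    obtain ⟨h1', h2'⟩ := (hmem k' W').1 hW'
    have hWW : W' = W := by
      by_contra hne
      exact Set.disjoint_left.1 (hdisj k' h1' k h1 W' h2' W h2 hne) hxW' hxW
    subst hWW
    exact ⟨hP.level_unique (hF k' h1' h2') (hF k h1 h2), rfl⟩

theorem extendZero_of_mem {Y : Type*} {J : Set Y} {g : J → ℂ} {y : Y} (hy : y ∈ J) : extendZero g y = g ⟨y, hy⟩ :=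
  Subtype.val_injective.extend_apply g 0 (⟨y, hy⟩ : J)

theorem extendZero_of_notMem {Y : Type*} {J : Set Y} {g : J → ℂ} {y : Y} (hy : y ∉ J) : extendZero g y = 0 := by
  rw [extendZero, Function.extend_apply']
  · rfl
  · rintro ⟨z, rfl⟩
    exact hy z.2

section Preim

variable {X Y : Type*} [MeasurableSpace X] [MeasurableSpace Y] {I : Set X} {J : Set Y}
  {h : J ≃ᵐ I}

theorem mem_preim {Q : Set X} {y : Y} : y ∈ preim h Q ↔ ∃ hy : y ∈ J, (h ⟨y, hy⟩ : X) ∈ Q := by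
  simp [preim]

theorem preim_subset (Q : Set X) : preim h Q ⊆ J := fun _ hy => (mem_preim.1 hy).1

/-- Nonsingularity of h. It is assumed only for measurable subsets of I, so the exceptional set is
first enlarged to a measurable null set. -/
theorem IsBranch.ae_pullback {m : Measure X} {μ : Measure Y} {P : ℕ → Finset (Set X)}
    {H : ℕ → Finset (Set Y)} {s p a e DGD1 DGD2 DC1 DC2 : ℝ} {G : ℕ → Finset (Set X)}
    (hB : IsBranch m μ P H s p a e DGD1 DGD2 DC1 DC2 G h) {φ : X → Prop} (hφ : ∀ᵐ x ∂m, φ x) :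
    ∀ᵐ y ∂μ, ∀ hy : y ∈ J, φ (h ⟨y, hy⟩) := by
  set N := toMeasurable m {x | ¬ φ x} ∩ I with hN
  have h0 : m N = 0 := measure_mono_null Set.inter_subset_left
    ((measure_toMeasurable _).trans hφ)
  have h1 := (hB.null_iff N ((measurableSet_toMeasurable _ _).inter hB.measurableSet_I)
    Set.inter_subset_right).1 h0
  rw [ae_iff]
  refine measure_mono_null (fun y hy => ?_) h1
  simp only [not_forall, Set.mem_ofPred_eq] at hy
  obtain ⟨hy, hφy⟩ := hy
  exact mem_preim.2 ⟨hy, subset_toMeasurable m _ hφy, (h ⟨y, hy⟩).2⟩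

end Preim

end GoodGridBesov

/-! ### Overlaps of branches and the weights of cells -/

namespace GoodGridBesov

namespace TransferData

variable {X : Type*} [MeasurableSpace X] {m : Measure X} {P : ℕ → Finset (Set X)}
  {l₁ l₂ : ℝ} {p s β ε γ : ℝ} {q : ℝ≥0∞}
  {Λ : Type*} {T : TransferData X X Λ}

/-- Jensen with the indicator of {r | W ⊆ J_r} as weight, of total mass at most the overlap. For p =
1 the factor is 1 even when the overlap is ∞. -/
theorem tsum_rpow_le_overlap (hp : 1 ≤ p) {k : ℕ} {W : Set X} (hW : W ∈ P k) (z : Λ → ℝ≥0∞)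
    (hz : ∀ r, z r ≠ 0 → W ⊆ T.J r) :
    (∑' r, z r) ^ p ≤ ((T.overlap P : ℕ∞) : ℝ≥0∞) ^ (p - 1) * ∑' r, z r ^ p := by
  classical
  set w : Λ → ℝ≥0∞ := {r | W ⊆ T.J r}.indicator 1 with hw
  have hwz : ∀ r, ∀ u : ℝ≥0∞, (u ≠ 0 → z r ≠ 0) → w r * u = u := fun r u hu => by
    by_cases h0 : u = 0
    · simp [h0]
    · have : r ∈ {r | W ⊆ T.J r} := hz r (hu h0)
      simp [hw, Set.indicator_of_mem this]
  have hN : ∑' r, w r ≤ ((T.overlap P : ℕ∞) : ℝ≥0∞) := by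
    rw [hw, ← tsum_subtype {r | W ⊆ T.J r} (1 : Λ → ℝ≥0∞)]
    simp only [Pi.one_apply]
    rw [ENNReal.tsum_set_one]
    have h : {r : Λ | W ⊆ T.J r}.encard ≤ T.overlap P :=
      (le_iSup₂ (f := fun W (_ : W ∈ P k) => {r : Λ | W ⊆ T.J r}.encard) W hW).trans
        (le_iSup (fun k => ⨆ W ∈ P k, {r : Λ | W ⊆ T.J r}.encard) k)
    exact_mod_cast h
  have h := tsum_mul_rpow_le w z hp
  rw [tsum_congr fun r => hwz r (z r) id, tsum_congr fun r => hwz r (z r ^ p) fun hne h0 =>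
    hne (by rw [h0, ENNReal.zero_rpow_of_pos (by linarith)])] at h
  refine h.trans (mul_le_mul' (ENNReal.rpow_le_rpow hN (by linarith)) le_rfl)

/-- The bound of the coefficients over cells by those of the slicing. -/
theorem mixNorm_le_of_slicing [Countable Λ] (hp : 1 ≤ p) (hq : 1 ≤ q) (z : Λ → ℕ → ℕ → Set X → ℝ≥0∞)
    (θ : Λ → ℝ≥0∞) (C : Λ → ℕ → ℝ≥0∞) (ρ : ℝ≥0∞)
    (hz : ∀ r j k, (∑ W ∈ P k, z r j k W ^ p) ^ (1 / p) ≤ θ r * symmKernel ρ k j * C r j)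
    (hJ : ∀ r j k, ∀ W ∈ P k, z r j k W ≠ 0 → W ⊆ T.J r) {B : ℝ≥0∞}
    (hB : lqNorm q (fun j => ∑' r, θ r * C r j) ≤ B ∨
      ((T.overlap P : ℕ∞) : ℝ≥0∞) ^ (1 - 1 / p) *
        lqNorm q (fun j => (∑' r, θ r ^ p * C r j ^ p) ^ (1 / p)) ≤ B) :
    mixNorm P p q (fun k W => ∑' r, ∑' j, z r j k W) ≤ (2 * ∑' i, ρ ^ i) * B := by
  have hp0 : 0 < p := by linarith
  -- Schur's test for the symmetric kernel reduces the claim to one pair of levels (k, j) at a time.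
  have key : ∀ u : ℕ → ℝ≥0∞, (∀ k j, (∑ W ∈ P k, (∑' r, z r j k W) ^ p) ^ (1 / p) ≤
      symmKernel ρ k j * u j) →
      mixNorm P p q (fun k W => ∑' r, ∑' j, z r j k W) ≤ (2 * ∑' i, ρ ^ i) * lqNorm q u := by
    intro u hu
    refine le_trans (lqNorm_mono fun k => ?_) (lqNorm_kernel_le hq (symmKernel ρ)
      (tsum_symmKernel_le ρ) (fun j => ?_) u)
    · have e : ∀ W, ∑' r, ∑' j, z r j k W = ∑' j, ∑' r, z r j k W := fun W => ENNReal.tsum_comm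
      simp only [e]
      exact (sum_tsum_rpow_le (P k) (fun j W => ∑' r, z r j k W) hp).trans
        (ENNReal.tsum_le_tsum fun j => hu k j)
    · simpa only [symmKernel_comm ρ _ j] using tsum_symmKernel_le ρ j
  rcases hB with hB | hB
  · refine (key _ fun k j => ?_).trans (mul_le_mul' le_rfl hB)
    -- First form of slicing: Minkowski over the branches.
    refine (sum_tsum_rpow_le (P k) (fun r W => z r j k W) hp).trans ?_
    rw [← ENNReal.tsum_mul_left]
    refine ENNReal.tsum_le_tsum fun r => (hz r j k).trans_eq ?_
    ring
  · rw [← lqNorm_const_mul hq] at hB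
    refine (key _ fun k j => ?_).trans (mul_le_mul' le_rfl hB)
    set N := ((T.overlap P : ℕ∞) : ℝ≥0∞)
    -- Second form: on each W Jensen costs a power of the overlap, after which p-th powers add over
    -- the branches.
    calc (∑ W ∈ P k, (∑' r, z r j k W) ^ p) ^ (1 / p)
        ≤ (∑ W ∈ P k, N ^ (p - 1) * ∑' r, z r j k W ^ p) ^ (1 / p) := by
          refine ENNReal.rpow_le_rpow (Finset.sum_le_sum fun W hW => ?_) (by positivity)
          exact tsum_rpow_le_overlap hp hW _ fun r => hJ r j k W hW
      _ = (N ^ (p - 1) * ∑' r, ∑ W ∈ P k, z r j k W ^ p) ^ (1 / p) := by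
          have e : ∑' r, ∑ W ∈ P k, z r j k W ^ p = ∑ W ∈ P k, ∑' r, z r j k W ^ p :=
            Summable.tsum_finsetSum fun W _ => ENNReal.summable
          rw [e, Finset.mul_sum]
      _ ≤ (N ^ (p - 1) * ∑' r, (θ r * symmKernel ρ k j * C r j) ^ p) ^ (1 / p) := by
          refine ENNReal.rpow_le_rpow (mul_le_mul' le_rfl (ENNReal.tsum_le_tsum fun r => ?_))
            (by positivity)
          rw [← ENNReal.rpow_inv_le_iff hp0, ← one_div]
          exact hz r j k
      _ = (N ^ (p - 1) * (symmKernel ρ k j ^ p * ∑' r, θ r ^ p * C r j ^ p)) ^ (1 / p) := by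
          have e : ∀ r, (θ r * symmKernel ρ k j * C r j) ^ p =
              symmKernel ρ k j ^ p * (θ r ^ p * C r j ^ p) := fun r => by
            rw [ENNReal.mul_rpow_of_nonneg _ _ hp0.le, ENNReal.mul_rpow_of_nonneg _ _ hp0.le]
            ring
          rw [tsum_congr e, ENNReal.tsum_mul_left]
      _ = _ := by
          rw [ENNReal.mul_rpow_of_nonneg _ _ (by positivity),
            ENNReal.mul_rpow_of_nonneg _ _ (by positivity), ← ENNReal.rpow_mul, ← ENNReal.rpow_mul,
            mul_one_div_cancel hp0.ne', ENNReal.rpow_one, mul_left_comm]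
          congr 3
          field_simp

theorem Standing.lam_pos (hT : T.Standing m m P P s β p q ε) (r : Λ) : 0 < T.lam p ε r :=
  (Real.rpow_pos_of_pos (hT.branch r).DC2_pos ε).trans_le (le_max_left _ _)

theorem Standing.lam_le_lamSup (hT : T.Standing m m P P s β p q ε) (r : Λ) :
    T.lam p ε r ≤ T.lamSup p ε :=
  le_ciSup (f := T.lam p ε) ⟨1, by rintro _ ⟨r, rfl⟩; exact (hT.lam_lt_one r).le⟩ r

theorem Standing.lamSup_nonneg (hT : T.Standing m m P P s β p q ε) : 0 ≤ T.lamSup p ε :=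
  Real.iSup_nonneg fun r => (hT.lam_pos r).le

theorem Standing.lamSup_rpow_lt_one (hT : T.Standing m m P P s β p q ε) (hγ : 0 < γ) :
    T.lamSup p ε ^ γ < 1 :=
  Real.rpow_lt_one hT.lamSup_nonneg hT.lamSup_lt_one hγ

theorem Standing.constD_pos (hT : T.Standing m m P P s β p q ε) (hγ : 0 < γ) :
    0 < T.constD p ε γ :=
  div_pos two_pos (sub_pos.2 (hT.lamSup_rpow_lt_one hγ))

/-- Identifies the constant D with the Schur bound of the kernel λ^(γ |k - j|). -/
theorem Standing.two_mul_tsum_eq (hT : T.Standing m m P P s β p q ε) (hγ : 0 < γ) :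
    2 * ∑' i, ENNReal.ofReal (T.lamSup p ε ^ γ) ^ i = ENNReal.ofReal (T.constD p ε γ) := by
  have h := sub_pos.2 (hT.lamSup_rpow_lt_one hγ)
  rw [ENNReal.tsum_geometric, constD, ENNReal.ofReal_div_of_pos h, ENNReal.div_eq_inv_mul, mul_comm,
    ENNReal.ofReal_sub _ (Real.rpow_nonneg hT.lamSup_nonneg γ)]
  simp

variable [IsProbabilityMeasure m]

/-- The decomposition of `h_r⁻¹(Q)` into cells, with the resulting bounds. -/
theorem Standing.exists_cell_family (hT : T.Standing m m P P s β p q ε)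
    (hP : IsGoodGrid m P l₁ l₂) (hp : 1 ≤ p) (hq : 1 ≤ q) (hε : 0 < ε) (hγ : 0 < γ) (hγ1 : γ ≤ 1)
    (hβ : 0 < β) (r : Λ) {j : ℕ} {Q : Set X} (hQ : Q ∈ T.G r j) :
    ∃ (F : ℕ → Finset (Set X)) (K : ℝ), (∀ k, F k ⊆ P k) ∧
      (∀ k, ∀ W ∈ F k, W ⊆ preim (T.h r) Q) ∧
      (∀ x ∈ preim (T.h r) Q, ∃ k, ∃ W ∈ F k, x ∈ W ∧
        ∀ k', ∀ W' ∈ F k', x ∈ W' → k' = k ∧ W' = W) ∧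
      (∀ k, ∀ W ∈ F k, besovNormOn m P β p q W (fun x => ((m.real Q ^ (s - 1 / p) : ℝ) : ℂ) *
        W.indicator (extendZero (T.g r)) x) ≤ ENNReal.ofReal K * m W ^ (1 / p - β)) ∧
      ∀ k, (∑ W ∈ F k, (ENNReal.ofReal K * m W ^ (1 / p - s)) ^ p) ^ (1 / p) ≤
        ENNReal.ofReal (T.Theta p ε γ r) *
          symmKernel (ENNReal.ofReal (T.lamSup p ε ^ γ)) k j := by
  have hp0 : 0 < p := by linarith
  have hB := hT.branch r
  obtain ⟨ho, F, hFP, hFsum, hFsub, hFx⟩ := (hB.geometric j Q hQ).exists_family hP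
  have ha : 0 < m.real Q := ENNReal.toReal_pos (hB.grid.pos j Q hQ).ne' (measure_ne_top m Q)
  set Ω := preim (T.h r) Q with hΩ
  have hDRP := (hT.potential r).DRP_pos
  -- The bound for |Q|^(s - 1/p) g_r 1_W in B^β(W), with the factor |W|^(1/p - β) removed; it no
  -- longer depends on W.
  set K : ℝ := m.real Q ^ (s - 1 / p) *
    (T.DRP r * (m.real Q / m.real Ω) ^ (1 / p - s + T.e r)) with hK
  have hK0 : 0 ≤ K := by positivity
  refine ⟨F, K, hFP, hFsub, hFx, fun k W hW => ?_, fun k => ?_⟩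
  · refine (hP.besovNormOn_const_mul_le hp hq hβ _ _).trans ?_
    have h := (hT.potential r).norm_le k W (hFP k hW) j Q hQ
      ((hFsub k W hW).trans (preim_subset Q)) fun y hy => (mem_preim.1 (hFsub k W hW hy)).2
    have hW0 := hP.measure_ne_zero (hFP k hW)
    rw [ENNReal.ofReal_mul (by positivity), ofReal_measureReal_rpow hW0] at h
    refine (mul_le_mul' le_rfl h).trans_eq ?_
    rw [← mul_assoc, hK, ENNReal.ofReal_mul (p := m.real Q ^ (s - 1 / p)) (by positivity), ← ofReal_norm, Complex.norm_real,
      Real.norm_of_nonneg (by positivity)]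
  · rcases (F k).eq_empty_or_nonempty with hk | hk
    · simp [hk, hp0]
    obtain ⟨hk0, hS⟩ := hFsum k hk
    have hS0 : 0 ≤ ∑ W ∈ F k, m.real W ^ (1 - s * p) :=
      Finset.sum_nonneg fun W _ => by positivity
    have e1 : (∑ W ∈ F k, (ENNReal.ofReal K * m W ^ (1 / p - s)) ^ p) ^ (1 / p) =
        ENNReal.ofReal (K * (∑ W ∈ F k, m.real W ^ (1 - s * p)) ^ (1 / p)) := by
      rw [ENNReal.ofReal_mul hK0, ← ENNReal.ofReal_rpow_of_nonneg hS0 (by positivity),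
        ENNReal.ofReal_sum_of_nonneg fun W _ => by positivity]
      have e2 : ∀ W ∈ F k, (ENNReal.ofReal K * m W ^ (1 / p - s)) ^ p =
          ENNReal.ofReal K ^ p * ENNReal.ofReal (m.real W ^ (1 - s * p)) := fun W hW => by
        rw [ofReal_measureReal_rpow (hP.measure_ne_zero (hFP k hW)),
          ENNReal.mul_rpow_of_nonneg _ _ hp0.le, ← ENNReal.rpow_mul]
        congr 2
        field_simp
      rw [Finset.sum_congr rfl e2, ← Finset.mul_sum,
        ENNReal.mul_rpow_of_nonneg _ _ (by positivity), ← ENNReal.rpow_mul,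
        mul_one_div_cancel hp0.ne', ENNReal.rpow_one]
    have hκ := hB.scaling_le j Q hQ
    have hsc := hB.scaling j Q hQ
    rw [hB.grid_level j Q hQ] at hκ hsc
    -- The truncated differences add up to |k - j|, and the triangle inequality through k₀(h⁻¹ Q)
    -- applies.
    have hδ : (((k - j) + (j - k) : ℕ) : ℝ) ≤ |(j : ℝ) - (k0 P Ω : ℝ)| + ((k - k0 P Ω : ℕ) : ℝ) := by
      rw [Nat.cast_sub hk0]
      have h1 := le_abs_self ((j : ℝ) - (k0 P Ω : ℝ))
      have h2 := neg_abs_le ((j : ℝ) - (k0 P Ω : ℝ))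
      have h3 : (k0 P Ω : ℝ) ≤ k := by exact_mod_cast hk0
      rcases le_total j k with h | h
      · rw [Nat.sub_eq_zero_of_le h, add_zero, Nat.cast_sub h]
        linarith
      · rw [Nat.sub_eq_zero_of_le h, zero_add, Nat.cast_sub h]
        linarith
    have hmain := branch_weight_le hp0 hε (hT.abs_e r) hγ.le hγ1 ha ho hS0 hB.DGD1_pos hB.DGD2_pos
      hB.DC1_pos hB.DC2_pos hDRP (hT.lam_lt_one r) (le_max_left _ _) (le_max_right _ _)
      (abs_nonneg _) hκ hδ hsc hS
    have hΘ : 0 ≤ T.Theta p ε γ r := by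
      have h1 := hB.DC1_pos
      have h2 := hB.DGD1_pos
      have h3 := hT.lam_pos r
      rw [Theta]
      positivity
    rw [e1, symmKernel, ← ENNReal.ofReal_pow (Real.rpow_nonneg hT.lamSup_nonneg γ),
      ← ENNReal.ofReal_mul hΘ]
    refine ENNReal.ofReal_le_ofReal (hmain.trans ?_)
    rw [← Real.rpow_natCast, ← Real.rpow_mul hT.lamSup_nonneg]
    refine mul_le_mul_of_nonneg_left ?_ hΘ
    exact Real.rpow_le_rpow (hT.lam_pos r).le (hT.lam_le_lamSup r) (by positivity)

end TransferData

end GoodGridBesov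

/-! ### The transfer transformation of a sliced series -/

namespace GoodGridBesov

namespace TransferData

variable {X : Type*} [MeasurableSpace X] {m : Measure X} {P : ℕ → Finset (Set X)}
  {l₁ l₂ : ℝ} {p s β ε γ : ℝ} {q : ℝ≥0∞}
  {Λ : Type*} {T : TransferData X X Λ}

/-- The family partitions Ω, so at each point of Ω exactly one cell of the family contains it. -/
theorem tsum_sum_family_eq {X : Type*} {P F : ℕ → Finset (Set X)} {Ω : Set X} [∀ k W, Decidable (W ∈ F k)]
    (hFP : ∀ k, F k ⊆ P k)
    (hFΩ : ∀ k, ∀ W ∈ F k, W ⊆ Ω) (hF : ∀ x ∈ Ω, ∃ k, ∃ W ∈ F k, x ∈ W ∧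
      ∀ k', ∀ W' ∈ F k', x ∈ W' → k' = k ∧ W' = W) (g : X → ℂ) (a : ℂ) (x : X) :
    ∑' k, ∑ W ∈ P k, (if W ∈ F k then a * W.indicator g x else 0) = a * Ω.indicator g x := by
  by_cases hx : x ∈ Ω
  · obtain ⟨k, W, hW, hxW, huniq⟩ := hF x hx
    rw [tsum_eq_single k, Finset.sum_eq_single_of_mem W (hFP k hW), if_pos hW,
      Set.indicator_of_mem hxW, Set.indicator_of_mem hx]
    · intro W' _ hne
      split_ifs with hW'
      · rw [Set.indicator_of_notMem fun hxW' => hne (huniq k W' hW' hxW').2, mul_zero]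
      · rfl
    · intro k' hne
      refine Finset.sum_eq_zero fun W' _ => ?_
      split_ifs with hW'
      · rw [Set.indicator_of_notMem fun hxW' => hne (huniq k' W' hW' hxW').1, mul_zero]
      · rfl
  · rw [Set.indicator_of_notMem hx, mul_zero]
    refine (tsum_congr fun k => Finset.sum_eq_zero fun W _ => ?_).trans tsum_zero
    split_ifs with hW
    · rw [Set.indicator_of_notMem fun hxW => hx (hFΩ k W hW hxW), mul_zero]
    · rfl

/-- The action of a branch on a function represented along its local grid. -/
theorem Standing.branchOp_ae_eq [Countable Λ] (hT : T.Standing m m P P s β p q ε) (hp : 1 ≤ p)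
    {f : X → ℂ} {c : Λ → ℕ → Set X → ℂ}
    (hc : ∀ r, IsRep m (T.G r) s p q (c r) ((T.I r).indicator f)) :
    ∀ᵐ x ∂m, ∀ r, T.branchOp r f x = ∑' j, ∑ Q ∈ T.G r j,
      c r j Q * ((m.real Q ^ (s - 1 / p) : ℝ) : ℂ) *
        (preim (T.h r) Q).indicator (extendZero (T.g r)) x := by
  rw [ae_all_iff]
  intro r
  filter_upwards [(hT.branch r).ae_pullback ((hT.branch r).grid.isRep_ae_eq hp (hc r))] with x hx
  by_cases hxJ : x ∈ T.J r
  · rw [branchOp, extendZero_of_mem hxJ]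
    have h := hx hxJ
    rw [Set.indicator_of_mem (T.h r ⟨x, hxJ⟩).2] at h
    rw [h, ← tsum_mul_left]
    refine tsum_congr fun j => ?_
    rw [Finset.mul_sum]
    refine Finset.sum_congr rfl fun Q _ => ?_
    by_cases hQ : (T.h r ⟨x, hxJ⟩ : X) ∈ Q
    · rw [souzaAtom, Set.indicator_of_mem hQ, Set.indicator_of_mem (mem_preim.2 ⟨hxJ, hQ⟩),
        extendZero_of_mem hxJ]
      ring
    · have hn : x ∉ preim (T.h r) Q := fun hmem => hQ (mem_preim.1 hmem).2
      rw [souzaAtom, Set.indicator_of_notMem hQ, Set.indicator_of_notMem hn]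
      ring
  · rw [branchOp, extendZero_of_notMem hxJ]
    symm
    refine (tsum_congr fun j => Finset.sum_eq_zero fun Q _ => ?_).trans tsum_zero
    rw [Set.indicator_of_notMem fun hmem => hxJ (preim_subset Q hmem), mul_zero]

variable [IsProbabilityMeasure m]

/-- The transfer transformation on a regularly sliced series. -/
theorem HasRegularSlicing.exists_isRep_transfer [Countable Λ] (hP : IsGoodGrid m P l₁ l₂)
    (hp : 1 ≤ p) (hq : 1 ≤ q) (hs : 0 < s) (hsβ : s < β) (hε : 0 < ε) (hγ : 0 < γ) (hγ1 : γ ≤ 1)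
    {CGBS : ℝ} (hC : IsGBSConstant m P s β p q CGBS) (hT : T.Standing m m P P s β p q ε)
    {C : ℝ} {d : ℕ → Set X → ℂ} (h : T.HasRegularSlicing m P P s p q ε γ C d) :
    ∃ f, IsRep m P s p q d f ∧ (∀ᵐ x ∂m, ∑' r, ‖T.branchOp r f x‖ₑ ≠ ∞) ∧
      ∃ z, IsRep m P s p q z (T.transfer f) ∧ coefNorm P p q z ≤
        ENNReal.ofReal CGBS * (ENNReal.ofReal (T.constD p ε γ) *
          (ENNReal.ofReal C * coefNorm P p q d)) := by
  classical
  have hp0 : 0 < p := by linarith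
  obtain ⟨-, f, hf, c, hc, hslice, -⟩ := h
  refine ⟨f, hf, ?_⟩
  -- The superposition is indexed by all triples (r, j, Q) with Q in the j-th family of G_r.
  choose F K hFP hFsub hFx hFn hFsum using fun i : (Σ r : Λ, Σ j : ℕ, {Q : Set X // Q ∈ T.G r j}) =>
    hT.exists_cell_family hP hp hq hε hγ hγ1 (hs.trans hsβ) i.1 (j := i.2.1) i.2.2.2
  set ρ := ENNReal.ofReal (T.lamSup p ε ^ γ) with hρ
  let v : (Σ r : Λ, Σ j : ℕ, {Q : Set X // Q ∈ T.G r j}) → ℕ → Set X → X → ℂ := fun i k W x =>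
    if W ∈ F i k then c i.1 i.2.1 i.2.2 * ((m.real i.2.2.1 ^ (s - 1 / p) : ℝ) : ℂ) *
      W.indicator (extendZero (T.g i.1)) x else 0
  -- The power 1/p - s is chosen so that multiplying by |W|^(s - β), the normalization of Besov
  -- atoms, gives back |W|^(1/p - β).
  let y : (Σ r : Λ, Σ j : ℕ, {Q : Set X // Q ∈ T.G r j}) → ℕ → Set X → ℝ≥0∞ := fun i k W =>
    if W ∈ F i k then ‖c i.1 i.2.1 i.2.2‖ₑ * (ENNReal.ofReal (K i) * m W ^ (1 / p - s)) else 0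
  have hyv : ∀ i k, ∀ W ∈ P k, besovNormOn m P β p q W (v i k W) ≤ y i k W * m W ^ (s - β) := by
    intro i k W hW
    by_cases hWF : W ∈ F i k
    · have h1 : v i k W = fun x => c i.1 i.2.1 i.2.2 * (((m.real i.2.2.1 ^ (s - 1 / p) : ℝ) : ℂ) *
          W.indicator (extendZero (T.g i.1)) x) := by
        ext x; simp only [v, if_pos hWF, mul_assoc]
      have h2 : y i k W = ‖c i.1 i.2.1 i.2.2‖ₑ * (ENNReal.ofReal (K i) * m W ^ (1 / p - s)) :=
        if_pos hWF
      rw [h1, h2]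
      refine (hP.besovNormOn_const_mul_le hp hq (hs.trans hsβ) _ _).trans ?_
      rw [mul_assoc, mul_assoc, measure_rpow_mul (hP.measure_ne_zero hW), sub_add_sub_cancel]
      exact mul_le_mul' le_rfl (hFn i k W hWF)
    · have h1 : v i k W = fun _ => 0 := by
        ext x; simp only [v, if_neg hWF]
      rw [h1, besovNormOn_zero hp hq]
      exact zero_le
  have hvm : ∀ i k, ∀ W ∈ P k, AEStronglyMeasurable (v i k W) m := by
    intro i k W hW
    by_cases hWF : W ∈ F i k
    · simp only [v, if_pos hWF]
      exact ((hT.potential i.1).aestronglyMeasurable.indicator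
        (hP.measurableSet k W hW)).const_mul _
    · simp only [v, if_neg hWF]
      exact aestronglyMeasurable_const
  have hvsupp : ∀ i k, ∀ W ∈ P k, ∀ x ∉ W, v i k W x = 0 := by
    intro i k W _ x hx
    simp [v, hx]
  have hymix : mixNorm P p q (fun k W => ∑' i, y i k W) ≤
      ENNReal.ofReal (T.constD p ε γ) * (ENNReal.ofReal C * coefNorm P p q d) := by
    rw [← hT.two_mul_tsum_eq hγ]
    have hsig : ∀ k W, ∑' i, y i k W =
        ∑' r, ∑' j, ∑ Q : {Q : Set X // Q ∈ T.G r j}, y ⟨r, j, Q⟩ k W := by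
      intro k W
      rw [ENNReal.tsum_sigma']
      refine tsum_congr fun r => ?_
      rw [ENNReal.tsum_sigma']
      exact tsum_congr fun j => tsum_fintype _
    simp only [hsig]
    refine mixNorm_le_of_slicing (T := T) hp hq
      (fun r j k W => ∑ Q : {Q : Set X // Q ∈ T.G r j}, y ⟨r, j, Q⟩ k W)
      (fun r => ENNReal.ofReal (T.Theta p ε γ r))
      (fun r j => (∑ Q ∈ T.G r j, ‖c r j Q‖ₑ ^ p) ^ (1 / p)) ρ ?_ ?_ ?_
    · intro r j k
      -- For fixed r and j the preimages of the Q are disjoint, so W belongs to the family of at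
      -- most one Q.
      have hone : ∀ W ∈ P k, (∑ Q : {Q : Set X // Q ∈ T.G r j}, y ⟨r, j, Q⟩ k W) ^ p =
          ∑ Q : {Q : Set X // Q ∈ T.G r j}, y ⟨r, j, Q⟩ k W ^ p := by
        intro W hW
        refine sum_rpow_of_subsingleton_support hp0 fun Q R hQ hR => ?_
        have hQ' : W ∈ F ⟨r, j, Q⟩ k := by
          by_contra hn; exact hQ (if_neg hn)
        have hR' : W ∈ F ⟨r, j, R⟩ k := by
          by_contra hn; exact hR (if_neg hn)
        obtain ⟨x, hx⟩ := hP.nonempty_of_mem hW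
        obtain ⟨hxJ, h1⟩ := mem_preim.1 (hFsub _ k W hQ' hx)
        obtain ⟨_, h2⟩ := mem_preim.1 (hFsub _ k W hR' hx)
        by_contra hne
        exact Set.disjoint_left.1 ((hT.branch r).grid_disjoint j Q Q.2 R R.2
          fun h => hne (Subtype.ext h)) h1 h2
      have hQsum : ∀ Q : {Q : Set X // Q ∈ T.G r j}, ∑ W ∈ P k, y ⟨r, j, Q⟩ k W ^ p ≤
          (ENNReal.ofReal (T.Theta p ε γ r) * symmKernel ρ k j) ^ p * ‖c r j Q‖ₑ ^ p := by
        intro Q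
        have h1 : ∑ W ∈ P k, y ⟨r, j, Q⟩ k W ^ p = ‖c r j Q‖ₑ ^ p *
            ∑ W ∈ F ⟨r, j, Q⟩ k, (ENNReal.ofReal (K ⟨r, j, Q⟩) * m W ^ (1 / p - s)) ^ p := by
          rw [Finset.mul_sum, ← Finset.sum_subset (hFP ⟨r, j, Q⟩ k)]
          · refine Finset.sum_congr rfl fun W hW => ?_
            simp only [y, if_pos hW]
            rw [ENNReal.mul_rpow_of_nonneg _ _ hp0.le]
          · intro W _ hW
            simp only [y, if_neg hW, ENNReal.zero_rpow_of_pos hp0]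
        rw [h1, mul_comm]
        refine mul_le_mul' ?_ le_rfl
        rw [← ENNReal.rpow_inv_le_iff hp0, ← one_div]
        exact hFsum ⟨r, j, Q⟩ k
      rw [Finset.sum_congr rfl hone, Finset.sum_comm]
      refine (ENNReal.rpow_le_rpow (Finset.sum_le_sum fun Q _ => hQsum Q) (by positivity)).trans_eq ?_
      rw [← Finset.mul_sum, ENNReal.mul_rpow_of_nonneg _ _ (by positivity), ← ENNReal.rpow_mul,
        mul_one_div_cancel hp0.ne', ENNReal.rpow_one, Finset.sum_coe_sort (T.G r j)
          fun Q => ‖c r j Q‖ₑ ^ p]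
    · intro r j k W _ hne
      obtain ⟨Q, -, hQ⟩ := Finset.exists_ne_zero_of_sum_ne_zero hne
      have hQ' : W ∈ F ⟨r, j, Q⟩ k := by
        by_contra hn; exact hQ (if_neg hn)
      exact (hFsub _ k W hQ').trans (preim_subset _)
    · refine hslice.imp id fun h => ?_
      simpa only [← ENNReal.rpow_mul, one_div_mul_cancel hp0.ne', ENNReal.rpow_one] using h
  have hdfin : ENNReal.ofReal (T.constD p ε γ) * (ENNReal.ofReal C * coefNorm P p q d) ≠ ∞ :=
    ENNReal.mul_ne_top ENNReal.ofReal_ne_top (ENNReal.mul_ne_top ENNReal.ofReal_ne_top hf.2)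
  obtain ⟨hae, hrep⟩ := hP.exists_isRep_of_besovNormOn_le hp hq hs hsβ hC hvm hvsupp hyv
    (ne_top_of_le_ne_top hdfin hymix)
  have hblock : ∀ i x, ∑' k, ∑ W ∈ P k, v i k W x =
      c i.1 i.2.1 i.2.2 * ((m.real i.2.2.1 ^ (s - 1 / p) : ℝ) : ℂ) *
        (preim (T.h i.1) i.2.2).indicator (extendZero (T.g i.1)) x := fun i x =>
    tsum_sum_family_eq (hFP i) (hFsub i) (hFx i) _ _ x
  have hpoint : ∀ᵐ x ∂m, (∑' i, ‖∑' k, ∑ W ∈ P k, v i k W x‖ₑ ≠ ∞) ∧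
      ∀ r, T.branchOp r f x =
        ∑' a : (Σ j : ℕ, {Q : Set X // Q ∈ T.G r j}), ∑' k, ∑ W ∈ P k, v ⟨r, a⟩ k W x := by
    filter_upwards [hae, hT.branchOp_ae_eq hp hc] with x h1 h2
    have h3 : ∑' i, ‖∑' k, ∑ W ∈ P k, v i k W x‖ₑ ≠ ∞ := by
      refine ne_top_of_le_ne_top h1 (ENNReal.tsum_le_tsum fun i => ?_)
      exact (enorm_tsum_le _).trans (ENNReal.tsum_le_tsum fun k => enorm_sum_le _ _)
    refine ⟨h3, fun r => ?_⟩
    rw [ENNReal.tsum_sigma'] at h3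
    have h4 := ENNReal.ne_top_of_tsum_ne_top h3 r
    rw [(summable_of_tsum_enorm_ne_top h4).tsum_sigma, h2 r]
    refine tsum_congr fun j => ?_
    simp only [hblock]
    rw [tsum_fintype, Finset.sum_coe_sort (T.G r j) fun Q =>
      c r j Q * ((m.real Q ^ (s - 1 / p) : ℝ) : ℂ) *
        (preim (T.h r) Q).indicator (extendZero (T.g r)) x]
  refine ⟨?_, ?_⟩
  · filter_upwards [hpoint] with x hx
    obtain ⟨h1, h2⟩ := hx
    rw [ENNReal.tsum_sigma'] at h1
    refine ne_top_of_le_ne_top h1 (ENNReal.tsum_le_tsum fun r => ?_)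
    rw [h2 r]
    exact enorm_tsum_le _
  · obtain ⟨z, hz, hzn⟩ := hrep (T.transfer f) (by
      filter_upwards [hpoint] with x hx
      obtain ⟨h1, h2⟩ := hx
      rw [transfer, (summable_of_tsum_enorm_ne_top h1).tsum_sigma]
      exact tsum_congr h2)
    exact ⟨z, hz, hzn.trans (mul_le_mul' le_rfl hymix)⟩

end TransferData

end GoodGridBesov

namespace GoodGridBesov

/-! ## The Lasota–Yorke inequality -/

theorem lqNorm_ne_top {q : ℝ≥0∞} {u : ℕ → ℝ≥0∞} {n : ℕ} (h0 : ∀ k, n ≤ k → u k = 0)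
    (hu : ∀ k, u k ≠ ∞) (hq : 1 ≤ q) : lqNorm q u ≠ ∞ := by
  unfold lqNorm
  split_ifs with h
  · refine ne_top_of_le_ne_top (ENNReal.sum_ne_top.2 fun k (_ : k ∈ Finset.range n) => hu k)
      (iSup_le fun k => ?_)
    rcases lt_or_ge k n with hk | hk
    · exact Finset.single_le_sum (f := u) (fun _ _ => zero_le) (Finset.mem_range.2 hk)
    · rw [h0 k hk]
      exact zero_le
  · have h1 := one_le_toReal_of_ne_top hq h
    refine ENNReal.rpow_ne_top_of_nonneg (by positivity) ?_
    rw [tsum_eq_sum (s := Finset.range n)]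
    · exact ENNReal.sum_ne_top.2 fun k _ => ENNReal.rpow_ne_top_of_nonneg (by linarith) (hu k)
    · intro k hk
      rw [h0 k (by simpa using hk), ENNReal.zero_rpow_of_pos (by linarith)]

section LasotaYorke

variable {X : Type*} [MeasurableSpace X] {m : Measure X} {P : ℕ → Finset (Set X)}
  {l₁ l₂ : ℝ} {p s β ε γ : ℝ} {q : ℝ≥0∞}

/-- The L¹ norm does not grow along the orbit, so each step adds at most the same K |f|_1, damped by
the later factors ρ. -/
theorem iterate_besovNorm_le {Φ : (X → ℂ) → X → ℂ} {K ρ : ℝ≥0∞}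
    (hΦ : ∀ f, MemBesov m P s p q f → MemBesov m P s p q (Φ f) ∧
      besovNorm m P s p q (Φ f) ≤ K * eLpNorm f 1 m + ρ * besovNorm m P s p q f)
    (h1 : ∀ f, MemBesov m P s p q f → eLpNorm (Φ f) 1 m ≤ eLpNorm f 1 m) (n : ℕ) {f : X → ℂ}
    (hf : MemBesov m P s p q f) :
    MemBesov m P s p q (Φ^[n] f) ∧ eLpNorm (Φ^[n] f) 1 m ≤ eLpNorm f 1 m ∧
      besovNorm m P s p q (Φ^[n] f) ≤ (K * ∑ i ∈ Finset.range n, ρ ^ i) * eLpNorm f 1 m +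
        ρ ^ n * besovNorm m P s p q f := by
  induction n with
  | zero => simp [hf]
  | succ n ih =>
    obtain ⟨ih1, ih2, ih3⟩ := ih
    rw [Function.iterate_succ_apply']
    refine ⟨(hΦ _ ih1).1, (h1 _ ih1).trans ih2, (hΦ _ ih1).2.trans ?_⟩
    calc _ ≤ K * eLpNorm f 1 m + ρ * ((K * ∑ i ∈ Finset.range n, ρ ^ i) * eLpNorm f 1 m +
          ρ ^ n * besovNorm m P s p q f) := by gcongr
      _ = _ := by
        rw [Finset.sum_range_succ', Finset.sum_congr rfl fun i _ => pow_succ' ρ i,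
          ← Finset.mul_sum]
        ring

/-- A divergent series has sum 0 by convention, so additivity needs the branch sums to converge
almost everywhere. Nonsingularity of the branches carries the almost-everywhere identity for f over
to each f ∘ h_r. -/
theorem TransferData.Standing.transfer_add_ae_eq {Λ : Type*}
    {T : TransferData X X Λ} [Countable Λ] (hT : T.Standing m m P P s β p q ε)
    {f f₁ f₂ : X → ℂ} (hf : f =ᵐ[m] fun x => f₁ x + f₂ x)
    (h₁ : ∀ᵐ x ∂m, ∑' r, ‖T.branchOp r f₁ x‖ₑ ≠ ∞)
    (h₂ : ∀ᵐ x ∂m, ∑' r, ‖T.branchOp r f₂ x‖ₑ ≠ ∞) :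
    T.transfer f =ᵐ[m] fun x => T.transfer f₁ x + T.transfer f₂ x := by
  have hb : ∀ᵐ x ∂m, ∀ r, T.branchOp r f x = T.branchOp r f₁ x + T.branchOp r f₂ x := by
    rw [ae_all_iff]
    intro r
    filter_upwards [(hT.branch r).ae_pullback hf] with x hx
    by_cases hxJ : x ∈ T.J r
    · rw [TransferData.branchOp, TransferData.branchOp, TransferData.branchOp, extendZero_of_mem hxJ, extendZero_of_mem hxJ,
        extendZero_of_mem hxJ, hx hxJ, mul_add]
    · rw [TransferData.branchOp, TransferData.branchOp, TransferData.branchOp, extendZero_of_notMem hxJ, extendZero_of_notMem hxJ,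
        extendZero_of_notMem hxJ, add_zero]
  filter_upwards [hb, h₁, h₂] with x hx hx₁ hx₂
  rw [TransferData.transfer, TransferData.transfer, TransferData.transfer,
    ← (summable_of_tsum_enorm_ne_top hx₁).tsum_add
    (summable_of_tsum_enorm_ne_top hx₂)]
  exact tsum_congr hx

variable [IsProbabilityMeasure m]

open scoped Classical in
theorem IsGoodGrid.mixNorm_finite_ne_top (hP : IsGoodGrid m P l₁ l₂) (hp : 1 ≤ p) (hq : 1 ≤ q)
    {P' : Finset (Set X)} (hP' : ∀ Q ∈ P', ∃ k, Q ∈ P k) :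
    mixNorm P p q (fun _ Q => if Q ∈ P' then 1 else 0) ≠ ∞ := by
  have hp0 : 0 < p := by linarith
  choose! n hn using hP'
  refine lqNorm_ne_top (n := P'.sup n + 1) (fun k hk => ?_) (fun k => ?_) hq
  · rw [Finset.sum_eq_zero, ENNReal.zero_rpow_of_pos (by positivity)]
    intro Q hQ
    dsimp only
    rw [if_neg, ENNReal.zero_rpow_of_pos hp0]
    intro hQ'
    have h1 := hP.level_unique hQ (hn Q hQ')
    have h2 := Finset.le_sup (f := n) hQ'
    omega
  · refine ENNReal.rpow_ne_top_of_nonneg (by positivity) (ENNReal.sum_ne_top.2 fun Q _ => ?_)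
    exact ENNReal.rpow_ne_top_of_nonneg hp0.le (by dsimp only; split_ifs <;> simp)

open scoped Classical in
-- The source of the weak norm: P' involves finitely many coefficients, each a bounded functional on
-- L¹. The level n Q is recovered from the cell, so only one functional per cell of P' matters.
theorem IsGoodGrid.exists_coefNorm_finite_le (hP : IsGoodGrid m P l₁ l₂) (hp : 1 ≤ p) (hq : 1 ≤ q)
    {P' : Finset (Set X)} (hP' : ∀ Q ∈ P', ∃ k, Q ∈ P k) (φ : ℕ → Set X → (Lp ℂ 1 m →L[ℂ] ℂ)) :
    ∃ K : ℝ≥0∞, K ≠ ∞ ∧ ∀ f : Lp ℂ 1 m,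
      coefNorm P p q (fun k Q => if Q ∈ P' then φ k Q f else 0) ≤ K * ‖f‖ₑ := by
  have hE := hP.mixNorm_finite_ne_top hp hq hP'
  choose! n hn using hP'
  set B : ℝ≥0∞ := ∑ Q ∈ P', ‖φ (n Q) Q‖ₑ with hB
  refine ⟨B * mixNorm P p q (fun _ Q => if Q ∈ P' then 1 else 0),
    ENNReal.mul_ne_top (ENNReal.sum_ne_top.2 fun Q _ => enorm_ne_top) hE, fun f => ?_⟩
  rw [mul_right_comm, ← mixNorm_const_mul hp hq]
  refine mixNorm_mono hp fun k Q hQ => ?_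
  dsimp only
  split_ifs with h
  · rw [mul_one, hP.level_unique hQ (hn Q h)]
    refine ((φ (n Q) Q).le_opENorm f).trans ?_
    gcongr
    exact Finset.single_le_sum (f := fun Q => ‖φ (n Q) Q‖ₑ) (fun _ _ => zero_le) h
  · simp

namespace TransferData

variable {Λ : Type*} {T : TransferData X X Λ}

/-- One step of the Lasota–Yorke inequality. -/
theorem HasEssentialSlicing.exists_besovNorm_transfer_le [Countable Λ] (hP : IsGoodGrid m P l₁ l₂)
    (hp : 1 ≤ p) (hq : 1 ≤ q) (hs : 0 < s) (hsβ : s < β) (hε : 0 < ε) (hγ : 0 < γ) (hγ1 : γ ≤ 1)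
    {CGBS CGC CFR CES : ℝ} (hC : IsGBSConstant m P s β p q CGBS) (hGC : IsGCConstant m P s p q CGC)
    (hT : T.Standing m m P P s β p q ε) (h : T.HasEssentialSlicing m P P s p q ε γ CFR CES) :
    ∃ K : ℝ≥0∞, K ≠ ∞ ∧ ∀ f : X → ℂ, MemBesov m P s p q f →
      MemBesov m P s p q (T.transfer f) ∧ besovNorm m P s p q (T.transfer f) ≤
        K * eLpNorm f 1 m +
          ENNReal.ofReal (CGBS * T.constD p ε γ * CES * CGC) * besovNorm m P s p q f := by
  classical
  obtain ⟨hGC1, φ, hφ⟩ := hGC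
  obtain ⟨P', hP', hslice⟩ := h
  obtain ⟨K, hK, hKf⟩ := hP.exists_coefNorm_finite_le hp hq hP' φ
  refine ⟨ENNReal.ofReal CGBS * (ENNReal.ofReal (T.constD p ε γ) * (ENNReal.ofReal CFR * K)),
    by finiteness, fun f hf => ?_⟩
  -- On a probability space L^p embeds in L¹, so the coefficient functionals apply to the class of
  -- f.
  have hf1 : MemLp f 1 m := by
    obtain ⟨c, hc⟩ := hf
    exact hc.1.mono_exponent (one_le_ofReal hp)
  have hae := hf1.coeFn_toLp
  have hfB : MemBesov m P s p q (hf1.toLp f) := by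
    obtain ⟨c, hc⟩ := hf
    exact ⟨c, hc.congr hae.symm⟩
  obtain ⟨hrep, hnorm⟩ := hφ (hf1.toLp f) hfB
  have hrep' := hrep.congr hae
  rw [besovNorm_congr hae] at hnorm
  set d : ℕ → Set X → ℂ := fun k Q => φ k Q (hf1.toLp f) with hd
  obtain ⟨hs₁, hs₂⟩ := hslice f d hrep'
  have hD := hT.constD_pos hγ
  have hCES := hs₁.1
  obtain ⟨f₁, hf₁, hb₁, z₁, hz₁, hzn₁⟩ :=
    hs₁.exists_isRep_transfer hP hp hq hs hsβ hε hγ hγ1 hC hT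
  obtain ⟨f₂, hf₂, hb₂, z₂, hz₂, hzn₂⟩ :=
    hs₂.exists_isRep_transfer hP hp hq hs hsβ hε hγ hγ1 hC hT
  have hsum : f =ᵐ[m] fun x => f₁ x + f₂ x := by
    filter_upwards [hP.isRep_ae_eq hp hrep',
      hP.isRep_ae_eq hp (hP.isRep_add hp hq hs hf₁ hf₂).1] with x h1 h2
    rw [h1, h2]
    refine tsum_congr fun k => Finset.sum_congr rfl fun Q _ => ?_
    by_cases hQ : Q ∈ P' <;> simp [hQ]
  have htr := hT.transfer_add_ae_eq hsum hb₁ hb₂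
  obtain ⟨hz, hzn⟩ := hP.isRep_add hp hq hs hz₁ hz₂
  have hz' := hz.congr htr.symm
  refine ⟨⟨_, hz'⟩, hz'.besovNorm_le.trans (hzn.trans ?_)⟩
  -- Setting coefficients to zero does not increase the norm, so the full GC bound serves for the
  -- part outside P'.
  have hd₁ : coefNorm P p q (fun k Q => if Q ∈ P' then 0 else d k Q) ≤
      ENNReal.ofReal CGC * besovNorm m P s p q f := by
    refine le_trans (mixNorm_mono hp fun k Q _ => ?_) hnorm
    dsimp only
    split_ifs <;> simp
  have hd₂ : coefNorm P p q (fun k Q => if Q ∈ P' then d k Q else 0) ≤ K * eLpNorm f 1 m := by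
    refine (hKf (hf1.toLp f)).trans_eq ?_
    rw [Lp.enorm_toLp]
  rw [add_comm (coefNorm P p q z₁)]
  refine add_le_add (hzn₂.trans ?_) (hzn₁.trans ?_)
  · simp only [mul_assoc]
    gcongr
  · rw [ENNReal.ofReal_mul (by have := hC.1; positivity), ENNReal.ofReal_mul (by
      have := hC.1; positivity), ENNReal.ofReal_mul hC.1.le]
    simp only [mul_assoc]
    gcongr

end TransferData

end LasotaYorke

end GoodGridBesov


theorem mainTheorem3 {X : Type*} [MeasurableSpace X] (m : MeasureTheory.Measure X)
    [MeasureTheory.IsProbabilityMeasure m]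
    (P : ℕ → Finset (Set X)) (l₁ l₂ : ℝ) (hP : GoodGridBesov.IsGoodGrid m P l₁ l₂)
    (p : ℝ) (q : ℝ≥0∞) (ε γ s β δ : ℝ)
    (hp : 1 ≤ p) (hq : 1 ≤ q) (hε : 0 < ε) (hγ : 0 < γ) (hγ1 : γ ≤ 1)
    (hs : 0 < s) (hsε : s + ε ≤ 1 / p) (hsβ : s < β) (hβ : β < 1 / p)
    (hδ : 0 < δ) (hδ' : δ < max s ε) :
    (∃ CGBS : ℝ, GoodGridBesov.IsGBSConstant m P s β p q CGBS) ∧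
    (∃ CGC : ℝ, GoodGridBesov.IsGCConstant m P s p q CGC) ∧
    ∀ CGBS CGC : ℝ, GoodGridBesov.IsGBSConstant m P s β p q CGBS →
      GoodGridBesov.IsGCConstant m P s p q CGC →
      ∀ (Λ : Set ℕ) (T : GoodGridBesov.TransferData X X Λ) (CFR CES : ℝ),
        T.Standing m m P P s β p q ε →
        T.BoundedFrom m m (p / (1 - s * p + δ * p)) →
        T.HasEssentialSlicing m P P s p q ε γ CFR CES →
        CGBS * T.constD p ε γ * CES * CGC < 1 →
        (∀ f : X → ℂ, GoodGridBesov.MemBesov m P s p q f →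
          eLpNorm (T.transfer f) 1 m ≤ eLpNorm f 1 m) →
        ∃ C : ℝ, 0 ≤ C ∧ ∀ (n : ℕ) (f : X → ℂ), GoodGridBesov.MemBesov m P s p q f →
          GoodGridBesov.MemBesov m P s p q (T.transfer^[n] f) ∧
          GoodGridBesov.besovNorm m P s p q (T.transfer^[n] f) ≤
            ENNReal.ofReal C * eLpNorm f 1 m +
              ENNReal.ofReal ((CGBS * T.constD p ε γ * CES * CGC) ^ n) *
                GoodGridBesov.besovNorm m P s p q f := by
  classical
  refine ⟨hP.exists_isGBSConstant hp hq hs hsβ,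
    hP.exists_isGCConstant hp hq hs (hsβ.le.trans hβ.le), ?_⟩
  intro CGBS CGC hC hGC Λ T CFR CES hT _ hslice hlt h1
  set κ := CGBS * T.constD p ε γ * CES * CGC with hκ
  obtain ⟨K, hK, hstep⟩ := hslice.exists_besovNorm_transfer_le hP hp hq hs hsβ hε hγ hγ1 hC hGC hT
  -- Nonnegativity of CES is part of a regular slicing, and the zero series provides one. It is
  -- needed to write ofReal (κ ^ n) as a power.
  have hκ0 : 0 ≤ κ := by
    obtain ⟨P', -, hs'⟩ := hslice
    have hzero : GoodGridBesov.IsRep m P s p q (fun _ _ => 0) (fun _ => 0) :=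
      (hP.isRep_iff hp hq hs).2 ⟨by simp [GoodGridBesov.coefNorm_zero hp hq], by simp⟩
    have hCES : 0 ≤ CES := (hs' _ _ hzero).1.1
    have hD := hT.constD_pos hγ
    have hC0 := hC.1
    have hGC1 := hGC.1
    positivity
  have hρ : ENNReal.ofReal κ < 1 := by simpa using hlt
  have hS := GoodGridBesov.geometric_ne_top hρ
  -- One-step weak constant times the full geometric series, which bounds the partial sums for all n
  -- at once.
  refine ⟨(K * ∑' i, ENNReal.ofReal κ ^ i).toReal, ENNReal.toReal_nonneg, fun n f hf => ?_⟩
  obtain ⟨h2, -, h3⟩ := GoodGridBesov.iterate_besovNorm_le hstep h1 n hf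
  refine ⟨h2, h3.trans ?_⟩
  rw [ENNReal.ofReal_toReal (ENNReal.mul_ne_top hK hS), ENNReal.ofReal_pow hκ0]
  gcongr
  exact ENNReal.sum_le_tsum _
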